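/- A sequential specification $Spec$ is the set of finite traces of a labelled transition system whose labels are operations $m(a)\Rightarrow b$ (method $m$, argument $a$, return value $b$). It is deterministic (resp. non-blocking) if in this transition system each state has, for each $m$ and $a$, at most (resp. at least) one transition with a label of the form $m(a)\Rightarrow\cdot$. The object $\mathcal U_{Spec}$ for $n$ processes $P_0,\dots,P_{n-1}$ keeps a linked list of nodes with fields $(oid,m,a,hist,lin,decideNext,seq,next)$, where $decideNext$ is a consensus object ($decide(x)$ returns the argument of the first call). In a new node $seq=0$, $decideNext$ is undecided, and $hist,lin,next$ are null. The list starts with a sentinel node $tail$, which belongs to no operation and has $seq=1$; all entries of the arrays $head[0..n-1]$ and $announce[0..n-1]$ initially point to $tail$. A history recorder holds a finite sequence of call and return actions, initially empty; $storeCall$ and $storeReturn$ append an action and $read$ returns the sequence. An identity generator returns a fresh identity at each call. The consensus objects, the recorder and the generator are atomic. An operation $m(a)$ of process $pid$ runs the following code. 1. $oid:=genID()$; $storeCall(m,a,pid,oid)$; $announce[pid]:=$ new node for $(m,a,oid)$; $head[pid]:=$ a node of maximal $seq$ among the entries of $head$, which are read one after the other. 2. While $announce[pid].seq=0$: $before:=head[pid]$;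 $help:=announce[(before.seq+1)\bmod n]$; $prefer:=help$ if $help.seq=0$, and $prefer:=announce[pid]$ otherwise; $after:=before.decideNext.decide(prefer)$; $h_1:=read()$; $cas(after.hist,null,h_1)$; $l:=genLin()$; $cas(after.lin,null,l)$; $before.next:=after$; $after.seq:=before.seq+1$; $head[pid]:=after$. 3. $head[pid]:=announce[pid]$; $b:=getRetValue(oid)$; $storeReturn(m,b,pid,oid)$; return $b$. Here $genLin()$ reads $h=after.hist$, walks along the list from $tail$ to $before$, and returns a nondeterministically chosen linearization $l$ of $h$ w.r.t. $Spec$ such that (1) $l$ contains the operation of $after$, and (2) for each node $nod\neq tail$ of the list from $tail$ to $before$, $l$ contains the operation of $nod$, with the return value that this operation has in $nod.lin$. $getRetValue(oid)$ walks along the list from $tail$ to the node with identity $oid$ and returns the return value of $oid$ in the $lin$-field of that node. A finite history $h$ (in which the calls and matching returns of each process alternate, starting with a call) is linearizable w.r.t. $Spec$ if there are an extension $h'$ of $h$ by zero or more return actions and a sequential history $s$ of operations of the $n$ processes whose sequence of operations is in $Spec$, such that $complete(h')$ ($h'$ without its pending calls) and $s$ have the same process subhistories, and for all operations $o_1,o_2$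 of $s$, if the return of $o_1$ precedes the call of $o_2$ in $h$, then it does so in $s$; $s$ is then called a linearization of $h$. In the executions of an object with $n$ processes, each process repeatedly calls arbitrary methods with arbitrary arguments, and the atomic steps of the processes interleave arbitrarily. The object is linearizable w.r.t. $Spec$ for $n$ processes if the sequence of call and return actions of each finite execution is linearizable w.r.t. $Spec$. It is wait-free for $n$ processes if each call returns after finitely many steps of the calling process, whatever the other processes do: in each infinite execution, every call by a process that takes infinitely many steps returns, and in each reachable configuration every process with a pending call can take a step. Lemma. Let $Spec$ be a deterministic and non-blocking sequential specification. Then for every $n$ the object $\mathcal U_{Spec}$ is wait-free for $n$ processes and linearizable w.r.t. $Spec$ for $n$ processes. -/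

import Mathlib

namespace UnivConstr

/-! ### Labelled transition systems and sequential specifications -/

/-- A labelled transition system with states `Q` and labels `L`. -/
structure LTS (Q L : Type*) where
  init : Q
  trans : Q → L → Q → Prop

/-- `A.Run q t q'`: there is a finite path from `q` to `q'` whose labels form the list `t`. -/
inductive LTS.Run {Q L : Type*} (A : LTS Q L) : Q → List L → Q → Prop
  | nil (q : Q) : A.Run q [] q
  | cons {q q₁ q₂ : Q} {x : L} {t : List L} :
      A.trans q x q₁ → A.Run q₁ t q₂ → A.Run q (x :: t) q₂

/-- The finite traces of an LTS. -/
def LTS.traces {Q L : Type*} (A : LTS Q L) : Set (List L) :=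
  {t | ∃ q, A.Run A.init t q}

/-- The states that lie on some finite path of an LTS. -/
def LTS.Reachable {Q L : Type*} (A : LTS Q L) (q : Q) : Prop :=
  ∃ t, A.Run A.init t q

/-- The infinite paths of an LTS: the states `c i` and the labels `x i`. -/
def LTS.InfinitePath {Q L : Type*} (A : LTS Q L) (c : ℕ → Q) (x : ℕ → L) : Prop :=
  c 0 = A.init ∧ ∀ i, A.trans (c i) (x i) (c (i + 1))

/-- An operation `m(a) ⇒ b`. -/
structure Operation (M A B : Type*) where
  meth : M
  arg : A
  res : B

/-- From each state, for each `m` and `a`, there is at most one transition labelled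
`m(a) ⇒ _`. -/
def LTS.Deterministic {Q M A B : Type*} (S : LTS Q (Operation M A B)) : Prop :=
  ∀ (q : Q) (m : M) (a : A) (b₁ b₂ : B) (q₁ q₂ : Q),
    S.trans q ⟨m, a, b₁⟩ q₁ → S.trans q ⟨m, a, b₂⟩ q₂ → b₁ = b₂ ∧ q₁ = q₂

/-- From each state, for each `m` and `a`, there is at least one transition labelled
`m(a) ⇒ _`. -/
def LTS.NonBlocking {Q M A B : Type*} (S : LTS Q (Operation M A B)) : Prop :=
  ∀ (q : Q) (m : M) (a : A), ∃ (b : B) (q' : Q), S.trans q ⟨m, a, b⟩ q'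

/-! ### Histories and linearizations

Actions carry an identity in `I`. The actions of a trace have no identity (`I = Unit`);
those kept by a history recorder carry the operation identity (`I = ℕ`). -/

/-- Call and return actions of the `n` processes. -/
inductive Action (n : ℕ) (I M A B : Type*) where
  | call (p : Fin n) (o : I) (m : M) (a : A)
  | ret (p : Fin n) (o : I) (m : M) (b : B)

section histories

variable {n : ℕ} {I M A B : Type*}

def Action.proc : Action n I M A B → Fin n
  | .call p _ _ _ => p
  | .ret p _ _ _ => p

def Action.isCall : Action n I M A B → Bool
  | .call _ _ _ _ => true
  | .ret _ _ _ _ => false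

def Action.isRet : Action n I M A B → Bool
  | .call _ _ _ _ => false
  | .ret _ _ _ _ => true

/-- The process subhistory `h|_p`. -/
def proj (p : Fin n) (h : List (Action n I M A B)) : List (Action n I M A B) :=
  h.filter (fun x => x.proc = p)

/-- Calls and matching returns alternate, starting with a call; the last call may be pending. -/
inductive Alternating : List (Action n I M A B) → Prop
  | nil : Alternating []
  | pending (p : Fin n) (o : I) (m : M) (a : A) : Alternating [.call p o m a]
  | cons (p : Fin n) (o : I) (m : M) (a : A) (b : B) (t : List (Action n I M A B)) :
      Alternating t → Alternating (.call p o m a :: .ret p o m b :: t)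

/-- Well-formed histories: in each process subhistory, calls and matching returns alternate. -/
def IsHistory (h : List (Action n I M A B)) : Prop :=
  ∀ p, Alternating (proj p h)

/-- Remove the pending calls. In a well-formed history these are the calls that are not
followed by any action of the same process. -/
def complete : List (Action n I M A B) → List (Action n I M A B)
  | [] => []
  | x :: t =>
      if x.isCall && t.all (fun y => y.proc ≠ x.proc) then complete t else x :: complete t

/-- Two histories are equivalent if all their process subhistories agree. -/
def HEquiv (h h' : List (Action n I M A B)) : Prop :=
  ∀ p, proj p h = proj p h'

/-- An operation together with its process and its identity. -/
structure ProcOp (n : ℕ) (I M A B : Type*) where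
  proc : Fin n
  tag : I
  op : Operation M A B

/-- The sequential history of a sequence of operations. -/
def seqHistory (s : List (ProcOp n I M A B)) : List (Action n I M A B) :=
  s.flatMap (fun x =>
    [.call x.proc x.tag x.op.meth x.op.arg, .ret x.proc x.tag x.op.meth x.op.res])

/-- The happen-before relation `<_h`. The pair `(p, k)` stands for the `k`-th operation of
process `p` (counted from `0`): the `k`-th return of `p` occurs in `h` before the `j`-th call
of `q`. -/
def HappensBefore (h : List (Action n I M A B)) (p : Fin n) (k : ℕ) (q : Fin n) (j : ℕ) :
    Prop :=
  ∃ (i i' : ℕ) (x y : Action n I M A B), i < i' ∧ h[i]? = some x ∧ h[i']? = some y ∧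
    x.isRet = true ∧ x.proc = p ∧ (h.take i).countP (fun z => z.isRet && z.proc = p) = k ∧
    y.isCall = true ∧ y.proc = q ∧ (h.take i').countP (fun z => z.isCall && z.proc = q) = j

/-- `s` is a linearization of `h` with respect to `Spec`: it is a sequence of operations in
`Spec`, each given to a process; some extension `h ++ ext` of `h` by returns is a history whose
completed part is equivalent to the sequential history of `s`; and `s` keeps the happen-before
order of `h` between operations that occur in `s` (an operation that has returned in `h` always
does; one that is pending in `h` does if `ext` completes it). -/
def IsLinearization (Spec : Set (List (Operation M A B))) (h : List (Action n I M A B))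
    (s : List (ProcOp n I M A B)) : Prop :=
  s.map (fun x => x.op) ∈ Spec ∧
  (∃ ext : List (Action n I M A B), (∀ x ∈ ext, x.isRet = true) ∧ IsHistory (h ++ ext) ∧
    HEquiv (complete (h ++ ext)) (seqHistory s)) ∧
  ∀ (p : Fin n) (k : ℕ) (q : Fin n) (j : ℕ), HappensBefore h p k q j →
    j < s.countP (fun x => x.proc = q) → HappensBefore (seqHistory s) p k q j

end histories

/-! ### Concurrent objects and their operational semantics -/

/-- A concurrent object for `n` processes, with shared states `S` and local states `L`:
the initial shared state, the local state in which `p` starts the body of method `m` with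
argument `a`, the atomic internal steps of a method body, and the local states in which a body
is about to return a value. -/
structure ConcObject (n : ℕ) (M A B S L : Type*) where
  init : S
  start : Fin n → M → A → L
  step : Fin n → S → L → S → L → Prop
  returns : L → B → Prop

/-- Transition labels: call and return actions, and internal steps of a process. -/
inductive Label (n : ℕ) (M A B : Type*) where
  | act (x : Action n Unit M A B)
  | internal (p : Fin n)

def Label.proc {n : ℕ} {M A B : Type*} : Label n M A B → Fin n
  | .act x => x.proc
  | .internal p => p

/-- Configurations: the shared state and, for each process, either `none` (idle: no operation is
pending) or the current method and the local state of its body. -/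
structure Config (n : ℕ) (M S L : Type*) where
  shared : S
  loc : Fin n → Option (M × L)

section objects

variable {n : ℕ} {M A B S L : Type*}

/-- The transitions of `n` processes that each run a most general client. -/
inductive ConcObject.Trans (O : ConcObject n M A B S L) :
    Config n M S L → Label n M A B → Config n M S L → Prop
  | call (c : Config n M S L) (p : Fin n) (m : M) (a : A) :
      c.loc p = none →
      O.Trans c (.act (.call p () m a))
        ⟨c.shared, Function.update c.loc p (some (m, O.start p m a))⟩
  | step (c : Config n M S L) (p : Fin n) (m : M) (l l' : L) (s' : S) :
      c.loc p = some (m, l) → O.step p c.shared l s' l' →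
      O.Trans c (.internal p) ⟨s', Function.update c.loc p (some (m, l'))⟩
  | ret (c : Config n M S L) (p : Fin n) (m : M) (l : L) (b : B) :
      c.loc p = some (m, l) → O.returns l b →
      O.Trans c (.act (.ret p () m b)) ⟨c.shared, Function.update c.loc p none⟩

/-- The operational semantics `⟦O, n⟧`. -/
def ConcObject.semantics (O : ConcObject n M A B S L) : LTS (Config n M S L) (Label n M A B) where
  init := ⟨O.init, fun _ => none⟩
  trans := O.Trans

/-- The projection of a trace to its call and return actions. -/
def history (e : List (Label n M A B)) : List (Action n Unit M A B) :=
  e.filterMap (fun x => match x with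
    | .act y => some y
    | .internal _ => none)

/-- Every finite trace has a linearizable history. -/
def ConcObject.Linearizable (O : ConcObject n M A B S L) (Spec : Set (List (Operation M A B))) :
    Prop :=
  ∀ e ∈ O.semantics.traces, ∃ s, IsLinearization Spec (history e) s

/-- Each call returns after finitely many steps of the calling process, whatever the other
processes do: on each infinite path, a call by a process that takes infinitely many steps is
followed by a return of that process; and a process with a pending call is never stuck. -/
def ConcObject.WaitFree (O : ConcObject n M A B S L) : Prop :=
  (∀ (c : ℕ → Config n M S L) (x : ℕ → Label n M A B), O.semantics.InfinitePath c x →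
    ∀ (i : ℕ) (p : Fin n) (m : M) (a : A), x i = .act (.call p () m a) →
      (∀ N, ∃ k, N ≤ k ∧ (x k).proc = p) →
      ∃ (j : ℕ) (b : B), i < j ∧ x j = .act (.ret p () m b)) ∧
  (∀ c, O.semantics.Reachable c → ∀ p, c.loc p ≠ none →
    ∃ x c', O.semantics.trans c x c' ∧ x.proc = p)

end objects

/-! ### The universal construction

Nodes live in a heap and are referred to by natural numbers; `0` is the sentinel `tail`, the
first node of the linked list. The consensus objects, the history recorder and the identity
generator are atomic objects. -/

/-- A recorded history: its actions carry operation identities. -/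
abbrev RecHistory (n : ℕ) (M A B : Type*) := List (Action n ℕ M A B)

/-- A sequence of operations with their identities. -/
abbrev OpSeq (n : ℕ) (M A B : Type*) := List (ProcOp n ℕ M A B)

/-- An invocation `(m, a)` and the identity of the operation. -/
structure Invoc (M A : Type*) where
  oid : ℕ
  meth : M
  arg : A

/-- Nodes. The value `none` is the null value; the sentinel has no invocation. The consensus
object `decideNext` is represented by the decided node, if any. -/
structure Node (n : ℕ) (M A B : Type*) where
  inv : Option (Invoc M A)
  hist : Option (RecHistory n M A B)
  lin : Option (OpSeq n M A B)
  decideNext : Option ℕ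
  seq : ℕ
  next : Option ℕ

/-- A new node. -/
def Node.new {n : ℕ} {M A B : Type*} (v : Option (Invoc M A)) : Node n M A B where
  inv := v
  hist := none
  lin := none
  decideNext := none
  seq := 0
  next := none

/-- The shared memory. The addresses of the allocated nodes are those below `fresh`, `recorder`
is the content of the history recorder, and `usedIds` are the identities generated so far. -/
structure Mem (n : ℕ) (M A B : Type*) where
  heap : ℕ → Node n M A B
  fresh : ℕ
  announce : Fin n → ℕ
  head : Fin n → ℕ
  recorder : RecHistory n M A B
  usedIds : Finset ℕ

/-- Initially the list consists of the sentinel, with sequence number `1`, to which all entries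
of the two arrays point. -/
def Mem.init (n : ℕ) (M A B : Type*) : Mem n M A B where
  heap := Function.update (fun _ => Node.new none) 0 { (Node.new none) with seq := 1 }
  fresh := 1
  announce := fun _ => 0
  head := fun _ => 0
  recorder := []
  usedIds := ∅

/-- Change the node at address `r`. -/
def Mem.modify {n : ℕ} {M A B : Type*} (s : Mem n M A B) (r : ℕ)
    (f : Node n M A B → Node n M A B) : Mem n M A B :=
  { s with heap := Function.update s.heap r (f (s.heap r)) }

/-- Control points of `apply`, each with the local variables that are still needed.
`v` is the invocation with its identity; the other names are those of the pseudo-code. -/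
inductive PC (n : ℕ) (M A B : Type*) where
  /-- `oid := idGen.genID()` -/
  | genID (m : M) (a : A)
  /-- `his.storeCall(m, a, pid, oid)` -/
  | storeCall (v : Invoc M A)
  /-- `announce[pid] := new Node(m, a, oid)` -/
  | announce (v : Invoc M A)
  /-- `head[pid] := Node.max(head)`; the first `i` entries are read, `best` is the maximum -/
  | max (v : Invoc M A) (i : ℕ) (best : ℕ)
  /-- `while announce[pid].seq == 0` -/
  | loop (v : Invoc M A)
  /-- `before := head[pid]` -/
  | setBefore (v : Invoc M A)
  /-- `help := announce[(before.seq + 1) % n]` -/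
  | setHelp (v : Invoc M A) (before : ℕ)
  /-- `if help.seq == 0 then prefer := help else prefer := announce[pid]` -/
  | setPrefer (v : Invoc M A) (before help : ℕ)
  /-- `after := before.decideNext.decide(prefer)` -/
  | decide (v : Invoc M A) (before prefer : ℕ)
  /-- `h₁ := his.read()` -/
  | readHis (v : Invoc M A) (before after : ℕ)
  /-- `cas(after.hist, null, h₁)` -/
  | casHist (v : Invoc M A) (before after : ℕ) (h₁ : RecHistory n M A B)
  /-- `genLin()`: read `after.hist` -/
  | genLin (v : Invoc M A) (before after : ℕ)
  /-- `genLin()`: walk along the list from `tail` to `before`, now at `cur`; `cs` holds the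
  identities and the `lin`-fields that were read -/
  | genLinScan (v : Invoc M A) (before after : ℕ) (h : RecHistory n M A B) (cur : ℕ)
      (cs : List (ℕ × OpSeq n M A B))
  /-- `genLin()`: choose the linearization -/
  | genLinChoose (v : Invoc M A) (before after : ℕ) (h : RecHistory n M A B)
      (cs : List (ℕ × OpSeq n M A B))
  /-- `cas(after.lin, null, l)` -/
  | casLin (v : Invoc M A) (before after : ℕ) (l : OpSeq n M A B)
  /-- `before.next := after` -/
  | setNext (v : Invoc M A) (before after : ℕ)
  /-- `after.seq := before.seq + 1` -/
  | setSeq (v : Invoc M A) (before after : ℕ)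
  /-- `head[pid] := after` -/
  | setHead (v : Invoc M A) (after : ℕ)
  /-- `head[pid] := announce[pid]`, after the loop -/
  | finalHead (v : Invoc M A)
  /-- `b := getRetValue(oid)`: walk along the list from `tail`, now at `cur` -/
  | getRet (v : Invoc M A) (cur : ℕ)
  /-- `his.storeReturn(m, b, pid, oid)` -/
  | storeReturn (v : Invoc M A) (b : B)
  /-- `return b` -/
  | done (b : B)

section construction

variable {n : ℕ} {M A B : Type*}

/-- The index `k % n` of an array with one entry per process; `p` witnesses that `n ≠ 0`. -/
def slot (p : Fin n) (k : ℕ) : Fin n :=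
  ⟨k % n, Nat.mod_lt k (Nat.lt_of_le_of_lt (Nat.zero_le _) p.isLt)⟩

/-- The results that `genLin` may return for the history `h` of the node of operation `oid`:
the linearizations `l` of `h` that contain the operation `oid` and, for each pair `(o, l')` in
`cs`, i.e. for each earlier node of the list, its operation `o` with the return value that `o`
has in the `lin`-field `l'` of that node. -/
def GenLinResult (Spec : Set (List (Operation M A B))) (h : RecHistory n M A B) (oid : ℕ)
    (cs : List (ℕ × OpSeq n M A B)) (l : OpSeq n M A B) : Prop :=
  IsLinearization Spec h l ∧
  (∃ x ∈ l, x.tag = oid) ∧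
  ∀ c ∈ cs, ∃ x ∈ l, x.tag = c.1 ∧ ∃ y ∈ c.2, y.tag = c.1 ∧ x.op.res = y.op.res

/-- The pairs of identity and `lin`-field read at a node; none at the sentinel. The step is not
enabled at a node of an operation whose `lin`-field is null. -/
inductive ReadLin : Node n M A B → List (ℕ × OpSeq n M A B) → Prop
  | sentinel (x : Node n M A B) : x.inv = none → ReadLin x []
  | node (x : Node n M A B) (w : Invoc M A) (l : OpSeq n M A B) :
      x.inv = some w → x.lin = some l → ReadLin x [(w.oid, l)]

/-- The atomic steps of `apply`, executed by process `p`. -/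
inductive ApplyStep (Spec : Set (List (Operation M A B))) (p : Fin n) :
    Mem n M A B → PC n M A B → Mem n M A B → PC n M A B → Prop
  | genID (s : Mem n M A B) (m : M) (a : A) (oid : ℕ) :
      oid ∉ s.usedIds →
      ApplyStep Spec p s (.genID m a)
        { s with usedIds := insert oid s.usedIds } (.storeCall ⟨oid, m, a⟩)
  | storeCall (s : Mem n M A B) (v : Invoc M A) :
      ApplyStep Spec p s (.storeCall v)
        { s with recorder := s.recorder ++ [.call p v.oid v.meth v.arg] } (.announce v)
  | announce (s : Mem n M A B) (v : Invoc M A) :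
      ApplyStep Spec p s (.announce v)
        { s with
          heap := Function.update s.heap s.fresh (Node.new (some v))
          fresh := s.fresh + 1
          announce := Function.update s.announce p s.fresh } (.max v 0 0)
  | maxRead (s : Mem n M A B) (v : Invoc M A) (i best : ℕ) (hi : i < n) :
      ApplyStep Spec p s (.max v i best) s
        (.max v (i + 1)
          (if (s.heap best).seq < (s.heap (s.head ⟨i, hi⟩)).seq then s.head ⟨i, hi⟩ else best))
  | maxDone (s : Mem n M A B) (v : Invoc M A) (best : ℕ) :
      ApplyStep Spec p s (.max v n best)
        { s with head := Function.update s.head p best } (.loop v)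
  | loopEnter (s : Mem n M A B) (v : Invoc M A) :
      (s.heap (s.announce p)).seq = 0 →
      ApplyStep Spec p s (.loop v) s (.setBefore v)
  | loopExit (s : Mem n M A B) (v : Invoc M A) :
      (s.heap (s.announce p)).seq ≠ 0 →
      ApplyStep Spec p s (.loop v) s (.finalHead v)
  | setBefore (s : Mem n M A B) (v : Invoc M A) :
      ApplyStep Spec p s (.setBefore v) s (.setHelp v (s.head p))
  | setHelp (s : Mem n M A B) (v : Invoc M A) (before : ℕ) :
      ApplyStep Spec p s (.setHelp v before) s
        (.setPrefer v before (s.announce (slot p ((s.heap before).seq + 1))))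
  | setPrefer (s : Mem n M A B) (v : Invoc M A) (before help : ℕ) :
      ApplyStep Spec p s (.setPrefer v before help) s
        (.decide v before (if (s.heap help).seq = 0 then help else s.announce p))
  | decideFirst (s : Mem n M A B) (v : Invoc M A) (before prefer : ℕ) :
      (s.heap before).decideNext = none →
      ApplyStep Spec p s (.decide v before prefer)
        (s.modify before (fun x => { x with decideNext := some prefer }))
        (.readHis v before prefer)
  | decideLater (s : Mem n M A B) (v : Invoc M A) (before prefer after : ℕ) :
      (s.heap before).decideNext = some after →
      ApplyStep Spec p s (.decide v before prefer) s (.readHis v before after)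
  | readHis (s : Mem n M A B) (v : Invoc M A) (before after : ℕ) :
      ApplyStep Spec p s (.readHis v before after) s (.casHist v before after s.recorder)
  | casHist (s : Mem n M A B) (v : Invoc M A) (before after : ℕ) (h₁ : RecHistory n M A B) :
      ApplyStep Spec p s (.casHist v before after h₁)
        (s.modify after (fun x => { x with hist := some (x.hist.getD h₁) }))
        (.genLin v before after)
  | genLin (s : Mem n M A B) (v : Invoc M A) (before after : ℕ) (h : RecHistory n M A B) :
      (s.heap after).hist = some h →
      ApplyStep Spec p s (.genLin v before after) s (.genLinScan v before after h 0 [])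
  | genLinNext (s : Mem n M A B) (v : Invoc M A) (before after : ℕ) (h : RecHistory n M A B)
      (cur nxt : ℕ) (cs cs' : List (ℕ × OpSeq n M A B)) :
      cur ≠ before → ReadLin (s.heap cur) cs' → (s.heap cur).next = some nxt →
      ApplyStep Spec p s (.genLinScan v before after h cur cs) s
        (.genLinScan v before after h nxt (cs ++ cs'))
  | genLinLast (s : Mem n M A B) (v : Invoc M A) (before after : ℕ) (h : RecHistory n M A B)
      (cs cs' : List (ℕ × OpSeq n M A B)) :
      ReadLin (s.heap before) cs' →
      ApplyStep Spec p s (.genLinScan v before after h before cs) s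
        (.genLinChoose v before after h (cs ++ cs'))
  | genLinChoose (s : Mem n M A B) (v w : Invoc M A) (before after : ℕ)
      (h : RecHistory n M A B) (cs : List (ℕ × OpSeq n M A B)) (l : OpSeq n M A B) :
      (s.heap after).inv = some w → GenLinResult Spec h w.oid cs l →
      ApplyStep Spec p s (.genLinChoose v before after h cs) s (.casLin v before after l)
  | casLin (s : Mem n M A B) (v : Invoc M A) (before after : ℕ) (l : OpSeq n M A B) :
      ApplyStep Spec p s (.casLin v before after l)
        (s.modify after (fun x => { x with lin := some (x.lin.getD l) }))
        (.setNext v before after)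
  | setNext (s : Mem n M A B) (v : Invoc M A) (before after : ℕ) :
      ApplyStep Spec p s (.setNext v before after)
        (s.modify before (fun x => { x with next := some after }))
        (.setSeq v before after)
  | setSeq (s : Mem n M A B) (v : Invoc M A) (before after : ℕ) :
      ApplyStep Spec p s (.setSeq v before after)
        (s.modify after (fun x => { x with seq := (s.heap before).seq + 1 }))
        (.setHead v after)
  | setHead (s : Mem n M A B) (v : Invoc M A) (after : ℕ) :
      ApplyStep Spec p s (.setHead v after)
        { s with head := Function.update s.head p after } (.loop v)
  | finalHead (s : Mem n M A B) (v : Invoc M A) :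
      ApplyStep Spec p s (.finalHead v)
        { s with head := Function.update s.head p (s.announce p) } (.getRet v 0)
  | getRetNext (s : Mem n M A B) (v : Invoc M A) (cur nxt : ℕ) :
      (∀ w, (s.heap cur).inv = some w → w.oid ≠ v.oid) → (s.heap cur).next = some nxt →
      ApplyStep Spec p s (.getRet v cur) s (.getRet v nxt)
  | getRetFound (s : Mem n M A B) (v w : Invoc M A) (cur : ℕ) (l : OpSeq n M A B)
      (x : ProcOp n ℕ M A B) :
      (s.heap cur).inv = some w → w.oid = v.oid → (s.heap cur).lin = some l →
      x ∈ l → x.tag = v.oid →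
      ApplyStep Spec p s (.getRet v cur) s (.storeReturn v x.op.res)
  | storeReturn (s : Mem n M A B) (v : Invoc M A) (b : B) :
      ApplyStep Spec p s (.storeReturn v b)
        { s with recorder := s.recorder ++ [.ret p v.oid v.meth b] } (.done b)

end construction

/-- The universal construction for `Spec` and `n` processes. A call of its only method `apply`
with argument `(m, a)` is regarded as a call of `m` with argument `a`. -/
def universalObject {M A B : Type*} (n : ℕ) (Spec : Set (List (Operation M A B))) :
    ConcObject n M A B (Mem n M A B) (PC n M A B) where
  init := Mem.init n M A B
  start := fun _ m a => .genID m a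
  step := fun p => ApplyStep Spec p
  returns := fun l b => l = .done b

end UnivConstr

/-!
The successor of a node is the value of its consensus object, so the decided nodes form a list `L`
that grows only at its end, by the first call of `decide` on its last node. All invariants refer to
`L`: a node is preferred only if it is not yet in `L` or if the consensus object in question is
already decided, so no node is appended twice, and all nodes but the last one are complete.

*Linearizability.* The history in a node is a prefix of the recorded one, and an operation returns
only the value that the `lin`-field of its own node prescribes. Each `lin`-field repeats the values
of all earlier nodes. Hence the last `lin`-field that is set contains every operation that has
returned, with the right value, and a linearization of a prefix with this property is one of the
whole history (`IsLinearization.of_prefix`). A linearization of the recorded history is one of the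
history of the object, since an operation is recorded as called after its call and as returned
before its return (`RecInv.isLinearization`).

*Wait-freedom.* No process gets stuck: the only step that needs an argument is the choice of a
linearization, where that of the preceding node is still one of the newer history, and the
operation of the new node, which is pending, can be linearized last because the specification is
non-blocking (`ListInv.exists_genLinResult`). Each operation finishes: after a process has announced
its node, every `n`-th new node is chosen by processes that prefer the announced one, so it is
appended after boundedly many further nodes (`Helped.pos_le`), and each iteration of the loop moves the
process on by one node, which makes `rank` decrease.
-/

namespace UnivConstr

section histories

variable {n : ℕ} {I M A B : Type*}

/-! ### Alternating sequences and their completions -/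

@[simp] theorem proj_nil (p : Fin n) : proj p ([] : List (Action n I M A B)) = [] := rfl

@[simp] theorem proj_append (p : Fin n) (h h' : List (Action n I M A B)) :
    proj p (h ++ h') = proj p h ++ proj p h' := by simp [proj]

theorem proj_cons (p : Fin n) (x : Action n I M A B) (h : List (Action n I M A B)) :
    proj p (x :: h) = if x.proc = p then x :: proj p h else proj p h := by
  simp [proj, List.filter_cons]

theorem mem_proj {p : Fin n} {x : Action n I M A B} {h : List (Action n I M A B)} :
    x ∈ proj p h ↔ x ∈ h ∧ x.proc = p := by simp [proj]

@[simp] theorem seqHistory_nil : seqHistory ([] : List (ProcOp n I M A B)) = [] := rfl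

theorem seqHistory_cons (x : ProcOp n I M A B) (s : List (ProcOp n I M A B)) :
    seqHistory (x :: s) = .call x.proc x.tag x.op.meth x.op.arg ::
      .ret x.proc x.tag x.op.meth x.op.res :: seqHistory s := rfl

@[simp] theorem seqHistory_append (s s' : List (ProcOp n I M A B)) :
    seqHistory (s ++ s') = seqHistory s ++ seqHistory s' := by simp [seqHistory]

theorem proj_seqHistory (p : Fin n) (s : List (ProcOp n I M A B)) :
    proj p (seqHistory s) = seqHistory (s.filter (fun x => x.proc = p)) := by
  induction s with
  | nil => rfl
  | cons x s ih =>
    rw [seqHistory_cons, proj_cons, proj_cons, ih]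
    by_cases hx : x.proc = p <;> simp [Action.proc, hx, seqHistory_cons]

theorem alternating_seqHistory_append (s : List (ProcOp n I M A B))
    (u : List (Action n I M A B)) : Alternating (seqHistory s ++ u) ↔ Alternating u := by
  induction s with
  | nil => rfl
  | cons x s ih =>
    rw [← ih, seqHistory_cons]
    exact ⟨fun h => by cases h; assumption, fun h => Alternating.cons _ _ _ _ _ _ h⟩

theorem alternating_seqHistory (s : List (ProcOp n I M A B)) : Alternating (seqHistory s) := by
  simpa using (alternating_seqHistory_append s []).2 .nil

theorem Alternating.eq_seqHistory {t : List (Action n I M A B)} (h : Alternating t) :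
    ∃ s, t = seqHistory s ∨ ∃ p o m a, t = seqHistory s ++ [.call p o m a] := by
  induction h with
  | nil => exact ⟨[], .inl rfl⟩
  | pending p o m a => exact ⟨[], .inr ⟨p, o, m, a, rfl⟩⟩
  | cons p o m a b t _ ih =>
    obtain ⟨s, rfl | ⟨q, o', m', a', rfl⟩⟩ := ih
    · exact ⟨⟨p, o, ⟨m, a, b⟩⟩ :: s, .inl rfl⟩
    · exact ⟨⟨p, o, ⟨m, a, b⟩⟩ :: s, .inr ⟨q, o', m', a', rfl⟩⟩

theorem Alternating.of_append {t u : List (Action n I M A B)} (h : Alternating (t ++ u)) :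
    Alternating t := by
  generalize hv : t ++ u = v at h
  induction h generalizing t with
  | nil => simp at hv; simp [hv.1, Alternating.nil]
  | pending p o m a =>
    match t, hv with
    | [], _ => exact .nil
    | [x], hv => simp at hv; rw [hv.1]; exact .pending ..
  | cons p o m a b t' _ ih =>
    match t, hv with
    | [], _ => exact .nil
    | [x], hv => simp at hv; rw [hv.1]; exact .pending ..
    | x :: y :: t, hv =>
      simp at hv
      obtain ⟨rfl, rfl, hv⟩ := hv
      exact .cons _ _ _ _ _ _ (ih hv)

theorem IsHistory.of_prefix {h h' : List (Action n I M A B)} (hp : h <+: h')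
    (hh : IsHistory h') : IsHistory h := by
  obtain ⟨u, rfl⟩ := hp
  intro p
  have := hh p
  rw [proj_append] at this
  exact this.of_append

@[simp] theorem complete_nil : complete ([] : List (Action n I M A B)) = [] := rfl

theorem complete_seqHistory_append (s : List (ProcOp n I M A B))
    (u : List (Action n I M A B)) :
    complete (seqHistory s ++ u) = seqHistory s ++ complete u := by
  induction s with
  | nil => rfl
  | cons x s ih =>
    simp [seqHistory_cons, complete, Action.isCall, Action.proc, ih]

theorem complete_seqHistory (s : List (ProcOp n I M A B)) :
    complete (seqHistory s) = seqHistory s := by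
  simpa using complete_seqHistory_append s []

theorem proj_complete (p : Fin n) (h : List (Action n I M A B)) :
    proj p (complete h) = complete (proj p h) := by
  induction h with
  | nil => rfl
  | cons x t ih =>
    have key : x.proc = p → ((proj p t).all (fun y => y.proc ≠ x.proc) =
        t.all (fun y => y.proc ≠ x.proc)) := by
      rintro rfl
      rw [Bool.eq_iff_iff]
      simp only [List.all_eq_true, mem_proj]
      simp
    rw [complete]
    split_ifs with hc
    · rw [ih, proj_cons]
      split_ifs with hx
      · rw [complete, key hx, if_pos hc]
      · rfl
    · rw [proj_cons, proj_cons, ih]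
      split_ifs with hx
      · rw [complete, key hx, if_neg hc]
      · rfl

/-- `t` and `σ` agree up to one action: `t` may have one more call, or lack one return. For an
alternating `t` and a sequence `σ` of complete operations, this says that `σ` is the completed
part of `t` or of `t` extended by one return. -/
def Compat (t σ : List (Action n I M A B)) : Prop :=
  t = σ ∨ (∃ p o m a, t = σ ++ [.call p o m a]) ∨ (∃ p o m b, σ = t ++ [.ret p o m b])

theorem compat_of_complete {t e : List (Action n I M A B)} (he : ∀ x ∈ e, x.isRet = true)
    (ha : Alternating (t ++ e)) : Compat t (complete (t ++ e)) := by
  have key : ∀ (v w u : List (Action n I M A B)) (p : Fin n) (o : I) (m : M) (a : A),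
      (∀ x ∈ v, x.isRet = true) → u ++ v = w ++ [.call p o m a] → v = [] := by
    intro v w u p o m a hv h
    rcases List.eq_nil_or_concat v with rfl | ⟨v', z, rfl⟩
    · rfl
    · rw [List.concat_eq_append, ← List.append_assoc] at h
      have := (List.append_inj' h rfl).2
      simp at this
      have hz := hv z (by simp)
      rw [this] at hz
      simp [Action.isRet] at hz
  obtain ⟨s, hs | ⟨p, o, m, a, hs⟩⟩ := ha.eq_seqHistory
  · rw [hs, complete_seqHistory, ← hs]
    rcases List.eq_nil_or_concat e with rfl | ⟨e', z, rfl⟩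
    · exact .inl (by simp)
    · right; right
      rcases List.eq_nil_or_concat s with rfl | ⟨s', x, rfl⟩
      · simp at hs
      · simp only [List.concat_eq_append, seqHistory_append, seqHistory_cons, seqHistory_nil]
          at hs
        have h2 := List.append_inj' (s₁ := t ++ e') (t₁ := [z])
          (s₂ := seqHistory s' ++ [.call x.proc x.tag x.op.meth x.op.arg])
          (t₂ := [.ret x.proc x.tag x.op.meth x.op.res]) (by simpa using hs) rfl
        have h3 := key e' _ _ _ _ _ _ (fun x hx => he x (by simp [hx])) h2.1
        subst h3
        simp only [List.cons.injEq, and_true] at h2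
        exact ⟨_, _, _, _, by rw [← h2.2]; simp⟩
  · have h3 := key e _ _ _ _ _ _ he hs
    subst h3
    rw [hs, complete_seqHistory_append]
    right; left
    refine ⟨p, o, m, a, ?_⟩
    simp at hs
    simp [hs, complete, Action.isCall]

theorem Compat.exists_complete {p : Fin n} {t : List (Action n I M A B)}
    {s : List (ProcOp n I M A B)} (h : Compat t (seqHistory s))
    (hp : ∀ x ∈ s, x.proc = p) :
    ∃ e : List (Action n I M A B), (∀ x ∈ e, x.isRet = true ∧ x.proc = p) ∧
      Alternating (t ++ e) ∧ complete (t ++ e) = seqHistory s := by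
  rcases h with rfl | ⟨q, o, m, a, rfl⟩ | ⟨q, o, m, b, h⟩
  · exact ⟨[], by simp, by simpa using alternating_seqHistory s, by
      simpa using complete_seqHistory s⟩
  · refine ⟨[], by simp, ?_, ?_⟩
    · rw [List.append_nil, alternating_seqHistory_append]
      exact .pending ..
    · rw [List.append_nil, complete_seqHistory_append]
      simp [complete, Action.isCall]
  · refine ⟨[.ret q o m b], ?_, ?_, ?_⟩
    · have hm : Action.ret q o m b ∈ seqHistory s := by rw [h]; simp
      simp only [List.mem_singleton, forall_eq]
      refine ⟨rfl, ?_⟩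
      simp only [seqHistory, List.mem_flatMap] at hm
      obtain ⟨x, hx, hm⟩ := hm
      simp at hm
      rw [← hp x hx, ← hm.1]; rfl
    · rw [← h]; exact alternating_seqHistory s
    · rw [← h]; exact complete_seqHistory s

theorem Compat.count_call_le {t σ : List (Action n I M A B)} (h : Compat t σ) (q : Fin n) :
    σ.countP (fun z => z.isCall && z.proc = q) ≤ t.countP (fun z => z.isCall && z.proc = q) := by
  rcases h with rfl | ⟨_, _, _, _, rfl⟩ | ⟨_, _, _, _, rfl⟩ <;>
    simp [List.countP_append, Action.isCall]

theorem Compat.count_ret_le {t σ : List (Action n I M A B)} (h : Compat t σ) (q : Fin n) :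
    t.countP (fun z => z.isRet && z.proc = q) ≤ σ.countP (fun z => z.isRet && z.proc = q) := by
  rcases h with rfl | ⟨_, _, _, _, rfl⟩ | ⟨_, _, _, _, rfl⟩ <;>
    simp [List.countP_append, Action.isRet]

theorem countP_call_proj (q : Fin n) (h : List (Action n I M A B)) :
    (proj q h).countP (fun z => z.isCall && z.proc = q) =
      h.countP (fun z => z.isCall && z.proc = q) := by
  rw [proj, List.countP_filter]
  congr 1; funext z; simp

theorem countP_ret_proj (q : Fin n) (h : List (Action n I M A B)) :
    (proj q h).countP (fun z => z.isRet && z.proc = q) =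
      h.countP (fun z => z.isRet && z.proc = q) := by
  rw [proj, List.countP_filter]
  congr 1; funext z; simp

theorem countP_call_seqHistory (q : Fin n) (s : List (ProcOp n I M A B)) :
    (seqHistory s).countP (fun z => z.isCall && z.proc = q) =
      s.countP (fun x => x.proc = q) := by
  induction s with
  | nil => rfl
  | cons x s ih =>
    rw [seqHistory_cons, List.countP_cons, List.countP_cons, List.countP_cons, ih]
    by_cases hx : x.proc = q <;> simp [Action.isCall, Action.proc, hx]

/-! ### The happen-before relation -/

theorem exists_countP_eq {α : Type*} (P : α → Bool) (u : List α) (k : ℕ)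
    (hk : k < u.countP P) : ∃ (u₁ u₂ : List α) (x : α), u = u₁ ++ x :: u₂ ∧ P x = true ∧
      u₁.countP P = k := by
  induction u using List.reverseRecOn with
  | nil => simp at hk
  | append_singleton u z ih =>
    by_cases h : k < u.countP P
    · obtain ⟨u₁, u₂, x, rfl, hx, hc⟩ := ih h
      exact ⟨u₁, u₂ ++ [z], x, by simp, hx, hc⟩
    · by_cases hz : P z = true
      · refine ⟨u, [], z, rfl, hz, ?_⟩
        simp [List.countP_append, hz] at hk
        omega
      · simp [List.countP_append, hz] at hk
        omega

/-- The `k`-th return of `p` precedes the `j`-th call of `q` if and only if more than `k` returns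
of `p` precede that call. -/
theorem happensBefore_iff {h : List (Action n I M A B)} {p : Fin n} {k : ℕ} {q : Fin n} {j : ℕ} :
    HappensBefore h p k q j ↔ ∃ u y w, h = u ++ y :: w ∧ y.isCall = true ∧ y.proc = q ∧
      u.countP (fun z => z.isCall && z.proc = q) = j ∧
      k < u.countP (fun z => z.isRet && z.proc = p) := by
  constructor
  · rintro ⟨i, i', x, y, hi, hx, hy, hr, hp, hk, hc, hq, hj⟩
    refine ⟨h.take i', y, h.drop (i' + 1), ?_, hc, hq, hj, ?_⟩
    · obtain ⟨hlt, rfl⟩ := List.getElem?_eq_some_iff.1 hy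
      simp
    · obtain ⟨hlt, rfl⟩ := List.getElem?_eq_some_iff.1 hx
      have h1 : h.take (i + 1) <+: h.take i' := List.take_prefix_take_left (by omega)
      refine lt_of_lt_of_le ?_ (h1.sublist.countP_le)
      rw [List.take_add_one, List.getElem?_eq_getElem hlt, List.countP_append, hk]
      simp [hr, hp]
  · rintro ⟨u, y, w, rfl, hc, hq, hj, hk⟩
    obtain ⟨u₁, u₂, x, rfl, hx, hu⟩ := exists_countP_eq _ _ _ hk
    simp at hx
    refine ⟨u₁.length, (u₁ ++ x :: u₂).length, x, y, by simp, ?_, ?_, hx.1, hx.2, ?_, hc, hq, ?_⟩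
    · simp
    · simp
    · simpa using hu
    · rw [List.append_assoc, List.cons_append, ← List.cons_append, ← List.append_assoc,
        List.take_left]
      exact hj

theorem HappensBefore.of_prefix {h h' : List (Action n I M A B)} (hp : h <+: h')
    {p : Fin n} {k : ℕ} {q : Fin n} {j : ℕ} (hb : HappensBefore h p k q j) :
    HappensBefore h' p k q j := by
  obtain ⟨t, rfl⟩ := hp
  rw [happensBefore_iff] at hb ⊢
  obtain ⟨u, y, w, rfl, hr⟩ := hb
  exact ⟨u, y, w ++ t, by simp, hr⟩

theorem happensBefore_append {h t : List (Action n I M A B)}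
    {p : Fin n} {k : ℕ} {q : Fin n} {j : ℕ} (hb : HappensBefore (h ++ t) p k q j)
    (hj : j < h.countP (fun z => z.isCall && z.proc = q)) : HappensBefore h p k q j := by
  rw [happensBefore_iff] at hb ⊢
  obtain ⟨u, y, w, he, hc, hq, hj', hk⟩ := hb
  rcases List.append_eq_append_iff.1 he with ⟨v, rfl, hv⟩ | ⟨v, rfl, hv⟩
  · simp [List.countP_append] at hj'
    omega
  · match v, hv with
    | [], hv => simp at hj; omega
    | z :: v, hv =>
      simp at hv
      obtain ⟨rfl, rfl⟩ := hv
      exact ⟨u, y, v, rfl, hc, hq, hj', hk⟩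

theorem HappensBefore.lt_count_ret {h : List (Action n I M A B)}
    {p : Fin n} {k : ℕ} {q : Fin n} {j : ℕ} (hb : HappensBefore h p k q j) :
    k < h.countP (fun z => z.isRet && z.proc = p) := by
  obtain ⟨u, y, w, rfl, -, -, -, hk⟩ := happensBefore_iff.1 hb
  rw [List.countP_append]; omega

theorem HappensBefore.lt_count_call {h : List (Action n I M A B)}
    {p : Fin n} {k : ℕ} {q : Fin n} {j : ℕ} (hb : HappensBefore h p k q j) :
    j < h.countP (fun z => z.isCall && z.proc = q) := by
  obtain ⟨u, y, w, rfl, hc, hq, hj, -⟩ := happensBefore_iff.1 hb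
  rw [List.countP_append, List.countP_cons]
  simp [hc, hq, hj]

theorem happensBefore_append_call {h : List (Action n I M A B)} {p : Fin n} {k : ℕ} {q : Fin n}
    {y : Action n I M A B} (hc : y.isCall = true) (hq : y.proc = q)
    (hk : k < h.countP (fun z => z.isRet && z.proc = p)) (t : List (Action n I M A B)) :
    HappensBefore (h ++ y :: t) p k q (h.countP (fun z => z.isCall && z.proc = q)) :=
  happensBefore_iff.2 ⟨h, y, t, rfl, hc, hq, rfl, hk⟩

/-! ### Linearizations -/

theorem proj_flatMap_finRange (e : Fin n → List (Action n I M A B))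
    (he : ∀ p, ∀ x ∈ e p, x.proc = p) (q : Fin n) :
    proj q ((List.finRange n).flatMap e) = e q := by
  have key : ∀ l : List (Fin n), l.Nodup →
      proj q (l.flatMap e) = if q ∈ l then e q else [] := by
    intro l hl
    induction l with
    | nil => rfl
    | cons p l ih =>
      rw [List.nodup_cons] at hl
      rw [List.flatMap_cons, proj_append, ih hl.2]
      by_cases hq : q = p
      · subst hq
        have : proj q (e q) = e q := by
          rw [proj, List.filter_eq_self]
          simpa using he q
        simp [hl.1, this]
      · have : proj q (e p) = [] := by
          rw [proj, List.filter_eq_nil_iff]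
          intro x hx
          rw [he p x hx]
          simpa using fun h => hq h.symm
        simp [hq, this]
  rw [key _ (List.nodup_finRange n), if_pos (List.mem_finRange q)]

/-- The condition on the extension by returns can be checked for one process at a time. -/
theorem isLinearization_iff {Spec : Set (List (Operation M A B))}
    {h : List (Action n I M A B)} {s : List (ProcOp n I M A B)} :
    IsLinearization Spec h s ↔ s.map (fun x => x.op) ∈ Spec ∧
      (∀ p, Compat (proj p h) (proj p (seqHistory s))) ∧
      ∀ (p : Fin n) (k : ℕ) (q : Fin n) (j : ℕ), HappensBefore h p k q j →
        j < s.countP (fun x => x.proc = q) → HappensBefore (seqHistory s) p k q j := by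
  refine and_congr_right fun _ => and_congr_left fun _ => ⟨?_, ?_⟩
  · rintro ⟨ext, hr, hh, he⟩ p
    rw [← he p, proj_complete, proj_append]
    refine compat_of_complete (fun x hx => hr x (mem_proj.1 hx).1) ?_
    rw [← proj_append]
    exact hh p
  · intro hc
    have h1 : ∀ p, ∃ e : List (Action n I M A B), (∀ x ∈ e, x.isRet = true ∧ x.proc = p) ∧
        Alternating (proj p h ++ e) ∧ complete (proj p h ++ e) = proj p (seqHistory s) := by
      intro p
      have := hc p
      rw [proj_seqHistory] at this ⊢
      exact this.exists_complete (by simp)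
    choose e he ha hq using h1
    have hpe := proj_flatMap_finRange e (fun p x hx => (he p x hx).2)
    refine ⟨(List.finRange n).flatMap e, ?_, ?_, ?_⟩
    · intro x hx
      obtain ⟨p, -, hx⟩ := List.mem_flatMap.1 hx
      exact (he p x hx).1
    · intro p
      rw [proj_append, hpe]; exact ha p
    · intro p
      rw [proj_complete, proj_append, hpe]; exact hq p

/-- The identities of the calls of a history. -/
def callIds (h : List (Action n I M A B)) : List I :=
  h.filterMap (fun x => match x with
    | .call _ o _ _ => some o
    | .ret _ _ _ _ => none)

@[simp] theorem callIds_append (h h' : List (Action n I M A B)) :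
    callIds (h ++ h') = callIds h ++ callIds h' := by simp [callIds]

theorem mem_callIds {h : List (Action n I M A B)} {o : I} :
    o ∈ callIds h ↔ ∃ p m a, Action.call p o m a ∈ h := by
  simp only [callIds, List.mem_filterMap]
  constructor
  · rintro ⟨x, hx, he⟩
    cases x <;> simp at he
    subst he
    exact ⟨_, _, _, hx⟩
  · rintro ⟨p, m, a, hx⟩
    exact ⟨_, hx, rfl⟩

theorem callIds_seqHistory (s : List (ProcOp n I M A B)) :
    callIds (seqHistory s) = s.map (fun x => x.tag) := by
  induction s with
  | nil => rfl
  | cons x s ih =>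
    rw [List.map_cons, ← ih]; rfl

theorem call_unique {h : List (Action n I M A B)} (hid : (callIds h).Nodup) {o : I}
    {p q : Fin n} {m m' : M} {a a' : A} (h1 : Action.call p o m a ∈ h)
    (h2 : Action.call q o m' a' ∈ h) : p = q ∧ m = m' ∧ a = a' := by
  induction h with
  | nil => simp at h1
  | cons x t ih =>
    have hid' : (callIds ([x] ++ t)).Nodup := hid
    rw [callIds_append, List.nodup_append] at hid'
    have hne : ∀ p q m m' a a', x = .call p o m a → Action.call q o m' a' ∉ t := by
      rintro p q m m' a a' rfl h
      exact hid'.2.2 o (mem_callIds.2 ⟨p, m, a, by simp⟩) o (mem_callIds.2 ⟨q, m', a', h⟩) rfl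
    rcases List.mem_cons.1 h1 with h1 | h1 <;> rcases List.mem_cons.1 h2 with h2 | h2
    · rw [← h1] at h2
      cases h2
      exact ⟨rfl, rfl, rfl⟩
    · exact absurd h2 (hne _ _ _ _ _ _ h1.symm)
    · exact absurd h1 (hne _ _ _ _ _ _ h2.symm)
    · exact ih hid'.2.1 h1 h2

theorem Compat.callIds_sublist {t σ : List (Action n I M A B)} (h : Compat t σ) :
    (callIds σ).Sublist (callIds t) := by
  rcases h with rfl | ⟨_, _, _, _, rfl⟩ | ⟨_, _, _, _, rfl⟩
  · exact .refl _
  · rw [callIds_append]; exact List.sublist_append_left ..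
  · rw [callIds_append]; simp [callIds]

section

variable {Spec : Set (List (Operation M A B))} {h h₀ : List (Action n I M A B)}
  {l : List (ProcOp n I M A B)}

theorem IsLinearization.call_mem (hl : IsLinearization Spec h l) {x : ProcOp n I M A B}
    (hx : x ∈ l) : Action.call x.proc x.tag x.op.meth x.op.arg ∈ h := by
  have hm : Action.call x.proc x.tag x.op.meth x.op.arg ∈ proj x.proc (seqHistory l) := by
    rw [mem_proj]
    exact ⟨List.mem_flatMap.2 ⟨x, hx, by simp⟩, rfl⟩
  refine (mem_proj (p := x.proc)).1 ?_ |>.1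
  rcases (isLinearization_iff.1 hl).2.1 x.proc with he | ⟨_, _, _, _, he⟩ | ⟨_, _, _, _, he⟩
  · rw [he]; exact hm
  · rw [he]; exact List.mem_append_left _ hm
  · rw [he] at hm; simpa using hm

theorem IsLinearization.eq_of_tag_eq (hl : IsLinearization Spec h l)
    (hid : (callIds h).Nodup) {x y : ProcOp n I M A B} (hx : x ∈ l) (hy : y ∈ l)
    (ht : x.tag = y.tag) : x = y := by
  have h1 := hl.call_mem hx
  have h2 := hl.call_mem hy
  rw [ht] at h1
  have hp := (call_unique hid h1 h2).1
  have hs := ((isLinearization_iff.1 hl).2.1 x.proc).callIds_sublist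
  rw [proj_seqHistory, callIds_seqHistory] at hs
  have hsub : (callIds (proj x.proc h)).Sublist (callIds h) := List.Sublist.filterMap _
    List.filter_sublist
  exact List.inj_on_of_nodup_map ((hs.trans hsub).nodup hid) (by simpa using hx)
    (by simp [hy, hp]) ht

/-- A linearization of a prefix `h₀` of `h` is also one of `h`, provided that each operation that
has returned in `h` occurs in it with the right return value. -/
theorem IsLinearization.of_prefix (hl : IsLinearization Spec h₀ l) (hpre : h₀ <+: h)
    (hh : IsHistory h) (hid : (callIds h).Nodup)
    (hr : ∀ p o m b, Action.ret p o m b ∈ h → ∃ x ∈ l, x.tag = o ∧ x.op.res = b) :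
    IsLinearization Spec h l := by
  obtain ⟨u, rfl⟩ := hpre
  have hl' := isLinearization_iff.1 hl
  have hid₀ := hid
  rw [callIds_append, List.nodup_append] at hid₀
  refine isLinearization_iff.2 ⟨hl'.1, fun p => ?_, fun p k q j hb hj => hl'.2.2 p k q j
    (happensBefore_append hb ?_) hj⟩
  · -- A call after `h₀` cannot have returned: its operation would occur in `l`, hence in `h₀`.
    have new : ∀ v, proj p u = v ∨ (∃ z, proj p u = z :: v) → Alternating v →
        v = [] ∨ ∃ o m a, v = [.call p o m a] := by
      intro v hv ha
      have hmem : ∀ x ∈ v, x ∈ proj p u := by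
        rcases hv with hv | ⟨z, hv⟩ <;> rw [hv] <;> simp +contextual
      cases ha with
      | nil => exact .inl rfl
      | pending p' o m a =>
        have := (mem_proj.1 (hmem _ (List.mem_singleton.2 rfl))).2
        simp only [Action.proc] at this
        subst this
        exact .inr ⟨o, m, a, rfl⟩
      | cons p' o m a b t _ =>
        exfalso
        have h1 := (mem_proj.1 (hmem (.call p' o m a) (by simp))).1
        have h2 := (mem_proj.1 (hmem (.ret p' o m b) (by simp))).1
        obtain ⟨x, hx, rfl, -⟩ := hr _ _ _ _ (List.mem_append_right h₀ h2)
        exact hid₀.2.2 x.tag (mem_callIds.2 ⟨_, _, _, hl.call_mem hx⟩) x.tag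
          (mem_callIds.2 ⟨_, _, _, h1⟩) rfl
    have hp := hh p
    rw [proj_append] at hp ⊢
    rcases hl'.2.1 p with he | ⟨p', o, m, a, he⟩ | ⟨p', o, m, b, he⟩
    · rw [he, proj_seqHistory] at hp
      rw [alternating_seqHistory_append] at hp
      rw [he]
      rcases new _ (.inl rfl) hp with hv | ⟨o, m, a, hv⟩ <;> rw [hv]
      · exact .inl (by simp)
      · exact .inr (.inl ⟨_, _, _, _, rfl⟩)
    · rw [he]
      right; left
      refine ⟨p', o, m, a, ?_⟩
      rw [he, List.append_assoc, proj_seqHistory, alternating_seqHistory_append] at hp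
      have hmem : Action.call p' o m a ∈ proj p h₀ := by rw [he]; simp
      generalize hu : proj p u = v at hp
      cases hp with
      | pending => simp
      | cons _ _ _ _ b t _ =>
        exfalso
        have h2 : Action.ret p' o m b ∈ u := (mem_proj (p := p)).1 (by rw [hu]; simp) |>.1
        obtain ⟨x, hx, rfl, -⟩ := hr _ _ _ _ (List.mem_append_right h₀ h2)
        have hxp : x.proc = p := (call_unique hid₀.1 (hl.call_mem hx) (mem_proj.1 hmem).1).1.trans
          (mem_proj.1 hmem).2
        have hn : (callIds (proj p h₀)).Nodup :=
          (List.Sublist.filterMap _ List.filter_sublist).nodup hid₀.1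
        rw [he, callIds_append, List.nodup_append] at hn
        refine hn.2.2 x.tag ?_ x.tag ?_ rfl
        · rw [proj_seqHistory, callIds_seqHistory]
          exact List.mem_map.2 ⟨x, by simp [hx, hxp], rfl⟩
        · exact mem_callIds.2 ⟨_, _, _, List.mem_singleton.2 rfl⟩
    · rw [proj_seqHistory] at he
      rcases List.eq_nil_or_concat (l.filter (fun x => x.proc = p)) with h0 | ⟨l', x, h0⟩
      · rw [h0] at he; simp at he
      rw [h0, List.concat_eq_append, seqHistory_append, seqHistory_cons, seqHistory_nil] at he
      have h2 := List.append_inj'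
          (s₁ := seqHistory l' ++ [.call x.proc x.tag x.op.meth x.op.arg])
          (t₁ := [.ret x.proc x.tag x.op.meth x.op.res])
          (s₂ := proj p h₀) (t₂ := [.ret p' o m b]) (by simpa using he) rfl
      have hx : x ∈ l := by
        have : x ∈ l.filter (fun x => x.proc = p) := by rw [h0]; simp
        exact List.mem_of_mem_filter this
      rw [proj_seqHistory, h0, List.concat_eq_append, seqHistory_append, seqHistory_cons,
        seqHistory_nil]
      rw [← h2.1, List.append_assoc, alternating_seqHistory_append] at hp
      rw [← h2.1]
      generalize hu : proj p u = v at hp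
      cases hp with
      | pending => exact .inr (.inr ⟨_, _, _, _, by simp; exact ⟨rfl, rfl, rfl, rfl⟩⟩)
      | cons _ _ _ _ b' t ht =>
        have h2 : Action.ret x.proc x.tag x.op.meth b' ∈ u :=
          (mem_proj (p := p)).1 (by rw [hu]; simp) |>.1
        obtain ⟨y, hy, hyt, rfl⟩ := hr _ _ _ _ (List.mem_append_right h₀ h2)
        obtain rfl := hl.eq_of_tag_eq hid₀.1 hy hx hyt
        rcases new _ (.inr ⟨_, hu⟩) ht with rfl | ⟨o, m, a, rfl⟩
        · exact .inl (by simp)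
        · exact .inr (.inl ⟨_, _, _, _, by simp; exact ⟨rfl, rfl, rfl, rfl⟩⟩)
  · refine lt_of_lt_of_le hj ?_
    have := (hl'.2.1 q).count_call_le q
    rwa [countP_call_proj, countP_call_proj, countP_call_seqHistory] at this

/-- A pending operation that does not occur in a linearization can be linearized last. -/
theorem IsLinearization.append_pending (hl : IsLinearization Spec h l) {x : ProcOp n I M A B}
    (hc : Action.call x.proc x.tag x.op.meth x.op.arg ∈ h) (hx : ∀ y ∈ l, y.tag ≠ x.tag)
    (hs : (l ++ [x]).map (fun x => x.op) ∈ Spec) : IsLinearization Spec h (l ++ [x]) := by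
  have hl' := isLinearization_iff.1 hl
  refine isLinearization_iff.2 ⟨hs, fun p => ?_, fun p k q j hb hj => ?_⟩
  · by_cases hp : x.proc = p
    · have hmem : Action.call x.proc x.tag x.op.meth x.op.arg ∈ proj p h := mem_proj.2 ⟨hc, hp⟩
      have hnot : Action.call x.proc x.tag x.op.meth x.op.arg ∉ proj p (seqHistory l) := by
        intro hm
        have := mem_callIds.2 ⟨_, _, _, (mem_proj.1 hm).1⟩
        rw [callIds_seqHistory] at this
        obtain ⟨y, hy, hyt⟩ := List.mem_map.1 this
        exact hx y hy hyt
      rcases hl'.2.1 p with he | ⟨p', o, m, a, he⟩ | ⟨p', o, m, b, he⟩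
      · exact absurd (he ▸ hmem) hnot
      · right; right
        have hm := hmem
        rw [he] at hm
        have h3 := (List.mem_append.1 hm).resolve_left hnot
        rw [List.mem_singleton] at h3
        refine ⟨x.proc, x.tag, x.op.meth, x.op.res, ?_⟩
        rw [he, ← h3, seqHistory_append, proj_append, seqHistory_cons, proj_cons, proj_cons]
        simp [Action.proc, hp]
      · refine absurd ?_ hnot
        rw [he]; simp [hmem]
    · have : proj p (seqHistory (l ++ [x])) = proj p (seqHistory l) := by
        rw [seqHistory_append, proj_append, seqHistory_cons, proj_cons, proj_cons]
        simp [Action.proc, hp]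
      rw [this]; exact hl'.2.1 p
  · rw [seqHistory_append]
    by_cases hj' : j < l.countP (fun x => x.proc = q)
    · exact (hl'.2.2 p k q j hb hj').of_prefix (List.prefix_append ..)
    · have hk := hb.lt_count_ret
      have hcp := (hl'.2.1 p).count_ret_le p
      rw [countP_ret_proj, countP_ret_proj] at hcp
      rw [List.countP_append] at hj
      by_cases hq : x.proc = q
      · have : j = (seqHistory l).countP (fun z => z.isCall && z.proc = q) := by
          rw [countP_call_seqHistory]
          simp [hq] at hj
          simp at hj'
          omega
        subst this
        exact happensBefore_append_call (q := q) rfl (by exact hq) (lt_of_lt_of_le hk hcp) _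
      · simp [hq] at hj
        simp at hj'
        omega

end

end histories

section recorder

variable {n : ℕ} {M A B : Type*}

/-! ### The recorded history and the history of the object -/

/-- Forget the identity of an action. -/
def Action.forget {I : Type*} : Action n I M A B → Action n Unit M A B
  | .call p _ m a => .call p () m a
  | .ret p _ m b => .ret p () m b

/-- Forget the identity of an operation. -/
def ProcOp.forget {I : Type*} (x : ProcOp n I M A B) : ProcOp n Unit M A B := ⟨x.proc, (), x.op⟩

section forget

variable {I : Type*}

@[simp] theorem Action.proc_forget (x : Action n I M A B) : x.forget.proc = x.proc := by
  cases x <;> rfl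

@[simp] theorem Action.isCall_forget (x : Action n I M A B) : x.forget.isCall = x.isCall := by
  cases x <;> rfl

@[simp] theorem Action.isRet_forget (x : Action n I M A B) : x.forget.isRet = x.isRet := by
  cases x <;> rfl

theorem proj_map_forget (p : Fin n) (h : List (Action n I M A B)) :
    proj p (h.map Action.forget) = (proj p h).map Action.forget := by
  simp [proj, List.filter_map, Function.comp_def]

theorem seqHistory_map_forget (s : List (ProcOp n I M A B)) :
    seqHistory (s.map ProcOp.forget) = (seqHistory s).map Action.forget := by
  induction s with
  | nil => rfl
  | cons x s ih => rw [List.map_cons, seqHistory_cons, ih, seqHistory_cons]; rfl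

theorem Compat.map_forget {t σ : List (Action n I M A B)} (h : Compat t σ) :
    Compat (t.map Action.forget) (σ.map Action.forget) := by
  rcases h with rfl | ⟨p, o, m, a, rfl⟩ | ⟨p, o, m, b, rfl⟩
  · exact .inl rfl
  · exact .inr (.inl ⟨p, (), m, a, by simp [Action.forget]⟩)
  · exact .inr (.inr ⟨p, (), m, b, by simp [Action.forget]⟩)

theorem HappensBefore.map_forget {h : List (Action n I M A B)} {p : Fin n} {k : ℕ} {q : Fin n}
    {j : ℕ} (hb : HappensBefore h p k q j) : HappensBefore (h.map Action.forget) p k q j := by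
  rw [happensBefore_iff] at hb ⊢
  obtain ⟨u, y, w, rfl, hc, hq, hj, hk⟩ := hb
  exact ⟨u.map Action.forget, y.forget, w.map Action.forget, by simp, by simpa using hc,
    by simpa using hq, by simpa [List.countP_map, Function.comp_def] using hj,
    by simpa [List.countP_map, Function.comp_def] using hk⟩

theorem length_seqHistory (s : List (ProcOp n I M A B)) :
    (seqHistory s).length = 2 * s.length := by
  induction s with
  | nil => rfl
  | cons x s ih => simp [seqHistory_cons, ih]; omega

theorem Compat.eq_of_seqHistory {s s' : List (ProcOp n I M A B)}
    (h : Compat (seqHistory s) (seqHistory s')) : seqHistory s = seqHistory s' := by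
  have h1 := length_seqHistory s
  have h2 := length_seqHistory s'
  rcases h with h | ⟨_, _, _, _, h⟩ | ⟨_, _, _, _, h⟩
  · exact h
  · rw [h, List.length_append, List.length_singleton] at h1; omega
  · rw [h, List.length_append, List.length_singleton] at h2; omega

end forget

/-- The phase of an operation, as far as the recorder is concerned: without identity, with an
identity but not recorded as called, recorded as called and not as returned, and recorded as
returned. -/
inductive Phase (M A B : Type*) where
  | starting (m : M) (a : A)
  | identified (v : Invoc M A)
  | active (v : Invoc M A)
  | finished (b : B)

def PC.phase : PC n M A B → Phase M A B
  | .genID m a => .starting m a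
  | .storeCall v => .identified v
  | .announce v => .active v
  | .max v _ _ => .active v
  | .loop v => .active v
  | .setBefore v => .active v
  | .setHelp v _ => .active v
  | .setPrefer v _ _ => .active v
  | .decide v _ _ => .active v
  | .readHis v _ _ => .active v
  | .casHist v _ _ _ => .active v
  | .genLin v _ _ => .active v
  | .genLinScan v _ _ _ _ _ => .active v
  | .genLinChoose v _ _ _ _ => .active v
  | .casLin v _ _ _ => .active v
  | .setNext v _ _ => .active v
  | .setSeq v _ _ => .active v
  | .setHead v _ => .active v
  | .finalHead v => .active v
  | .getRet v _ => .active v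
  | .storeReturn v _ => .active v
  | .done b => .finished b

/-- The relation between the actions `t` of process `p` in the recorder and its actions `t'` in
the history of the object, in each phase of its current operation. -/
def PhaseRel (p : Fin n) (t : RecHistory n M A B) (t' : List (Action n Unit M A B)) :
    Option (M × Phase M A B) → Prop
  | none => (∃ s, t = seqHistory s) ∧ t' = t.map Action.forget
  | some (m, .starting m' a) =>
      m' = m ∧ (∃ s, t = seqHistory s) ∧ t' = t.map Action.forget ++ [.call p () m a]
  | some (m, .identified v) =>
      v.meth = m ∧ (∃ s, t = seqHistory s) ∧ t' = t.map Action.forget ++ [.call p () m v.arg]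
  | some (m, .active v) =>
      v.meth = m ∧ (∃ s, t = seqHistory s ++ [.call p v.oid v.meth v.arg]) ∧
        t' = t.map Action.forget
  | some (m, .finished b) =>
      (∃ s, t = seqHistory s) ∧ t.map Action.forget = t' ++ [.ret p () m b]

theorem PhaseRel.alternating {p : Fin n} {t : RecHistory n M A B}
    {t' : List (Action n Unit M A B)} {o : Option (M × Phase M A B)} (h : PhaseRel p t t' o) :
    Alternating t := by
  have key : ∀ s : OpSeq n M A B, Alternating (seqHistory s) := alternating_seqHistory
  rcases o with _ | ⟨m, _ | _ | _ | _⟩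
  · obtain ⟨⟨s, rfl⟩, -⟩ := h; exact key s
  · obtain ⟨-, ⟨s, rfl⟩, -⟩ := h; exact key s
  · obtain ⟨-, ⟨s, rfl⟩, -⟩ := h; exact key s
  · obtain ⟨-, ⟨s, rfl⟩, -⟩ := h
    rw [alternating_seqHistory_append]; exact .pending ..
  · obtain ⟨⟨s, rfl⟩, -⟩ := h; exact key s

theorem PhaseRel.count_ret_le {p : Fin n} {t : RecHistory n M A B}
    {t' : List (Action n Unit M A B)} {o : Option (M × Phase M A B)} (h : PhaseRel p t t' o) :
    t'.countP (fun z => z.isRet && z.proc = p) ≤ t.countP (fun z => z.isRet && z.proc = p) := by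
  have hm : (t.map Action.forget).countP (fun z => z.isRet && z.proc = p) =
      t.countP (fun z => z.isRet && z.proc = p) := by
    simp [List.countP_map, Function.comp_def]
  rw [← hm]
  rcases o with _ | ⟨m, _ | _ | _ | _⟩
  · rw [h.2]
  · rw [h.2.2]; simp [Action.isRet]
  · rw [h.2.2]; simp [Action.isRet]
  · rw [h.2.2]
  · rw [h.2, List.countP_append]; omega

theorem PhaseRel.compat {p : Fin n} {t : RecHistory n M A B}
    {t' : List (Action n Unit M A B)} {o : Option (M × Phase M A B)} (h : PhaseRel p t t' o)
    {s : OpSeq n M A B} (hc : Compat t (seqHistory s)) :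
    Compat t' ((seqHistory s).map Action.forget) := by
  rcases o with _ | ⟨m, _ | _ | _ | _⟩
  · rw [h.2]; exact hc.map_forget
  · obtain ⟨-, ⟨s', rfl⟩, rfl⟩ := h
    rw [hc.eq_of_seqHistory]
    exact .inr (.inl ⟨_, _, _, _, rfl⟩)
  · obtain ⟨-, ⟨s', rfl⟩, rfl⟩ := h
    rw [hc.eq_of_seqHistory]
    exact .inr (.inl ⟨_, _, _, _, rfl⟩)
  · rw [h.2.2]; exact hc.map_forget
  · obtain ⟨⟨s', rfl⟩, h⟩ := h
    rw [← hc.eq_of_seqHistory, h]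
    exact .inr (.inr ⟨_, _, _, _, rfl⟩)

/-- The configurations of the universal construction. -/
abbrev UConfig (n : ℕ) (M A B : Type*) := Config n M (Mem n M A B) (PC n M A B)

/-- The invariant that relates the recorder to the history `H` of the object. -/
structure RecInv (H : List (Action n Unit M A B)) (c : UConfig n M A B) : Prop where
  rel : ∀ p, PhaseRel p (proj p c.shared.recorder) (proj p H)
    ((c.loc p).map (fun x => (x.1, x.2.phase)))
  nodup : (callIds c.shared.recorder).Nodup
  used : ∀ o ∈ callIds c.shared.recorder, o ∈ c.shared.usedIds
  new_id : ∀ p m v, c.loc p = some (m, .storeCall v) →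
    v.oid ∈ c.shared.usedIds ∧ v.oid ∉ callIds c.shared.recorder ∧
      ∀ q m' v', q ≠ p → c.loc q = some (m', .storeCall v') → v'.oid ≠ v.oid
  order : ∀ p k q j, HappensBefore H p k q j →
    j < c.shared.recorder.countP (fun z => z.isCall && z.proc = q) →
      HappensBefore c.shared.recorder p k q j

theorem RecInv.isHistory {H : List (Action n Unit M A B)} {c : UConfig n M A B}
    (h : RecInv H c) : IsHistory c.shared.recorder := fun p => (h.rel p).alternating

theorem RecInv.count_ret_le {H : List (Action n Unit M A B)} {c : UConfig n M A B}
    (h : RecInv H c) (p : Fin n) : H.countP (fun z => z.isRet && z.proc = p) ≤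
      c.shared.recorder.countP (fun z => z.isRet && z.proc = p) := by
  have := (h.rel p).count_ret_le
  rwa [countP_ret_proj, countP_ret_proj] at this

theorem ApplyStep.phase_cases {Spec : Set (List (Operation M A B))} {p : Fin n}
    {s s' : Mem n M A B} {pc pc' : PC n M A B} (h : ApplyStep Spec p s pc s' pc') :
    (∃ m a oid, pc = .genID m a ∧ oid ∉ s.usedIds ∧
      s' = { s with usedIds := insert oid s.usedIds } ∧ pc' = .storeCall ⟨oid, m, a⟩) ∨
    (∃ v, pc = .storeCall v ∧
      s' = { s with recorder := s.recorder ++ [.call p v.oid v.meth v.arg] } ∧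
      pc' = .announce v) ∨
    (∃ v b, pc = .storeReturn v b ∧
      s' = { s with recorder := s.recorder ++ [.ret p v.oid v.meth b] } ∧ pc' = .done b) ∨
    ∃ v, pc.phase = .active v ∧ pc'.phase = .active v ∧ s'.recorder = s.recorder ∧
      s'.usedIds = s.usedIds := by
  cases h with
  | genID m a oid h => exact .inl ⟨m, a, oid, rfl, h, rfl, rfl⟩
  | storeCall v => exact .inr (.inl ⟨v, rfl, rfl, rfl⟩)
  | storeReturn v b => exact .inr (.inr (.inl ⟨v, b, rfl, rfl, rfl⟩))
  | _ => exact .inr (.inr (.inr ⟨_, rfl, rfl, rfl, rfl⟩))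

theorem RecInv.init : RecInv ([] : List (Action n Unit M A B)) ⟨Mem.init n M A B, fun _ => none⟩ where
  rel p := ⟨⟨[], rfl⟩, rfl⟩
  nodup := List.nodup_nil
  used o ho := by simp [Mem.init, callIds] at ho
  new_id p m v h := by simp at h
  order p k q j h _ := by
    have := h.lt_count_ret
    simp at this

theorem proj_append_single_of_ne {I : Type*} {p : Fin n} {x : Action n I M A B} (hx : x.proc ≠ p)
    (h : List (Action n I M A B)) : proj p (h ++ [x]) = proj p h := by
  rw [proj_append, proj_cons, if_neg hx]; simp

theorem proj_append_call {I : Type*} (p : Fin n) (o : I) (m : M) (a : A)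
    (h : List (Action n I M A B)) :
    proj p (h ++ [.call p o m a]) = proj p h ++ [.call p o m a] := by
  rw [proj_append]; simp [proj, Action.proc]

theorem proj_append_ret {I : Type*} (p : Fin n) (o : I) (m : M) (b : B)
    (h : List (Action n I M A B)) :
    proj p (h ++ [.ret p o m b]) = proj p h ++ [.ret p o m b] := by
  rw [proj_append]; simp [proj, Action.proc]

theorem countP_append_call {I : Type*} (p q : Fin n) (o : I) (m : M) (a : A)
    (h : List (Action n I M A B)) :
    (h ++ [.call p o m a] : List (Action n I M A B)).countP (fun z => z.isCall && z.proc = q) =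
      h.countP (fun z => z.isCall && z.proc = q) + if p = q then 1 else 0 := by
  rw [List.countP_append]
  congr 1
  by_cases hq : p = q <;> simp [Action.isCall, Action.proc, hq]

theorem RecInv.call {H : List (Action n Unit M A B)} {c : UConfig n M A B} (h : RecInv H c)
    {p : Fin n} (m : M) (a : A) (hp : c.loc p = none) :
    RecInv (H ++ [.call p () m a])
      ⟨c.shared, Function.update c.loc p (some (m, .genID m a))⟩ where
  rel q := by
    by_cases hq : q = p
    · subst hq
      have := h.rel q
      rw [hp] at this
      rw [proj_append_call]
      simp only [Function.update_self]
      exact ⟨rfl, this.1, by rw [← this.2]⟩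
    · rw [proj_append_single_of_ne (fun h => hq h.symm)]
      simp only [Function.update_of_ne hq]
      exact h.rel q
  nodup := h.nodup
  used := h.used
  new_id q m' v hq := by
    have key : ∀ q m' v, Function.update c.loc p (some (m, .genID m a)) q =
        some (m', .storeCall v) → c.loc q = some (m', .storeCall v) := by
      intro q m' v hq
      by_cases hqp : q = p
      · subst hqp; simp at hq
      · rwa [Function.update_of_ne hqp] at hq
    have := h.new_id q m' v (key _ _ _ hq)
    exact ⟨this.1, this.2.1, fun q' m'' v' hne hq' => this.2.2 q' m'' v' hne (key _ _ _ hq')⟩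
  order p' k q j hb hj := by
    refine h.order p' k q j (happensBefore_append hb ?_) hj
    have hr := h.rel q
    -- Each recorded call occurs in `H`, so the new call of `H` has no counterpart in the recorder.
    have key : ∀ o, PhaseRel q (proj q c.shared.recorder) (proj q H) o →
        c.shared.recorder.countP (fun z => z.isCall && z.proc = q) ≤
          H.countP (fun z => z.isCall && z.proc = q) := by
      intro o hr
      rw [← countP_call_proj q c.shared.recorder, ← countP_call_proj q H]
      have hm : ((proj q c.shared.recorder).map Action.forget).countP
          (fun z => z.isCall && z.proc = q) =
          (proj q c.shared.recorder).countP (fun z => z.isCall && z.proc = q) := by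
        simp [List.countP_map, Function.comp_def]
      rw [← hm]
      rcases o with _ | ⟨m, _ | _ | _ | _⟩
      · rw [hr.2]
      · rw [hr.2.2, List.countP_append]; omega
      · rw [hr.2.2, List.countP_append]; omega
      · rw [hr.2.2]
      · rw [hr.2, List.countP_append]; simp [Action.isCall]
    exact lt_of_lt_of_le hj (key _ hr)

theorem RecInv.ret {H : List (Action n Unit M A B)} {c : UConfig n M A B} (h : RecInv H c)
    {p : Fin n} {m : M} {b : B} (hp : c.loc p = some (m, .done b)) :
    RecInv (H ++ [.ret p () m b]) ⟨c.shared, Function.update c.loc p none⟩ where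
  rel q := by
    by_cases hq : q = p
    · subst hq
      have := h.rel q
      rw [hp] at this
      rw [proj_append_ret]
      simp only [Function.update_self]
      exact ⟨this.1, this.2.symm⟩
    · rw [proj_append_single_of_ne (fun h => hq h.symm)]
      simp only [Function.update_of_ne hq]
      exact h.rel q
  nodup := h.nodup
  used := h.used
  new_id q m' v hq := by
    have key : ∀ q m' v, Function.update c.loc p none q =
        some (m', .storeCall v) → c.loc q = some (m', .storeCall v) := by
      intro q m' v hq
      by_cases hqp : q = p
      · subst hqp; simp at hq
      · rwa [Function.update_of_ne hqp] at hq
    have := h.new_id q m' v (key _ _ _ hq)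
    exact ⟨this.1, this.2.1, fun q' m'' v' hne hq' => this.2.2 q' m'' v' hne (key _ _ _ hq')⟩
  order p' k q j hb hj := by
    refine h.order p' k q j (happensBefore_append hb ?_) hj
    have := hb.lt_count_call
    simpa [List.countP_append, Action.isCall] using this

theorem RecInv.step {Spec : Set (List (Operation M A B))} {H : List (Action n Unit M A B)}
    {c : UConfig n M A B} (h : RecInv H c) {p : Fin n} {m : M} {pc pc' : PC n M A B}
    {s' : Mem n M A B} (hp : c.loc p = some (m, pc)) (hs : ApplyStep Spec p c.shared pc s' pc') :
    RecInv H ⟨s', Function.update c.loc p (some (m, pc'))⟩ := by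
  have hrel := h.rel p
  rw [hp] at hrel
  -- The parts of the invariant that concern a process `q ≠ p`.
  have other : ∀ x : Action n ℕ M A B, x.proc = p → ∀ q, q ≠ p →
      PhaseRel q (proj q (c.shared.recorder ++ [x])) (proj q H)
        ((Function.update c.loc p (some (m, pc')) q).map (fun x => (x.1, x.2.phase))) := by
    intro x hx q hq
    rw [proj_append_single_of_ne (by rw [hx]; exact hq.symm), Function.update_of_ne hq]
    exact h.rel q
  have old : (∀ v, pc' ≠ .storeCall v) → ∀ q m' v, Function.update c.loc p (some (m, pc')) q =
      some (m', .storeCall v) → q ≠ p ∧ c.loc q = some (m', .storeCall v) := by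
    intro hpc q m' v hq
    by_cases hqp : q = p
    · subst hqp
      simp only [Function.update_self, Option.some.injEq, Prod.mk.injEq] at hq
      exact absurd hq.2 (hpc v)
    · rw [Function.update_of_ne hqp] at hq
      exact ⟨hqp, hq⟩
  rcases hs.phase_cases with ⟨m', a, oid, rfl, hid, rfl, rfl⟩ | ⟨v, rfl, rfl, rfl⟩ |
      ⟨v, b, rfl, rfl, rfl⟩ | ⟨v, h1, h2, h3, h4⟩
  · obtain ⟨rfl, hr2, hr3⟩ := hrel
    refine ⟨fun q => ?_, h.nodup, fun o ho => Finset.mem_insert_of_mem (h.used o ho), ?_, h.order⟩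
    · by_cases hq : q = p
      · subst hq
        simp only [Function.update_self]
        exact ⟨rfl, hr2, hr3⟩
      · simp only [Function.update_of_ne hq]
        exact h.rel q
    · have key : ∀ q m'' v, q ≠ p → Function.update c.loc p
          (some (m', .storeCall ⟨oid, m', a⟩)) q = some (m'', .storeCall v) →
          c.loc q = some (m'', .storeCall v) := by
        intro q m'' v hq hq'
        rwa [Function.update_of_ne hq] at hq'
      intro q m'' v hq
      by_cases hqp : q = p
      · subst hqp
        simp only [Function.update_self, Option.some.injEq, Prod.mk.injEq,
          PC.storeCall.injEq] at hq
        obtain ⟨-, rfl⟩ := hq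
        refine ⟨Finset.mem_insert_self _ _, fun ho => hid (h.used _ ho), ?_⟩
        rintro q' m'' v' hne hq' rfl
        exact hid (h.new_id _ _ _ (key _ _ _ hne hq')).1
      · have hn := h.new_id q m'' v (key _ _ _ hqp hq)
        refine ⟨Finset.mem_insert_of_mem hn.1, hn.2.1, ?_⟩
        intro q' m₁ v' hne hq'
        by_cases hqp' : q' = p
        · subst hqp'
          simp only [Function.update_self, Option.some.injEq, Prod.mk.injEq,
            PC.storeCall.injEq] at hq'
          obtain ⟨-, rfl⟩ := hq'
          rintro rfl
          exact hid hn.1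
        · exact hn.2.2 q' m₁ v' hne (key _ _ _ hqp' hq')
  · obtain ⟨rfl, ⟨s, hr2⟩, hr3⟩ := hrel
    have hv := h.new_id _ _ _ hp
    have hci : callIds (c.shared.recorder ++ [.call p v.oid v.meth v.arg]) =
        callIds c.shared.recorder ++ [v.oid] := by rw [callIds_append]; rfl
    refine ⟨fun q => ?_, ?_, ?_, ?_, ?_⟩
    · by_cases hq : q = p
      · subst hq
        simp only [Function.update_self]
        rw [proj_append_call]
        exact ⟨rfl, ⟨s, by rw [hr2]⟩, by rw [hr3]; simp [Action.forget]⟩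
      · exact other _ rfl q hq
    · simp only [hci]
      rw [List.nodup_append]
      exact ⟨h.nodup, by simp, by rintro o ho _ ho' rfl; simp at ho'; exact hv.2.1 (ho' ▸ ho)⟩
    · simp only [hci]
      intro o ho
      rcases List.mem_append.1 ho with ho | ho
      · exact h.used o ho
      · rw [List.mem_singleton.1 ho]; exact hv.1
    · intro q m' v' hq
      obtain ⟨hne, hq⟩ := old (by simp) _ _ _ hq
      have hn := h.new_id _ _ _ hq
      refine ⟨hn.1, ?_, fun q' m₁ v₁ hne' hq' => hn.2.2 _ _ _ hne' (old (by simp) _ _ _ hq').2⟩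
      simp only [hci]
      simp only [List.mem_append, List.mem_singleton, not_or]
      exact ⟨hn.2.1, hv.2.2 _ _ _ hne hq⟩
    · intro p' k q j hb hj
      by_cases hj' : j < c.shared.recorder.countP (fun z => z.isCall && z.proc = q)
      · exact (h.order p' k q j hb hj').of_prefix (List.prefix_append ..)
      · -- The new call of the recorder comes after all its returns, among them those of `H`.
        simp only [countP_append_call] at hj
        by_cases hq : p = q
        · have : j = c.shared.recorder.countP (fun z => z.isCall && z.proc = q) := by
            rw [if_pos hq] at hj
            omega
          subst this
          exact happensBefore_append_call (q := q) rfl (by exact hq)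
            (lt_of_lt_of_le hb.lt_count_ret (h.count_ret_le p')) _
        · rw [if_neg hq] at hj
          omega
  · obtain ⟨rfl, ⟨s, hr2⟩, hr3⟩ := hrel
    have hci : callIds (c.shared.recorder ++ [.ret p v.oid v.meth b]) =
        callIds c.shared.recorder := by rw [callIds_append]; simp [callIds]
    refine ⟨fun q => ?_, ?_, ?_, ?_, ?_⟩
    · by_cases hq : q = p
      · subst hq
        simp only [Function.update_self]
        rw [proj_append_ret]
        refine ⟨⟨s ++ [⟨q, v.oid, ⟨v.meth, v.arg, b⟩⟩], ?_⟩, ?_⟩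
        · rw [hr2, seqHistory_append]; simp [seqHistory_cons]
        · rw [hr3]; simp [Action.forget]
      · exact other _ rfl q hq
    · simp only [hci]; exact h.nodup
    · simp only [hci]; exact h.used
    · intro q m' v' hq
      simp only [hci]
      have hn := h.new_id _ _ _ (old (by simp) _ _ _ hq).2
      exact ⟨hn.1, hn.2.1, fun q' m₁ v₁ hne' hq' =>
        hn.2.2 _ _ _ hne' (old (by simp) _ _ _ hq').2⟩
    · intro p' k q j hb hj
      refine (h.order p' k q j hb ?_).of_prefix (List.prefix_append ..)
      simpa [List.countP_append, Action.isCall] using hj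
  · have hpc : ∀ v, pc' ≠ .storeCall v := by
      rintro v rfl
      simp [PC.phase] at h2
    refine ⟨fun q => ?_, ?_, ?_, ?_, ?_⟩
    · simp only [h3]
      by_cases hq : q = p
      · subst hq
        simp only [Function.update_self, Option.map_some, h2]
        simpa only [Option.map_some, h1] using hrel
      · simp only [Function.update_of_ne hq]
        exact h.rel q
    · simp only [h3]; exact h.nodup
    · simp only [h3, h4]; exact h.used
    · intro q m' v' hq
      have hn := h.new_id _ _ _ (old hpc _ _ _ hq).2
      simp only [h3, h4]
      exact ⟨hn.1, hn.2.1, fun q' m₁ v₁ hne' hq' => hn.2.2 _ _ _ hne' (old hpc _ _ _ hq').2⟩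
    · simp only [h3]; exact h.order

/-- A linearization of the recorded history is one of the history of the object. -/
theorem RecInv.isLinearization {Spec : Set (List (Operation M A B))}
    {H : List (Action n Unit M A B)} {c : UConfig n M A B} (h : RecInv H c)
    {l : OpSeq n M A B} (hl : IsLinearization Spec c.shared.recorder l) :
    IsLinearization Spec H (l.map ProcOp.forget) := by
  have hl' := isLinearization_iff.1 hl
  refine isLinearization_iff.2 ⟨?_, fun p => ?_, fun p k q j hb hj => ?_⟩
  · simpa [Function.comp_def, ProcOp.forget] using hl'.1
  · have hc := hl'.2.1 p
    rw [seqHistory_map_forget, proj_map_forget]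
    rw [proj_seqHistory] at hc ⊢
    exact (h.rel p).compat hc
  · rw [seqHistory_map_forget]
    have hj' : j < l.countP (fun x => x.proc = q) := by
      rw [List.countP_map] at hj; exact hj
    have hcc := (hl'.2.1 q).count_call_le q
    rw [countP_call_proj, countP_call_proj, countP_call_seqHistory] at hcc
    exact (hl'.2.2 p k q j (h.order p k q j hb (lt_of_lt_of_le hj' hcc)) hj').map_forget

end recorder

section linkedlist

variable {n : ℕ} {M A B : Type*}

/-! ### The linked list -/

theorem getElem?_of_prefix {α : Type*} {l l' : List α} (h : l <+: l') {k : ℕ} {x : α}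
    (hx : l[k]? = some x) : l'[k]? = some x := by
  obtain ⟨t, rfl⟩ := h
  obtain ⟨hk, -⟩ := List.getElem?_eq_some_iff.1 hx
  rw [List.getElem?_append_left hk, hx]

theorem getElem?_append_singleton {α : Type*} {l : List α} {k : ℕ} {x y : α} :
    (l ++ [x])[k]? = some y ↔ l[k]? = some y ∨ k = l.length ∧ y = x := by
  rcases lt_trichotomy k l.length with h | h | h
  · rw [List.getElem?_append_left h]; simp [h.ne]
  · subst h; simp [eq_comm]
  · simp [List.getElem?_eq_none, h.le, Nat.succ_le_of_lt h, h.ne']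

theorem take_eq_of_prefix {α : Type*} {l l' : List α} (h : l <+: l') {k : ℕ} {x : α}
    (hx : l[k]? = some x) : l'.take (k + 1) = l.take (k + 1) := by
  obtain ⟨t, rfl⟩ := h
  obtain ⟨hk, rfl⟩ := List.getElem?_eq_some_iff.1 hx
  exact List.take_append_of_le_length hk

theorem mem_take_iff {α : Type*} {l : List α} {k : ℕ} {x : α} :
    x ∈ l.take k ↔ ∃ j < k, l[j]? = some x := by
  rw [List.mem_iff_getElem?]
  constructor
  · rintro ⟨j, hj⟩
    rw [List.getElem?_take] at hj
    split_ifs at hj with h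
    exact ⟨j, h, hj⟩
  · rintro ⟨j, h, hj⟩
    exact ⟨j, by rw [List.getElem?_take, if_pos h, hj]⟩

theorem nodup_getElem?_unique {α : Type*} {l : List α} (h : l.Nodup) {i j : ℕ} {x : α}
    (hi : l[i]? = some x) (hj : l[j]? = some x) : i = j := by
  obtain ⟨h1, h2⟩ := List.getElem?_eq_some_iff.1 hi
  obtain ⟨h3, h4⟩ := List.getElem?_eq_some_iff.1 hj
  exact (h.getElem_inj_iff).1 (h2.trans h4.symm)

/-- The node at position `j` of the list `L` of addresses belongs to the invocation `w`, and its
`lin`-field is `l`. -/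
def Linked (L : List ℕ) (s : Mem n M A B) (j : ℕ) (w : Invoc M A) (l : OpSeq n M A B) : Prop :=
  ∃ r, L[j]? = some r ∧ (s.heap r).inv = some w ∧ (s.heap r).lin = some l

/-- `l` contains the operation `o`, with the return value that it has in `l'`. -/
def Agree (l : OpSeq n M A B) (o : ℕ) (l' : OpSeq n M A B) : Prop :=
  ∃ x ∈ l, x.tag = o ∧ ∃ y ∈ l', y.tag = o ∧ x.op.res = y.op.res

/-- The operation `o` has the return value `b` in the `lin`-field of its node, which is among the
first `k` nodes of the list. -/
def HasResult (L : List ℕ) (s : Mem n M A B) (k o : ℕ) (b : B) : Prop :=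
  ∃ j w l, j < k ∧ Linked L s j w l ∧ w.oid = o ∧ ∃ x ∈ l, x.tag = o ∧ x.op.res = b

/-- Each return in `h` is that of an operation of the first `k` nodes, with the value that the
`lin`-field of its node prescribes. -/
def RetsBefore (L : List ℕ) (s : Mem n M A B) (k : ℕ) (h : RecHistory n M A B) : Prop :=
  ∀ p o m b, Action.ret p o m b ∈ h → HasResult L s k o b

/-- The invocation `w` occurs in `h`. -/
def Called (h : RecHistory n M A B) (w : Invoc M A) : Prop :=
  ∃ p, Action.call p w.oid w.meth w.arg ∈ h

/-- The properties of a history `h` that may be stored in the node `r` at position `k + 1`. -/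
structure HistOK (L : List ℕ) (s : Mem n M A B) (k r : ℕ) (h : RecHistory n M A B) : Prop where
  pre : h <+: s.recorder
  called : ∃ w, (s.heap r).inv = some w ∧ Called h w
  rets : RetsBefore L s (k + 1) h
  prev : k = 0 ∨ ∃ r₀ h₀, L[k]? = some r₀ ∧ (s.heap r₀).hist = some h₀ ∧ h₀ <+: h

/-- The properties of a linearization `l` of `h` that may be stored in the node `r` at position
`k + 1`. -/
structure LinOK (Spec : Set (List (Operation M A B))) (L : List ℕ) (s : Mem n M A B) (k r : ℕ)
    (h : RecHistory n M A B) (l : OpSeq n M A B) : Prop where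
  isLin : IsLinearization Spec h l
  own : ∃ w, (s.heap r).inv = some w ∧ ∃ x ∈ l, x.tag = w.oid
  agree : ∀ j, 0 < j → j ≤ k → ∃ w l', Linked L s j w l' ∧ Agree l w.oid l'

/-- The pairs `cs` are those that a walk reads from the nodes at the positions below `i`. -/
def ScanOK (L : List ℕ) (s : Mem n M A B) (i : ℕ) (cs : List (ℕ × OpSeq n M A B)) : Prop :=
  (∀ j, 0 < j → j < i → ∃ w l, Linked L s j w l ∧ (w.oid, l) ∈ cs) ∧
  ∀ c ∈ cs, ∃ j w l, 0 < j ∧ j < i ∧ Linked L s j w l ∧ c = (w.oid, l)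

/-- The invariant of the memory, where `L` lists the addresses of the decided nodes in their
order: the successor of a node is the value of its consensus object. Only the last node of `L`
may be incomplete. -/
structure ListInv (Spec : Set (List (Operation M A B))) (L : List ℕ) (s : Mem n M A B) :
    Prop where
  zero : L[0]? = some 0
  nodup : L.Nodup
  chain : ∀ k r, L[k]? = some r → (s.heap r).decideNext = L[k + 1]?
  unused : ∀ r, s.fresh ≤ r → r ∉ L ∧ (s.heap r).inv = none
  outside : ∀ r, r ∉ L → s.heap r = Node.new (s.heap r).inv
  tail : (s.heap 0).inv = none ∧ (s.heap 0).seq = 1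
  invoc : ∀ k r, L[k + 1]? = some r → ∃ w, (s.heap r).inv = some w
  called : ∀ r w, (s.heap r).inv = some w → Called s.recorder w
  seq_eq : ∀ k r, L[k]? = some r → (s.heap r).seq ≠ 0 → (s.heap r).seq = k + 1
  seq_pred : ∀ k r r', L[k]? = some r → L[k + 1]? = some r' → (s.heap r).seq ≠ 0
  linked : ∀ k r r', L[k]? = some r → L[k + 1]? = some r' → (s.heap r').seq ≠ 0 →
    (s.heap r).next = some r' ∧ ∃ l, (s.heap r').lin = some l
  next_eq : ∀ k r r', L[k]? = some r → (s.heap r).next = some r' → L[k + 1]? = some r'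
  hist : ∀ k r h, L[k + 1]? = some r → (s.heap r).hist = some h → HistOK L s k r h
  lin : ∀ k r l, L[k + 1]? = some r → (s.heap r).lin = some l →
    ∃ h, (s.heap r).hist = some h ∧ LinOK Spec L s k r h l
  head : ∀ p, (s.heap (s.head p)).seq ≠ 0
  announced : ∀ p, s.announce p = 0 ∨ ∃ w, (s.heap (s.announce p)).inv = some w
  rets : RetsBefore L s L.length s.recorder

/-- The list and the memory only grow: no field that has been set changes. -/
structure Ext (L : List ℕ) (s : Mem n M A B) (L' : List ℕ) (s' : Mem n M A B) : Prop where
  list : L <+: L'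
  inv : ∀ r w, (s.heap r).inv = some w → (s'.heap r).inv = some w
  hist : ∀ r h, (s.heap r).hist = some h → (s'.heap r).hist = some h
  lin : ∀ r l, (s.heap r).lin = some l → (s'.heap r).lin = some l
  next : ∀ r r', (s.heap r).next = some r' → (s'.heap r).next = some r'
  seq : ∀ r, (s.heap r).seq ≠ 0 → (s'.heap r).seq = (s.heap r).seq
  recorder : s.recorder <+: s'.recorder

variable {Spec : Set (List (Operation M A B))} {L L' : List ℕ} {s s' : Mem n M A B}

theorem Ext.seq_ne (hE : Ext L s L' s') {r : ℕ} (h : (s.heap r).seq ≠ 0) :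
    (s'.heap r).seq ≠ 0 := by rwa [hE.seq r h]

theorem Linked.mono (hE : Ext L s L' s') {j : ℕ} {w : Invoc M A} {l : OpSeq n M A B}
    (h : Linked L s j w l) : Linked L' s' j w l := by
  obtain ⟨r, h1, h2, h3⟩ := h
  exact ⟨r, getElem?_of_prefix hE.list h1, hE.inv _ _ h2, hE.lin _ _ h3⟩

theorem HasResult.mono (hE : Ext L s L' s') {k k' o : ℕ} (hk : k ≤ k') {b : B}
    (h : HasResult L s k o b) : HasResult L' s' k' o b := by
  obtain ⟨j, w, l, hj, hl, hr⟩ := h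
  exact ⟨j, w, l, by omega, hl.mono hE, hr⟩

theorem RetsBefore.mono (hE : Ext L s L' s') {k k' : ℕ} (hk : k ≤ k') {h : RecHistory n M A B}
    (hh : RetsBefore L s k h) : RetsBefore L' s' k' h :=
  fun p o m b hm => (hh p o m b hm).mono hE hk

theorem Called.mono {h h' : RecHistory n M A B} (hp : h <+: h') {w : Invoc M A}
    (hc : Called h w) : Called h' w := by
  obtain ⟨p, hc⟩ := hc
  exact ⟨p, hp.subset hc⟩

theorem HistOK.mono (hE : Ext L s L' s') {k r : ℕ} {h : RecHistory n M A B}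
    (hh : HistOK L s k r h) : HistOK L' s' k r h where
  pre := hh.pre.trans hE.recorder
  called := by
    obtain ⟨w, h1, h2⟩ := hh.called
    exact ⟨w, hE.inv _ _ h1, h2⟩
  rets := hh.rets.mono hE le_rfl
  prev := by
    rcases hh.prev with h0 | ⟨r₀, h₀, h1, h2, h3⟩
    · exact .inl h0
    · exact .inr ⟨r₀, h₀, getElem?_of_prefix hE.list h1, hE.hist _ _ h2, h3⟩

theorem LinOK.mono (hE : Ext L s L' s') {k r : ℕ} {h : RecHistory n M A B} {l : OpSeq n M A B}
    (hl : LinOK Spec L s k r h l) : LinOK Spec L' s' k r h l where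
  isLin := hl.isLin
  own := by
    obtain ⟨w, h1, h2⟩ := hl.own
    exact ⟨w, hE.inv _ _ h1, h2⟩
  agree j h0 hj := by
    obtain ⟨w, l', h1, h2⟩ := hl.agree j h0 hj
    exact ⟨w, l', h1.mono hE, h2⟩

theorem ScanOK.mono (hE : Ext L s L' s') {i : ℕ} {cs : List (ℕ × OpSeq n M A B)}
    (h : ScanOK L s i cs) : ScanOK L' s' i cs := by
  refine ⟨fun j h0 hj => ?_, fun c hc => ?_⟩
  · obtain ⟨w, l, h1, h2⟩ := h.1 j h0 hj
    exact ⟨w, l, h1.mono hE, h2⟩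
  · obtain ⟨j, w, l, h0, hj, h1, h2⟩ := h.2 c hc
    exact ⟨j, w, l, h0, hj, h1.mono hE, h2⟩

theorem ListInv.exists_pos (hI : ListInv Spec L s) {r : ℕ} (h : (s.heap r).seq ≠ 0) :
    ∃ k : ℕ, L[k]? = some r := by
  rw [← List.mem_iff_getElem?]
  by_contra hr
  rw [hI.outside r hr] at h
  exact h rfl

theorem ListInv.seq_of_le (hI : ListInv Spec L s) {j k r r' : ℕ} (hr : L[k]? = some r)
    (h : (s.heap r).seq ≠ 0) (hj : j ≤ k) (hr' : L[j]? = some r') : (s.heap r').seq ≠ 0 := by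
  rcases hj.lt_or_eq with hj | rfl
  · obtain ⟨hk, -⟩ := List.getElem?_eq_some_iff.1 hr
    exact hI.seq_pred j r' (L[j + 1]'(by omega)) hr' (List.getElem?_eq_getElem _)
  · rw [hr] at hr'
    cases hr'
    exact h

theorem ListInv.notMem_take (hI : ListInv Spec L s) {k r r' : ℕ} (hr : L[k]? = some r)
    (h : (s.heap r).seq ≠ 0) (hr' : (s.heap r').seq = 0) : r' ∉ L.take (k + 1) := by
  rw [mem_take_iff]
  rintro ⟨j, hj, h'⟩
  exact hI.seq_of_le hr h (by omega) h' hr'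

/-- A node other than the sentinel whose sequence number is set is complete. -/
theorem ListInv.exists_lin (hI : ListInv Spec L s) {k r : ℕ} (hr : L[k + 1]? = some r)
    (h : (s.heap r).seq ≠ 0) : ∃ w l h, (s.heap r).inv = some w ∧ (s.heap r).lin = some l ∧
      (s.heap r).hist = some h ∧ LinOK Spec L s k r h l ∧ HistOK L s k r h := by
  obtain ⟨hk, -⟩ := List.getElem?_eq_some_iff.1 hr
  obtain ⟨-, l, hl⟩ := hI.linked k (L[k]'(by omega)) r (List.getElem?_eq_getElem _) hr h
  obtain ⟨w, hw⟩ := hI.invoc k r hr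
  obtain ⟨h, hh, hlin⟩ := hI.lin k r l hr hl
  exact ⟨w, l, h, hw, hl, hh, hlin, hI.hist k r h hr hh⟩

/-- The local invariant of process `p`. That a node is not in `L.take (k + 1)` says that it does
not occur in the list up to position `k`; it may be appended later. -/
def PCInv (Spec : Set (List (Operation M A B))) (p : Fin n) (L : List ℕ) (s : Mem n M A B) :
    PC n M A B → Prop
  | .genID _ _ => True
  | .storeCall _ => True
  | .announce v => Called s.recorder v
  | .max v i best => (s.heap (s.announce p)).inv = some v ∧ i ≤ n ∧ (s.heap best).seq ≠ 0
  | .loop v => (s.heap (s.announce p)).inv = some v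
  | .setBefore v => (s.heap (s.announce p)).inv = some v ∧
      ∃ k : ℕ, L[k]? = some (s.head p) ∧ s.announce p ∉ L.take (k + 1)
  | .setHelp v before => (s.heap (s.announce p)).inv = some v ∧
      ∃ k : ℕ, L[k]? = some before ∧ (s.heap before).seq ≠ 0 ∧ s.announce p ∉ L.take (k + 1)
  | .setPrefer v before help => (s.heap (s.announce p)).inv = some v ∧
      (help = 0 ∨ ∃ w, (s.heap help).inv = some w) ∧
      ∃ k : ℕ, L[k]? = some before ∧ (s.heap before).seq ≠ 0 ∧ s.announce p ∉ L.take (k + 1)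
  | .decide v before prefer => (s.heap (s.announce p)).inv = some v ∧
      (∃ w, (s.heap prefer).inv = some w) ∧
      ∃ k : ℕ, L[k]? = some before ∧ (s.heap before).seq ≠ 0 ∧ prefer ∉ L.take (k + 1)
  | .readHis v before after => (s.heap (s.announce p)).inv = some v ∧
      ∃ k : ℕ, L[k]? = some before ∧ L[k + 1]? = some after
  | .casHist v before after h₁ => (s.heap (s.announce p)).inv = some v ∧
      ∃ k : ℕ, L[k]? = some before ∧ L[k + 1]? = some after ∧
        ((s.heap after).hist = none → HistOK L s k after h₁)
  | .genLin v before after => (s.heap (s.announce p)).inv = some v ∧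
      ∃ k : ℕ, L[k]? = some before ∧ L[k + 1]? = some after ∧ ∃ h, (s.heap after).hist = some h
  | .genLinScan v before after h cur cs => (s.heap (s.announce p)).inv = some v ∧
      ∃ k : ℕ, L[k]? = some before ∧ L[k + 1]? = some after ∧ (s.heap after).hist = some h ∧
        ∃ i : ℕ, i ≤ k ∧ L[i]? = some cur ∧ ScanOK L s i cs
  | .genLinChoose v before after h cs => (s.heap (s.announce p)).inv = some v ∧
      ∃ k : ℕ, L[k]? = some before ∧ L[k + 1]? = some after ∧ (s.heap after).hist = some h ∧
        ScanOK L s (k + 1) cs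
  | .casLin v before after l => (s.heap (s.announce p)).inv = some v ∧
      ∃ k : ℕ, L[k]? = some before ∧ L[k + 1]? = some after ∧
        ∃ h, (s.heap after).hist = some h ∧ LinOK Spec L s k after h l
  | .setNext v before after => (s.heap (s.announce p)).inv = some v ∧
      ∃ k : ℕ, L[k]? = some before ∧ L[k + 1]? = some after ∧ ∃ l, (s.heap after).lin = some l
  | .setSeq v before after => (s.heap (s.announce p)).inv = some v ∧
      ∃ k : ℕ, L[k]? = some before ∧ L[k + 1]? = some after ∧ (∃ l, (s.heap after).lin = some l) ∧
        (s.heap before).next = some after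
  | .setHead v after => (s.heap (s.announce p)).inv = some v ∧ (s.heap after).seq ≠ 0
  | .finalHead v => (s.heap (s.announce p)).inv = some v ∧ (s.heap (s.announce p)).seq ≠ 0
  | .getRet v cur => (s.heap (s.announce p)).inv = some v ∧ (s.heap (s.announce p)).seq ≠ 0 ∧
      ∃ i k : ℕ, i ≤ k ∧ L[i]? = some cur ∧ L[k]? = some (s.announce p)
  | .storeReturn v b => HasResult L s L.length v.oid b
  | .done _ => True

/-- Steps of the other processes preserve the local invariant. -/
theorem PCInv.mono (hE : Ext L s L' s') {p : Fin n} (ha : s'.announce p = s.announce p)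
    (hh : s'.head p = s.head p) {pc : PC n M A B} (h : PCInv Spec p L s pc) :
    PCInv Spec p L' s' pc := by
  have hget : ∀ {k r : ℕ}, L[k]? = some r → L'[k]? = some r := fun h =>
    getElem?_of_prefix hE.list h
  have htake : ∀ {k r x : ℕ}, L[k]? = some r → x ∉ L.take (k + 1) → x ∉ L'.take (k + 1) := by
    intro k r x hk hx
    rwa [take_eq_of_prefix hE.list hk]
  have hinv : ∀ {x : ℕ}, (∃ w, (s.heap x).inv = some w) → ∃ w, (s'.heap x).inv = some w := by
    rintro x ⟨w, hw⟩
    exact ⟨w, hE.inv _ _ hw⟩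
  cases pc with
  | genID m a => trivial
  | storeCall v => trivial
  | announce v => exact Called.mono hE.recorder h
  | max v i best => exact ⟨by rw [ha]; exact hE.inv _ _ h.1, h.2.1, hE.seq_ne h.2.2⟩
  | loop v => show _ = _; rw [ha]; exact hE.inv _ _ h
  | setBefore v =>
    obtain ⟨h0, k, h1, h2⟩ := h
    exact ⟨by rw [ha]; exact hE.inv _ _ h0, k, by rw [hh]; exact hget h1,
      by rw [ha]; exact htake h1 h2⟩
  | setHelp v before =>
    obtain ⟨h0, k, h1, h2, h3⟩ := h
    exact ⟨by rw [ha]; exact hE.inv _ _ h0, k, hget h1, hE.seq_ne h2,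
      by rw [ha]; exact htake h1 h3⟩
  | setPrefer v before help =>
    obtain ⟨h0, h4, k, h1, h2, h3⟩ := h
    exact ⟨by rw [ha]; exact hE.inv _ _ h0, h4.imp_right hinv, k, hget h1, hE.seq_ne h2,
      by rw [ha]; exact htake h1 h3⟩
  | decide v before prefer =>
    obtain ⟨h0, h4, k, h1, h2, h3⟩ := h
    exact ⟨by rw [ha]; exact hE.inv _ _ h0, hinv h4, k, hget h1, hE.seq_ne h2, htake h1 h3⟩
  | readHis v before after =>
    obtain ⟨h0, k, h1, h2⟩ := h
    exact ⟨by rw [ha]; exact hE.inv _ _ h0, k, hget h1, hget h2⟩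
  | casHist v before after h₁ =>
    obtain ⟨h0, k, h1, h2, h3⟩ := h
    refine ⟨by rw [ha]; exact hE.inv _ _ h0, k, hget h1, hget h2, fun hn => (h3 ?_).mono hE⟩
    rcases hx : (s.heap after).hist with _ | x
    · rfl
    · rw [hE.hist _ _ hx] at hn; cases hn
  | genLin v before after =>
    obtain ⟨h0, k, h1, h2, x, h3⟩ := h
    exact ⟨by rw [ha]; exact hE.inv _ _ h0, k, hget h1, hget h2, x, hE.hist _ _ h3⟩
  | genLinScan v before after x cur cs =>
    obtain ⟨h0, k, h1, h2, h3, i, h4, h5, h6⟩ := h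
    exact ⟨by rw [ha]; exact hE.inv _ _ h0, k, hget h1, hget h2, hE.hist _ _ h3, i, h4, hget h5,
      h6.mono hE⟩
  | genLinChoose v before after x cs =>
    obtain ⟨h0, k, h1, h2, h3, h6⟩ := h
    exact ⟨by rw [ha]; exact hE.inv _ _ h0, k, hget h1, hget h2, hE.hist _ _ h3, h6.mono hE⟩
  | casLin v before after l =>
    obtain ⟨h0, k, h1, h2, x, h3, h6⟩ := h
    exact ⟨by rw [ha]; exact hE.inv _ _ h0, k, hget h1, hget h2, x, hE.hist _ _ h3, h6.mono hE⟩
  | setNext v before after =>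
    obtain ⟨h0, k, h1, h2, x, h3⟩ := h
    exact ⟨by rw [ha]; exact hE.inv _ _ h0, k, hget h1, hget h2, x, hE.lin _ _ h3⟩
  | setSeq v before after =>
    obtain ⟨h0, k, h1, h2, ⟨x, h3⟩, h4⟩ := h
    exact ⟨by rw [ha]; exact hE.inv _ _ h0, k, hget h1, hget h2, ⟨x, hE.lin _ _ h3⟩,
      hE.next _ _ h4⟩
  | setHead v after => exact ⟨by rw [ha]; exact hE.inv _ _ h.1, hE.seq_ne h.2⟩
  | finalHead v =>
    exact ⟨by rw [ha]; exact hE.inv _ _ h.1, by rw [ha]; exact hE.seq_ne h.2⟩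
  | getRet v cur =>
    obtain ⟨h0, h1, i, k, h2, h3, h4⟩ := h
    exact ⟨by rw [ha]; exact hE.inv _ _ h0, by rw [ha]; exact hE.seq_ne h1, i, k, h2, hget h3,
      by rw [ha]; exact hget h4⟩
  | storeReturn v b => exact HasResult.mono hE hE.list.length_le h
  | done b => trivial

/-! ### Steps that do not change the nodes -/

theorem Ext.of_heap_eq (hheap : s'.heap = s.heap) (hrec : s.recorder <+: s'.recorder) :
    Ext L s L s' := by
  refine ⟨List.prefix_rfl, ?_, ?_, ?_, ?_, ?_, hrec⟩ <;> simp only [hheap] <;> simp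

theorem ListInv.of_heap_eq (hI : ListInv Spec L s) (hheap : s'.heap = s.heap)
    (hfresh : s'.fresh = s.fresh) (hann : s'.announce = s.announce)
    (hhead : ∀ p, (s.heap (s'.head p)).seq ≠ 0) (hrec : s.recorder <+: s'.recorder)
    (hrets : RetsBefore L s L.length s'.recorder) : ListInv Spec L s' where
  zero := hI.zero
  nodup := hI.nodup
  chain := by rw [hheap]; exact hI.chain
  unused := by rw [hheap, hfresh]; exact hI.unused
  outside := by rw [hheap]; exact hI.outside
  tail := by rw [hheap]; exact hI.tail
  invoc := by rw [hheap]; exact hI.invoc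
  called r w h := by rw [hheap] at h; exact (hI.called r w h).mono hrec
  seq_eq := by rw [hheap]; exact hI.seq_eq
  seq_pred := by rw [hheap]; exact hI.seq_pred
  linked := by rw [hheap]; exact hI.linked
  next_eq := by rw [hheap]; exact hI.next_eq
  hist k r h := by
    rw [hheap]
    exact fun h1 h2 => (hI.hist k r h h1 h2).mono (.of_heap_eq hheap hrec)
  lin k r l := by
    rw [hheap]
    intro h1 h2
    obtain ⟨h, h3, h4⟩ := hI.lin k r l h1 h2
    exact ⟨h, h3, h4.mono (.of_heap_eq hheap hrec)⟩
  head := by rw [hheap]; exact hhead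
  announced := by rw [hheap, hann]; exact hI.announced
  rets := hrets.mono (.of_heap_eq hheap hrec) le_rfl

theorem ListInv.setHead (hI : ListInv Spec L s) (p : Fin n) {r : ℕ} (hr : (s.heap r).seq ≠ 0) :
    ListInv Spec L { s with head := Function.update s.head p r } := by
  refine hI.of_heap_eq rfl rfl rfl (fun q => ?_) List.prefix_rfl hI.rets
  by_cases hq : q = p
  · subst hq; simpa using hr
  · simpa [hq] using hI.head q

/-! ### Steps that change one node -/

theorem heap_modify (s : Mem n M A B) (r : ℕ) (f : Node n M A B → Node n M A B) (q : ℕ) :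
    (s.modify r f).heap q = if q = r then f (s.heap r) else s.heap q := by
  simp [Mem.modify, Function.update_apply]

/-- A change of a node of the list that leaves the invocation and the consensus object as they are
preserves the invariant if it preserves the clauses on the other fields, stated here as
hypotheses. -/
theorem ListInv.modify (hI : ListInv Spec L s) {r : ℕ} {f : Node n M A B → Node n M A B}
    (hr : r ∈ L) (hinv : ∀ q, ((s.modify r f).heap q).inv = (s.heap q).inv)
    (hdec : ∀ q, ((s.modify r f).heap q).decideNext = (s.heap q).decideNext)
    (hE : Ext L s L (s.modify r f))
    (hseq : ∀ k q, L[k]? = some q → ((s.modify r f).heap q).seq ≠ 0 →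
      ((s.modify r f).heap q).seq = k + 1)
    (hlinked : ∀ k q q', L[k]? = some q → L[k + 1]? = some q' →
      ((s.modify r f).heap q').seq ≠ 0 → ((s.modify r f).heap q).next = some q' ∧
        ∃ l, ((s.modify r f).heap q').lin = some l)
    (hnext : ∀ k q q', L[k]? = some q → ((s.modify r f).heap q).next = some q' →
      L[k + 1]? = some q')
    (hhist : ∀ k q h, L[k + 1]? = some q → ((s.modify r f).heap q).hist = some h →
      HistOK L s k q h)
    (hlin : ∀ k q l, L[k + 1]? = some q → ((s.modify r f).heap q).lin = some l →
      ∃ h, (s.heap q).hist = some h ∧ LinOK Spec L s k q h l) :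
    ListInv Spec L (s.modify r f) where
  zero := hI.zero
  nodup := hI.nodup
  chain k q hq := by rw [hdec]; exact hI.chain k q hq
  unused q hq := by rw [hinv]; exact hI.unused q hq
  outside q hq := by
    rw [heap_modify, if_neg (by rintro rfl; exact hq hr)]; exact hI.outside q hq
  tail := ⟨by rw [hinv]; exact hI.tail.1, by
    rw [hE.seq 0 (by rw [hI.tail.2]; simp)]; exact hI.tail.2⟩
  invoc k q hq := by rw [hinv]; exact hI.invoc k q hq
  called q w hq := by rw [hinv] at hq; exact hI.called q w hq
  seq_eq := hseq
  seq_pred k q q' h h' := hE.seq_ne (hI.seq_pred k q q' h h')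
  linked := hlinked
  next_eq := hnext
  hist k q h h1 h2 := (hhist k q h h1 h2).mono hE
  lin k q l h1 h2 := by
    obtain ⟨h, h3, h4⟩ := hlin k q l h1 h2
    exact ⟨h, hE.hist _ _ h3, h4.mono hE⟩
  head p := hE.seq_ne (hI.head p)
  announced p := (hI.announced p).imp_right fun ⟨w, hw⟩ => ⟨w, hE.inv _ _ hw⟩
  rets := hI.rets.mono hE le_rfl

theorem ListInv.casHist (hI : ListInv Spec L s) {k r : ℕ} {h₁ : RecHistory n M A B}
    (hr : L[k + 1]? = some r) (hh : (s.heap r).hist = none → HistOK L s k r h₁) :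
    Ext L s L (s.modify r (fun x => { x with hist := some (x.hist.getD h₁) })) ∧
      ListInv Spec L (s.modify r (fun x => { x with hist := some (x.hist.getD h₁) })) := by
  set s' := s.modify r (fun x => { x with hist := some (x.hist.getD h₁) }) with hs'
  have hinv : ∀ q, (s'.heap q).inv = (s.heap q).inv := by
    intro q; rw [heap_modify]; split_ifs with h <;> simp [h]
  have hdec : ∀ q, (s'.heap q).decideNext = (s.heap q).decideNext := by
    intro q; rw [heap_modify]; split_ifs with h <;> simp [h]
  have hlin : ∀ q, (s'.heap q).lin = (s.heap q).lin := by
    intro q; rw [heap_modify]; split_ifs with h <;> simp [h]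
  have hnext : ∀ q, (s'.heap q).next = (s.heap q).next := by
    intro q; rw [heap_modify]; split_ifs with h <;> simp [h]
  have hseq : ∀ q, (s'.heap q).seq = (s.heap q).seq := by
    intro q; rw [heap_modify]; split_ifs with h <;> simp [h]
  have hhist : ∀ q h, (s'.heap q).hist = some h → (s.heap q).hist = some h ∨
      (s.heap q).hist = none ∧ q = r ∧ h = h₁ := by
    intro q h hq
    rw [heap_modify] at hq
    split_ifs at hq with hqr
    · subst hqr
      rcases hx : (s.heap q).hist with _ | x <;> simp [hx] at hq <;> simp [hq]
    · exact .inl hq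
  have hE : Ext L s L s' := by
    refine ⟨List.prefix_rfl, fun q w h => by rw [hinv]; exact h, fun q h hq => ?_,
      fun q l h => by rw [hlin]; exact h, fun q q' h => by rw [hnext]; exact h,
      fun q _ => hseq q, List.prefix_rfl⟩
    rw [heap_modify]
    split_ifs with hqr
    · subst hqr; simp [hq]
    · exact hq
  refine ⟨hE, hI.modify (List.mem_of_getElem? hr) hinv hdec hE ?_ ?_ ?_ ?_ ?_⟩
  · intro j q hq h
    rw [hseq] at h ⊢; exact hI.seq_eq j q hq h
  · intro j q q' hq hq' h
    rw [hseq] at h; rw [hnext, hlin]; exact hI.linked j q q' hq hq' h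
  · intro j q q' hq h
    rw [hnext] at h; exact hI.next_eq j q q' hq h
  · intro j q h hq hh'
    rcases hhist q h hh' with h1 | ⟨h1, rfl, rfl⟩
    · exact hI.hist j q h hq h1
    · have := nodup_getElem?_unique hI.nodup hr hq
      obtain rfl : k = j := by omega
      exact hh h1
  · intro j q l hq h
    rw [hlin] at h; exact hI.lin j q l hq h

theorem ListInv.casLin (hI : ListInv Spec L s) {k r : ℕ} {h : RecHistory n M A B}
    {l : OpSeq n M A B} (hr : L[k + 1]? = some r) (hh : (s.heap r).hist = some h)
    (hl : LinOK Spec L s k r h l) :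
    Ext L s L (s.modify r (fun x => { x with lin := some (x.lin.getD l) })) ∧
      ListInv Spec L (s.modify r (fun x => { x with lin := some (x.lin.getD l) })) := by
  set s' := s.modify r (fun x => { x with lin := some (x.lin.getD l) }) with hs'
  have hinv : ∀ q, (s'.heap q).inv = (s.heap q).inv := by
    intro q; rw [heap_modify]; split_ifs with h <;> simp [h]
  have hdec : ∀ q, (s'.heap q).decideNext = (s.heap q).decideNext := by
    intro q; rw [heap_modify]; split_ifs with h <;> simp [h]
  have hhist : ∀ q, (s'.heap q).hist = (s.heap q).hist := by
    intro q; rw [heap_modify]; split_ifs with h <;> simp [h]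
  have hnext : ∀ q, (s'.heap q).next = (s.heap q).next := by
    intro q; rw [heap_modify]; split_ifs with h <;> simp [h]
  have hseq : ∀ q, (s'.heap q).seq = (s.heap q).seq := by
    intro q; rw [heap_modify]; split_ifs with h <;> simp [h]
  have hlin : ∀ q l', (s'.heap q).lin = some l' → (s.heap q).lin = some l' ∨
      q = r ∧ l' = l := by
    intro q l' hq
    rw [heap_modify] at hq
    split_ifs at hq with hqr
    · subst hqr
      rcases hx : (s.heap q).lin with _ | x <;> simp [hx] at hq <;> simp [hq]
    · exact .inl hq
  have hE : Ext L s L s' := by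
    refine ⟨List.prefix_rfl, fun q w h => by rw [hinv]; exact h,
      fun q h hq => by rw [hhist]; exact hq, fun q l' hq => ?_,
      fun q q' h => by rw [hnext]; exact h, fun q _ => hseq q, List.prefix_rfl⟩
    rw [heap_modify]
    split_ifs with hqr
    · subst hqr; simp [hq]
    · exact hq
  refine ⟨hE, hI.modify (List.mem_of_getElem? hr) hinv hdec hE ?_ ?_ ?_ ?_ ?_⟩
  · intro j q hq h
    rw [hseq] at h ⊢; exact hI.seq_eq j q hq h
  · intro j q q' hq hq' h
    rw [hseq] at h; rw [hnext]
    obtain ⟨h1, l', h2⟩ := hI.linked j q q' hq hq' h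
    exact ⟨h1, l', hE.lin _ _ h2⟩
  · intro j q q' hq h
    rw [hnext] at h; exact hI.next_eq j q q' hq h
  · intro j q h hq hh'
    rw [hhist] at hh'; exact hI.hist j q h hq hh'
  · intro j q l' hq h'
    rcases hlin q l' h' with h1 | ⟨rfl, rfl⟩
    · exact hI.lin j q l' hq h1
    · have := nodup_getElem?_unique hI.nodup hr hq
      obtain rfl : k = j := by omega
      exact ⟨h, hh, hl⟩

theorem ListInv.setNext (hI : ListInv Spec L s) {k r r' : ℕ} (hr : L[k]? = some r)
    (hr' : L[k + 1]? = some r') :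
    Ext L s L (s.modify r (fun x => { x with next := some r' })) ∧
      ListInv Spec L (s.modify r (fun x => { x with next := some r' })) := by
  set s' := s.modify r (fun x => { x with next := some r' }) with hs'
  have hinv : ∀ q, (s'.heap q).inv = (s.heap q).inv := by
    intro q; rw [heap_modify]; split_ifs with h <;> simp [h]
  have hdec : ∀ q, (s'.heap q).decideNext = (s.heap q).decideNext := by
    intro q; rw [heap_modify]; split_ifs with h <;> simp [h]
  have hhist : ∀ q, (s'.heap q).hist = (s.heap q).hist := by
    intro q; rw [heap_modify]; split_ifs with h <;> simp [h]
  have hlin : ∀ q, (s'.heap q).lin = (s.heap q).lin := by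
    intro q; rw [heap_modify]; split_ifs with h <;> simp [h]
  have hseq : ∀ q, (s'.heap q).seq = (s.heap q).seq := by
    intro q; rw [heap_modify]; split_ifs with h <;> simp [h]
  have hE : Ext L s L s' := by
    refine ⟨List.prefix_rfl, fun q w h => by rw [hinv]; exact h,
      fun q h hq => by rw [hhist]; exact hq, fun q l h => by rw [hlin]; exact h,
      fun q q' h => ?_, fun q _ => hseq q, List.prefix_rfl⟩
    rw [heap_modify]
    split_ifs with hqr
    · subst hqr
      have := hI.next_eq k q q' hr h
      rw [← this, hr']
    · exact h
  refine ⟨hE, hI.modify (List.mem_of_getElem? hr) hinv hdec hE ?_ ?_ ?_ ?_ ?_⟩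
  · intro j q hq h
    rw [hseq] at h ⊢; exact hI.seq_eq j q hq h
  · intro j q q' hq hq' h
    rw [hseq] at h; rw [hlin]
    obtain ⟨h1, h2⟩ := hI.linked j q q' hq hq' h
    exact ⟨hE.next _ _ h1, h2⟩
  · intro j q q' hq h
    rw [heap_modify] at h
    split_ifs at h with hqr
    · subst hqr
      obtain rfl := nodup_getElem?_unique hI.nodup hr hq
      simp at h
      rw [← h]; exact hr'
    · exact hI.next_eq j q q' hq h
  · intro j q h hq hh'
    rw [hhist] at hh'; exact hI.hist j q h hq hh'
  · intro j q l hq h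
    rw [hlin] at h; exact hI.lin j q l hq h

theorem ListInv.setSeq (hI : ListInv Spec L s) {k r r' : ℕ} (hr : L[k]? = some r)
    (hr' : L[k + 1]? = some r') (hnext : (s.heap r).next = some r')
    (hlin : ∃ l, (s.heap r').lin = some l) :
    Ext L s L (s.modify r' (fun x => { x with seq := (s.heap r).seq + 1 })) ∧
      ListInv Spec L (s.modify r' (fun x => { x with seq := (s.heap r).seq + 1 })) := by
  set s' := s.modify r' (fun x => { x with seq := (s.heap r).seq + 1 }) with hs'
  have hinv : ∀ q, (s'.heap q).inv = (s.heap q).inv := by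
    intro q; rw [heap_modify]; split_ifs with h <;> simp [h]
  have hdec : ∀ q, (s'.heap q).decideNext = (s.heap q).decideNext := by
    intro q; rw [heap_modify]; split_ifs with h <;> simp [h]
  have hhist : ∀ q, (s'.heap q).hist = (s.heap q).hist := by
    intro q; rw [heap_modify]; split_ifs with h <;> simp [h]
  have hlin' : ∀ q, (s'.heap q).lin = (s.heap q).lin := by
    intro q; rw [heap_modify]; split_ifs with h <;> simp [h]
  have hnext' : ∀ q, (s'.heap q).next = (s.heap q).next := by
    intro q; rw [heap_modify]; split_ifs with h <;> simp [h]
  have hval : (s.heap r).seq + 1 = k + 1 + 1 := by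
    rw [hI.seq_eq k r hr (hI.seq_pred k r r' hr hr')]
  have hE : Ext L s L s' := by
    refine ⟨List.prefix_rfl, fun q w h => by rw [hinv]; exact h,
      fun q h hq => by rw [hhist]; exact hq, fun q l h => by rw [hlin']; exact h,
      fun q q' h => by rw [hnext']; exact h, fun q h => ?_, List.prefix_rfl⟩
    rw [heap_modify]
    split_ifs with hqr
    · subst hqr
      simp only [hval]
      rw [hI.seq_eq (k + 1) q hr' h]
    · rfl
  refine ⟨hE, hI.modify (List.mem_of_getElem? hr') hinv hdec hE ?_ ?_ ?_ ?_ ?_⟩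
  · intro j q hq h
    rw [heap_modify] at h ⊢
    split_ifs at h ⊢ with hqr
    · subst hqr
      obtain rfl := nodup_getElem?_unique hI.nodup hr' hq
      exact hval
    · exact hI.seq_eq j q hq h
  · intro j q q' hq hq' h
    rw [hlin', hnext']
    rw [heap_modify] at h
    split_ifs at h with hqr
    · subst hqr
      have := nodup_getElem?_unique hI.nodup hr' hq'
      obtain rfl : k = j := by omega
      rw [hr] at hq
      cases hq
      exact ⟨hnext, hlin⟩
    · exact hI.linked j q q' hq hq' h
  · intro j q q' hq h
    rw [hnext'] at h; exact hI.next_eq j q q' hq h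
  · intro j q h hq hh'
    rw [hhist] at hh'; exact hI.hist j q h hq hh'
  · intro j q l hq h
    rw [hlin'] at h; exact hI.lin j q l hq h

/-! ### New nodes -/

theorem ListInv.announce (hI : ListInv Spec L s) (p : Fin n) {v : Invoc M A}
    (hv : Called s.recorder v) :
    Ext L s L { s with
      heap := Function.update s.heap s.fresh (Node.new (some v))
      fresh := s.fresh + 1
      announce := Function.update s.announce p s.fresh } ∧
    ListInv Spec L { s with
      heap := Function.update s.heap s.fresh (Node.new (some v))
      fresh := s.fresh + 1
      announce := Function.update s.announce p s.fresh } := by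
  set s' : Mem n M A B := { s with
      heap := Function.update s.heap s.fresh (Node.new (some v))
      fresh := s.fresh + 1
      announce := Function.update s.announce p s.fresh } with hs'
  obtain ⟨hfL, hfi⟩ := hI.unused s.fresh le_rfl
  have hout := hI.outside _ hfL
  rw [hfi] at hout
  have hself : s'.heap s.fresh = Node.new (some v) := by simp [hs']
  have hne : ∀ q, q ≠ s.fresh → s'.heap q = s.heap q := by
    intro q hq
    simp [hs', Function.update_of_ne hq]
  have hmem : ∀ {q : ℕ}, q ∈ L → s'.heap q = s.heap q := fun hq =>
    hne _ (by rintro rfl; exact hfL hq)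
  have hget : ∀ {k q : ℕ}, L[k]? = some q → s'.heap q = s.heap q := fun hq =>
    hmem (List.mem_of_getElem? hq)
  have hseqne : ∀ {q : ℕ}, (s.heap q).seq ≠ 0 → s'.heap q = s.heap q := by
    intro q hq
    refine hne _ ?_
    rintro rfl
    rw [hout] at hq
    exact hq rfl
  have hE : Ext L s L s' := by
    refine ⟨List.prefix_rfl, ?_, ?_, ?_, ?_, ?_, List.prefix_rfl⟩
    · intro r w h
      rw [hne]
      · exact h
      · rintro rfl; rw [hout] at h; simp [Node.new] at h
    · intro r w h
      rw [hne]
      · exact h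
      · rintro rfl; rw [hout] at h; simp [Node.new] at h
    · intro r w h
      rw [hne]
      · exact h
      · rintro rfl; rw [hout] at h; simp [Node.new] at h
    · intro r w h
      rw [hne]
      · exact h
      · rintro rfl; rw [hout] at h; simp [Node.new] at h
    · intro r h
      rw [hseqne h]
  refine ⟨hE, ?_⟩
  have h0 : s'.heap 0 = s.heap 0 := hget hI.zero
  exact {
    zero := hI.zero
    nodup := hI.nodup
    chain := fun k r hr => by rw [hget hr]; exact hI.chain k r hr
    unused := fun r hr => by
      have hr' : s.fresh + 1 ≤ r := hr
      rw [hne r (by omega)]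
      exact hI.unused r (by omega)
    outside := fun r hr => by
      by_cases hrf : r = s.fresh
      · subst hrf; rw [hself]; rfl
      · rw [hne r hrf]; exact hI.outside r hr
    tail := by rw [h0]; exact hI.tail
    invoc := fun k r hr => by rw [hget hr]; exact hI.invoc k r hr
    called := fun r w h => by
      by_cases hrf : r = s.fresh
      · subst hrf
        rw [hself] at h
        simp only [Node.new, Option.some.injEq] at h
        subst h
        exact hv
      · rw [hne r hrf] at h; exact hI.called r w h
    seq_eq := fun k r hr => by rw [hget hr]; exact hI.seq_eq k r hr
    seq_pred := fun k r r' hr hr' => by rw [hget hr]; exact hI.seq_pred k r r' hr hr'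
    linked := fun k r r' hr hr' => by
      rw [hget hr, hget hr']; exact hI.linked k r r' hr hr'
    next_eq := fun k r r' hr => by rw [hget hr]; exact hI.next_eq k r r' hr
    hist := fun k r h hr hh => by
      rw [hget hr] at hh; exact (hI.hist k r h hr hh).mono hE
    lin := fun k r l hr hl => by
      rw [hget hr] at hl ⊢
      obtain ⟨h, h1, h2⟩ := hI.lin k r l hr hl
      exact ⟨h, h1, h2.mono hE⟩
    head := fun q => hE.seq_ne (hI.head q)
    announced := fun q => by
      by_cases hq : q = p
      · subst hq
        right
        refine ⟨v, ?_⟩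
        have : s'.announce q = s.fresh := by simp [hs']
        rw [this, hself]; rfl
      · have : s'.announce q = s.announce q := by simp [hs', hq]
        rw [this]
        exact (hI.announced q).imp_right fun ⟨w, hw⟩ => ⟨w, hE.inv _ _ hw⟩
    rets := hI.rets.mono hE le_rfl }

/-- An undecided consensus object is that of the last node of the list. -/
theorem ListInv.length_of_undecided (hI : ListInv Spec L s) {k r : ℕ} (hr : L[k]? = some r)
    (hd : (s.heap r).decideNext = none) : k + 1 = L.length := by
  rw [hI.chain k r hr, List.getElem?_eq_none_iff] at hd
  obtain ⟨hk, -⟩ := List.getElem?_eq_some_iff.1 hr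
  omega

theorem ListInv.decide (hI : ListInv Spec L s) {k r x : ℕ} (hr : L[k]? = some r)
    (hd : (s.heap r).decideNext = none) (hseq : (s.heap r).seq ≠ 0) (hx : x ∉ L.take (k + 1))
    (hinv : ∃ w, (s.heap x).inv = some w) :
    Ext L s (L ++ [x]) (s.modify r (fun y => { y with decideNext := some x })) ∧
      ListInv Spec (L ++ [x]) (s.modify r (fun y => { y with decideNext := some x })) := by
  set s' := s.modify r (fun y => { y with decideNext := some x }) with hs'
  have hlen := hI.length_of_undecided hr hd
  rw [hlen, List.take_length] at hx
  have hrx : x ≠ r := by rintro rfl; exact hx (List.mem_of_getElem? hr)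
  have hout := hI.outside x hx
  have hinv' : ∀ q, (s'.heap q).inv = (s.heap q).inv := by
    intro q; rw [heap_modify]; split_ifs with h <;> simp [h]
  have hhist : ∀ q, (s'.heap q).hist = (s.heap q).hist := by
    intro q; rw [heap_modify]; split_ifs with h <;> simp [h]
  have hlin : ∀ q, (s'.heap q).lin = (s.heap q).lin := by
    intro q; rw [heap_modify]; split_ifs with h <;> simp [h]
  have hnext : ∀ q, (s'.heap q).next = (s.heap q).next := by
    intro q; rw [heap_modify]; split_ifs with h <;> simp [h]
  have hseq' : ∀ q, (s'.heap q).seq = (s.heap q).seq := by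
    intro q; rw [heap_modify]; split_ifs with h <;> simp [h]
  have hE : Ext L s (L ++ [x]) s' := by
    refine ⟨List.prefix_append .., fun q w h => by rw [hinv']; exact h,
      fun q h hq => by rw [hhist]; exact hq, fun q l h => by rw [hlin]; exact h,
      fun q q' h => by rw [hnext]; exact h, fun q _ => hseq' q, List.prefix_rfl⟩
  refine ⟨hE, ?_⟩
  exact {
    zero := getElem?_of_prefix hE.list hI.zero
    nodup := by
      rw [List.nodup_append]
      exact ⟨hI.nodup, by simp, by rintro a ha b hb rfl; simp at hb; exact hx (hb ▸ ha)⟩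
    chain := fun j q hq => by
      rw [heap_modify]
      rcases getElem?_append_singleton.1 hq with hq | ⟨rfl, rfl⟩
      · split_ifs with hqr
        · subst hqr
          obtain rfl := nodup_getElem?_unique hI.nodup hr hq
          simp [hlen]
        · obtain ⟨hj, -⟩ := List.getElem?_eq_some_iff.1 hq
          have hjk : j ≠ k := by
            rintro rfl
            rw [hr] at hq; cases hq; exact hqr rfl
          rw [hI.chain j q hq, List.getElem?_append_left (by omega)]
      · rw [if_neg hrx, hout, List.getElem?_eq_none (by simp)]
        rfl
    unused := fun q hq => by
      rw [hinv']
      have := hI.unused q hq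
      refine ⟨?_, this.2⟩
      simp only [List.mem_append, List.mem_singleton, not_or]
      refine ⟨this.1, ?_⟩
      rintro rfl
      obtain ⟨w, hw⟩ := hinv
      rw [this.2] at hw; cases hw
    outside := fun q hq => by
      simp only [List.mem_append, List.mem_singleton, not_or] at hq
      rw [heap_modify, if_neg (by rintro rfl; exact hq.1 (List.mem_of_getElem? hr))]
      exact hI.outside q hq.1
    tail := by rw [hinv', hseq']; exact hI.tail
    invoc := fun j q hq => by
      rw [hinv']
      rcases getElem?_append_singleton.1 hq with hq | ⟨-, rfl⟩
      · exact hI.invoc j q hq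
      · exact hinv
    called := fun q w h => by rw [hinv'] at h; exact hI.called q w h
    seq_eq := fun j q hq h => by
      rw [hseq'] at h ⊢
      rcases getElem?_append_singleton.1 hq with hq | ⟨-, rfl⟩
      · exact hI.seq_eq j q hq h
      · rw [hout] at h; exact absurd rfl h
    seq_pred := fun j q q' hq hq' => by
      rw [hseq']
      rcases getElem?_append_singleton.1 hq' with h' | ⟨hj, rfl⟩
      · rcases getElem?_append_singleton.1 hq with hq | ⟨rfl, rfl⟩
        · exact hI.seq_pred j q q' hq h'
        · obtain ⟨hj, -⟩ := List.getElem?_eq_some_iff.1 h'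
          omega
      · obtain rfl : j = k := by omega
        have := getElem?_of_prefix hE.list hr
        rw [this] at hq
        cases hq
        exact hseq
    linked := fun j q q' hq hq' h => by
      rw [hseq'] at h
      rw [hnext, hlin]
      rcases getElem?_append_singleton.1 hq' with h' | ⟨hj, rfl⟩
      · rcases getElem?_append_singleton.1 hq with hq | ⟨rfl, rfl⟩
        · exact hI.linked j q q' hq h' h
        · obtain ⟨hj, -⟩ := List.getElem?_eq_some_iff.1 h'
          omega
      · rw [hout] at h; exact absurd rfl h
    next_eq := fun j q q' hq h => by
      rw [hnext] at h
      rcases getElem?_append_singleton.1 hq with hq | ⟨-, rfl⟩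
      · exact getElem?_of_prefix hE.list (hI.next_eq j q q' hq h)
      · rw [hout] at h; simp [Node.new] at h
    hist := fun j q h hq hh => by
      rw [hhist] at hh
      rcases getElem?_append_singleton.1 hq with hq | ⟨-, rfl⟩
      · exact (hI.hist j q h hq hh).mono hE
      · rw [hout] at hh; simp [Node.new] at hh
    lin := fun j q l hq hl => by
      rw [hlin] at hl
      rw [hhist]
      rcases getElem?_append_singleton.1 hq with hq | ⟨-, rfl⟩
      · obtain ⟨h, h1, h2⟩ := hI.lin j q l hq hl
        exact ⟨h, h1, h2.mono hE⟩
      · rw [hout] at hl; simp [Node.new] at hl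
    head := fun p => hE.seq_ne (hI.head p)
    announced := fun p => (hI.announced p).imp_right fun ⟨w, hw⟩ => ⟨w, hE.inv _ _ hw⟩
    rets := hI.rets.mono hE (by simp) }

/-! ### Preservation of the invariant -/

open Classical in
/-- The list after a step of a process at `pc`: the first call of `decide` adds a node. -/
noncomputable def grow (s : Mem n M A B) (pc : PC n M A B) (L : List ℕ) : List ℕ :=
  match pc with
  | .decide _ before prefer =>
      if (s.heap before).decideNext = none then L ++ [prefer] else L
  | _ => L

theorem ListInv.histOK_recorder (hI : ListInv Spec L s) {k r r' : ℕ} (hr : L[k]? = some r)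
    (hr' : L[k + 1]? = some r') (hh : (s.heap r').hist = none) :
    HistOK L s k r' s.recorder := by
  have hlin : (s.heap r').lin = none := by
    rcases hl : (s.heap r').lin with _ | l
    · rfl
    · obtain ⟨h, h1, -⟩ := hI.lin k r' l hr' hl
      rw [hh] at h1; cases h1
  -- A node without history is the last one, and its operation has no result yet.
  have hlast : L[k + 2]? = none := by
    rcases hx : L[k + 2]? with _ | x
    · rfl
    · obtain ⟨-, l, -, -, hl, -⟩ := hI.exists_lin hr' (hI.seq_pred (k + 1) r' x hr' hx)
      rw [hlin] at hl; cases hl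
  rw [List.getElem?_eq_none_iff] at hlast
  obtain ⟨w, hw⟩ := hI.invoc k r' hr'
  refine ⟨List.prefix_rfl, ⟨w, hw, hI.called r' w hw⟩, ?_, ?_⟩
  · intro p o m b hm
    obtain ⟨j, w', l, hj, ⟨q, hq, hq1, hq2⟩, hres⟩ := hI.rets p o m b hm
    have hjk : j ≠ k + 1 := by
      rintro rfl
      rw [hr'] at hq
      cases hq
      rw [hlin] at hq2; cases hq2
    exact ⟨j, w', l, by omega, ⟨q, hq, hq1, hq2⟩, hres⟩
  · rcases k with _ | k
    · exact .inl rfl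
    · obtain ⟨-, -, h, -, -, h2, -, h3⟩ := hI.exists_lin hr (hI.seq_pred _ r r' hr hr')
      exact .inr ⟨r, h, hr, h2, h3.pre⟩

/-- What a walk reads at the node at position `i`. -/
theorem ListInv.scanOK_append (hI : ListInv Spec L s) {i r : ℕ} (hr : L[i]? = some r)
    {cs cs' : List (ℕ × OpSeq n M A B)} (hcs : ScanOK L s i cs) (h : ReadLin (s.heap r) cs') :
    ScanOK L s (i + 1) (cs ++ cs') := by
  cases h with
  | sentinel h =>
    have hi : i = 0 := by
      rcases i with _ | i
      · rfl
      · obtain ⟨w, hw⟩ := hI.invoc i r hr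
        rw [h] at hw; cases hw
    subst hi
    refine ⟨fun j h0 hj => by omega, fun c hc => ?_⟩
    rw [List.append_nil] at hc
    obtain ⟨j, w, l, h0, hj, -⟩ := hcs.2 c hc
    omega
  | node w l hw hl =>
    have hi : 0 < i := by
      rcases i with _ | i
      · rw [hI.zero] at hr
        cases hr
        rw [hI.tail.1] at hw; cases hw
      · omega
    refine ⟨fun j h0 hj => ?_, fun c hc => ?_⟩
    · rcases (Nat.lt_succ_iff.1 hj).lt_or_eq with hj | rfl
      · obtain ⟨w', l', h1, h2⟩ := hcs.1 j h0 hj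
        exact ⟨w', l', h1, List.mem_append_left _ h2⟩
      · exact ⟨w, l, ⟨r, hr, hw, hl⟩, by simp⟩
    · rcases List.mem_append.1 hc with hc | hc
      · obtain ⟨j, w', l', h0, hj, h1⟩ := hcs.2 c hc
        exact ⟨j, w', l', h0, by omega, h1⟩
      · exact ⟨i, w, l, hi, by omega, ⟨r, hr, hw, hl⟩, List.mem_singleton.1 hc⟩

theorem ListInv.step (hI : ListInv Spec L s) {p : Fin n} {pc pc' : PC n M A B}
    (hp : PCInv Spec p L s pc) (hs : ApplyStep Spec p s pc s' pc') :
    ListInv Spec (grow s pc L) s' ∧ Ext L s (grow s pc L) s' ∧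
      PCInv Spec p (grow s pc L) s' pc' ∧
      ∀ q, q ≠ p → s'.announce q = s.announce q ∧ s'.head q = s.head q := by
  have hsame : ∀ q : Fin n, q ≠ p → s.announce q = s.announce q ∧ s.head q = s.head q :=
    fun q _ => ⟨rfl, rfl⟩
  have hrefl : Ext L s L s := .of_heap_eq rfl List.prefix_rfl
  have hhd : ∀ r, ∀ q : Fin n, q ≠ p → s.announce q = s.announce q ∧
      Function.update s.head p r q = s.head q := fun r q hq =>
    ⟨rfl, Function.update_of_ne hq ..⟩
  cases hs with
  | genID m a oid _ =>
    exact ⟨hI.of_heap_eq rfl rfl rfl hI.head List.prefix_rfl hI.rets,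
      .of_heap_eq rfl List.prefix_rfl, trivial, hsame⟩
  | storeCall v =>
    refine ⟨hI.of_heap_eq rfl rfl rfl hI.head (List.prefix_append ..) ?_,
      .of_heap_eq rfl (List.prefix_append ..), ⟨p, by simp⟩, hsame⟩
    intro q o m b hm
    refine hI.rets q o m b ?_
    simpa using hm
  | announce v =>
    obtain ⟨hE, hI'⟩ := hI.announce p hp
    refine ⟨hI', hE, ⟨by simp [Node.new], Nat.zero_le _, hE.seq_ne ?_⟩, fun q hq =>
      ⟨Function.update_of_ne hq .., rfl⟩⟩
    rw [hI.tail.2]; simp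
  | maxRead v i best hi =>
    refine ⟨hI, hrefl, ⟨hp.1, hi, ?_⟩, hsame⟩
    split_ifs
    · exact hI.head _
    · exact hp.2.2
  | maxDone v best =>
    exact ⟨hI.setHead p hp.2.2, .of_heap_eq rfl List.prefix_rfl, hp.1, hhd _⟩
  | loopEnter v h0 =>
    obtain ⟨k, hk⟩ := hI.exists_pos (hI.head p)
    exact ⟨hI, hrefl, ⟨hp, k, hk, hI.notMem_take hk (hI.head p) h0⟩, hsame⟩
  | loopExit v h0 => exact ⟨hI, hrefl, ⟨hp, h0⟩, hsame⟩
  | setBefore v =>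
    obtain ⟨h0, k, h1, h2⟩ := hp
    exact ⟨hI, hrefl, ⟨h0, k, h1, hI.head p, h2⟩, hsame⟩
  | setHelp v before => exact ⟨hI, hrefl, ⟨hp.1, hI.announced _, hp.2⟩, hsame⟩
  | setPrefer v before help =>
    obtain ⟨h0, hh, k, h1, h2, h3⟩ := hp
    refine ⟨hI, hrefl, ⟨h0, ?_⟩, hsame⟩
    split_ifs with hz
    · refine ⟨hh.resolve_left ?_, k, h1, h2, hI.notMem_take h1 h2 hz⟩
      rintro rfl
      rw [hI.tail.2] at hz; cases hz
    · exact ⟨⟨v, h0⟩, k, h1, h2, h3⟩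
  | decideFirst v before prefer hd =>
    obtain ⟨h0, hw, k, h1, h2, h3⟩ := hp
    obtain ⟨hE, hI'⟩ := hI.decide h1 hd h2 h3 hw
    have hg : grow s (.decide v before prefer) L = L ++ [prefer] := by simp [grow, hd]
    rw [hg]
    refine ⟨hI', hE, ⟨hE.inv _ _ h0, k, getElem?_of_prefix hE.list h1, ?_⟩, hsame⟩
    rw [hI.length_of_undecided h1 hd]; simp
  | decideLater v before prefer after hd =>
    obtain ⟨h0, hw, k, h1, h2, h3⟩ := hp
    have hg : grow s (.decide v before prefer) L = L := by simp [grow, hd]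
    rw [hg]
    exact ⟨hI, hrefl, ⟨h0, k, h1, by rw [← hI.chain k before h1, hd]⟩, hsame⟩
  | readHis v before after =>
    obtain ⟨h0, k, h1, h2⟩ := hp
    exact ⟨hI, hrefl, ⟨h0, k, h1, h2, hI.histOK_recorder h1 h2⟩, hsame⟩
  | casHist v before after h₁ =>
    obtain ⟨h0, k, h1, h2, h3⟩ := hp
    obtain ⟨hE, hI'⟩ := hI.casHist h2 h3
    exact ⟨hI', hE, ⟨hE.inv _ _ h0, k, h1, h2, _, by rw [heap_modify, if_pos rfl]⟩, hsame⟩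
  | genLin v before after h hh =>
    obtain ⟨h0, k, h1, h2, -⟩ := hp
    exact ⟨hI, hrefl, ⟨h0, k, h1, h2, hh, 0, Nat.zero_le _, hI.zero, fun j _ hj => by omega,
      by simp⟩, hsame⟩
  | genLinNext v before after h cur nxt cs cs' hne hread hnext =>
    obtain ⟨h0, k, h1, h2, h3, i, hi, h4, h5⟩ := hp
    refine ⟨hI, hrefl, ⟨h0, k, h1, h2, h3, i + 1, ?_, hI.next_eq i cur nxt h4 hnext,
      hI.scanOK_append h4 h5 hread⟩, hsame⟩
    refine Nat.lt_of_le_of_ne hi ?_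
    rintro rfl
    rw [h1] at h4
    cases h4
    exact hne rfl
  | genLinLast v before after h cs cs' hread =>
    obtain ⟨h0, k, h1, h2, h3, i, hi, h4, h5⟩ := hp
    obtain rfl := nodup_getElem?_unique hI.nodup h1 h4
    exact ⟨hI, hrefl, ⟨h0, k, h1, h2, h3, hI.scanOK_append h4 h5 hread⟩, hsame⟩
  | genLinChoose v w before after h cs l hw hres =>
    obtain ⟨h0, k, h1, h2, h3, h4⟩ := hp
    refine ⟨hI, hrefl, ⟨h0, k, h1, h2, h, h3, hres.1, ⟨w, hw, hres.2.1⟩, fun j hj0 hj => ?_⟩,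
      hsame⟩
    obtain ⟨w', l', h5, h6⟩ := h4.1 j hj0 (by omega)
    exact ⟨w', l', h5, hres.2.2 _ h6⟩
  | casLin v before after l =>
    obtain ⟨h0, k, h1, h2, h, h3, h4⟩ := hp
    obtain ⟨hE, hI'⟩ := hI.casLin h2 h3 h4
    exact ⟨hI', hE, ⟨hE.inv _ _ h0, k, h1, h2, _, by rw [heap_modify, if_pos rfl]⟩, hsame⟩
  | setNext v before after =>
    obtain ⟨h0, k, h1, h2, l, h3⟩ := hp
    obtain ⟨hE, hI'⟩ := hI.setNext h1 h2
    exact ⟨hI', hE, ⟨hE.inv _ _ h0, k, h1, h2, ⟨l, hE.lin _ _ h3⟩,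
      by rw [heap_modify, if_pos rfl]⟩, hsame⟩
  | setSeq v before after =>
    obtain ⟨h0, k, h1, h2, h3, h4⟩ := hp
    obtain ⟨hE, hI'⟩ := hI.setSeq h1 h2 h4 h3
    exact ⟨hI', hE, ⟨hE.inv _ _ h0, by rw [heap_modify, if_pos rfl]; simp⟩, hsame⟩
  | setHead v after =>
    exact ⟨hI.setHead p hp.2, .of_heap_eq rfl List.prefix_rfl, hp.1, hhd _⟩
  | finalHead v =>
    obtain ⟨k, hk⟩ := hI.exists_pos hp.2
    exact ⟨hI.setHead p hp.2, .of_heap_eq rfl List.prefix_rfl,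
      ⟨hp.1, hp.2, 0, k, Nat.zero_le _, hI.zero, hk⟩, hhd _⟩
  | getRetNext v cur nxt hne hnext =>
    obtain ⟨h0, h1, i, k, hi, h2, h3⟩ := hp
    refine ⟨hI, hrefl, ⟨h0, h1, i + 1, k, ?_, hI.next_eq i cur nxt h2 hnext, h3⟩, hsame⟩
    refine Nat.lt_of_le_of_ne hi ?_
    rintro rfl
    rw [h2] at h3
    cases h3
    exact hne v h0 rfl
  | getRetFound v w cur l x hw hv hl hx hxv =>
    obtain ⟨h0, h1, i, k, hi, h2, h3⟩ := hp
    obtain ⟨hlt, -⟩ := List.getElem?_eq_some_iff.1 h2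
    exact ⟨hI, hrefl, ⟨i, w, l, hlt, ⟨cur, h2, hw, hl⟩, hv, x, hx, hxv, rfl⟩, hsame⟩
  | storeReturn v b =>
    refine ⟨hI.of_heap_eq rfl rfl rfl hI.head (List.prefix_append ..) ?_,
      .of_heap_eq rfl (List.prefix_append ..), trivial, hsame⟩
    intro q o m b' hm
    simp only [List.mem_append, List.mem_singleton, Action.ret.injEq] at hm
    rcases hm with hm | ⟨-, rfl, -, rfl⟩
    · exact hI.rets q _ m _ hm
    · exact hp

theorem ListInv.init : ListInv Spec [0] (Mem.init n M A B) := by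
  have h0 : (Mem.init n M A B).heap 0 = { (Node.new none) with seq := 1 } := by
    simp [Mem.init]
  have hne : ∀ r, r ≠ 0 → (Mem.init n M A B).heap r = Node.new none := by
    intro r hr
    simp [Mem.init, hr]
  have hget : ∀ {k r : ℕ}, [0][k]? = some r → k = 0 ∧ r = 0 := by
    intro k r h
    rcases k with _ | k
    · simpa using h.symm
    · simp at h
  have hsucc : ∀ {k r : ℕ}, [0][k + 1]? = some r → False := by
    intro k r h
    simp at h
  exact {
    zero := rfl
    nodup := by simp
    chain := fun k r h => by
      obtain ⟨rfl, rfl⟩ := hget h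
      rw [h0]; rfl
    unused := fun r hr => by
      have hr' : 1 ≤ r := hr
      rw [hne r (by omega)]
      exact ⟨by simp; omega, rfl⟩
    outside := fun r hr => by rw [hne r (by simpa using hr)]; rfl
    tail := by rw [h0]; exact ⟨rfl, rfl⟩
    invoc := fun k r h => (hsucc h).elim
    called := fun r w h => by
      by_cases hr : r = 0
      · rw [hr, h0] at h; simp [Node.new] at h
      · rw [hne r hr] at h; simp [Node.new] at h
    seq_eq := fun k r h _ => by
      obtain ⟨rfl, rfl⟩ := hget h
      rw [h0]
    seq_pred := fun k r r' _ h => (hsucc h).elim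
    linked := fun k r r' _ h => (hsucc h).elim
    next_eq := fun k r r' h h' => by
      obtain ⟨rfl, rfl⟩ := hget h
      rw [h0] at h'; simp [Node.new] at h'
    hist := fun k r _ h => (hsucc h).elim
    lin := fun k r _ h => (hsucc h).elim
    head := fun p => by
      have : (Mem.init n M A B).head p = 0 := rfl
      rw [this, h0]; simp
    announced := fun p => .inl rfl
    rets := fun p o m b h => by simp [Mem.init] at h }

end linkedlist

section configurations

variable {n : ℕ} {M A B : Type*}

/-! ### Reachable configurations -/

/-- The invariant of a configuration with list `L` that is reached with history `H`. -/
structure ConfigInv (Spec : Set (List (Operation M A B))) (L : List ℕ)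
    (H : List (Action n Unit M A B)) (c : UConfig n M A B) : Prop where
  record : RecInv H c
  list : ListInv Spec L c.shared
  pcs : ∀ p m pc, c.loc p = some (m, pc) → PCInv Spec p L c.shared pc

/-- The list after a transition. -/
noncomputable def growConfig (c : UConfig n M A B) (L : List ℕ) : Label n M A B → List ℕ
  | .act _ => L
  | .internal p => match c.loc p with
    | none => L
    | some (_, pc) => grow c.shared pc L

variable {Spec : Set (List (Operation M A B))} {L : List ℕ} {H : List (Action n Unit M A B)}
  {c c' : UConfig n M A B} {x : Label n M A B}

theorem ConfigInv.init : ConfigInv Spec [0] [] (universalObject n Spec).semantics.init where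
  record := .init
  list := .init
  pcs p m pc h := by cases h

theorem ConfigInv.trans (hI : ConfigInv Spec L H c)
    (hx : (universalObject n Spec).semantics.trans c x c') :
    ConfigInv Spec (growConfig c L x) (H ++ history [x]) c' ∧
      Ext L c.shared (growConfig c L x) c'.shared := by
  cases hx with
  | call p m a hp =>
    refine ⟨⟨hI.record.call m a hp, hI.list, fun q m' pc hq => ?_⟩,
      .of_heap_eq rfl List.prefix_rfl⟩
    by_cases hqp : q = p
    · subst hqp
      simp only [Function.update_self, Option.some.injEq, Prod.mk.injEq] at hq
      obtain ⟨-, rfl⟩ := hq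
      trivial
    · simp only [Function.update_of_ne hqp] at hq
      exact hI.pcs q m' pc hq
  | ret p m l b hp hr =>
    obtain rfl : l = .done b := hr
    refine ⟨⟨hI.record.ret hp, hI.list, fun q m' pc hq => ?_⟩,
      .of_heap_eq rfl List.prefix_rfl⟩
    by_cases hqp : q = p
    · subst hqp
      simp at hq
    · simp only [Function.update_of_ne hqp] at hq
      exact hI.pcs q m' pc hq
  | step p m l l' s' hp hs =>
    obtain ⟨h1, h2, h3, h4⟩ := hI.list.step (hI.pcs p m l hp) hs
    have hg : growConfig c L (.internal p) = grow c.shared l L := by simp [growConfig, hp]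
    rw [hg]
    refine ⟨⟨?_, h1, fun q m' pc hq => ?_⟩, h2⟩
    · have : H ++ history [.internal p] = H := by simp [history]
      rw [this]
      exact hI.record.step hp hs
    · by_cases hqp : q = p
      · subst hqp
        simp only [Function.update_self, Option.some.injEq, Prod.mk.injEq] at hq
        obtain ⟨-, rfl⟩ := hq
        exact h3
      · simp only [Function.update_of_ne hqp] at hq
        exact (hI.pcs q m' pc hq).mono h2 (h4 q hqp).1 (h4 q hqp).2

theorem ConfigInv.run {e : List (Label n M A B)}
    (hr : (universalObject n Spec).semantics.Run c e c') {L : List ℕ}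
    {H : List (Action n Unit M A B)} (hI : ConfigInv Spec L H c) :
    ∃ L', ConfigInv Spec L' (H ++ history e) c' := by
  induction hr generalizing L H with
  | nil c => exact ⟨L, by simpa [history] using hI⟩
  | @cons c₀ c₁ c₂ y t hy _ ih =>
    obtain ⟨L', h⟩ := ih (hI.trans hy).1
    refine ⟨L', ?_⟩
    have : history (y :: t) = history [y] ++ history t := by
      simp [history, ← List.filterMap_append]
    rwa [this, ← List.append_assoc]

/-! ### Linearizations of prefixes of the recorded history -/

theorem callIds_nodup_of_prefix {I : Type*} {h h' : List (Action n I M A B)} (hp : h <+: h')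
    (hn : (callIds h').Nodup) : (callIds h).Nodup :=
  (hp.sublist.filterMap _).nodup hn

theorem isLinearization_nil {I : Type*} (h : [] ∈ Spec) :
    IsLinearization Spec ([] : List (Action n I M A B)) [] :=
  isLinearization_iff.2 ⟨h, fun _ => .inl rfl, fun _ _ _ _ hb _ => hb⟩

variable {s : Mem n M A B}

theorem ListInv.linked_pos (hI : ListInv Spec L s) {j : ℕ} {w : Invoc M A} {l : OpSeq n M A B}
    (h : Linked L s j w l) : 0 < j := by
  obtain ⟨r, h1, h2, -⟩ := h
  rcases j with _ | j
  · rw [hI.zero] at h1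
    cases h1
    rw [hI.tail.1] at h2; cases h2
  · omega

theorem Linked.unique {j : ℕ} {w w' : Invoc M A} {l l' : OpSeq n M A B}
    (h : Linked L s j w l) (h' : Linked L s j w' l') : w = w' ∧ l = l' := by
  obtain ⟨r, h1, h2, h3⟩ := h
  obtain ⟨r', h1', h2', h3'⟩ := h'
  rw [h1] at h1'
  cases h1'
  rw [h2] at h2'
  rw [h3] at h3'
  cases h2'
  cases h3'
  exact ⟨rfl, rfl⟩

theorem ListInv.linked_linOK (hI : ListInv Spec L s) {j : ℕ} {w : Invoc M A}
    {l : OpSeq n M A B} (h : Linked L s (j + 1) w l) :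
    ∃ r h, L[j + 1]? = some r ∧ (s.heap r).inv = some w ∧ (s.heap r).hist = some h ∧
      HistOK L s j r h ∧ LinOK Spec L s j r h l := by
  obtain ⟨r, h1, h2, h3⟩ := h
  obtain ⟨h, h4, h5⟩ := hI.lin j r l h1 h3
  exact ⟨r, h, h1, h2, h4, hI.hist j r h h1 h4, h5⟩

/-- The linearization `l` in the node at position `k` (the empty sequence for the sentinel) is
one of each longer history `h` whose returns are those of operations of the nodes up to
position `k`: these operations occur in `l` with the value that they returned. -/
theorem ListInv.exists_isLinearization (hI : ListInv Spec L s) (hnil : [] ∈ Spec)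
    (hid : (callIds s.recorder).Nodup) (hhist : IsHistory s.recorder) {k : ℕ}
    {h : RecHistory n M A B} (hpre : h <+: s.recorder) (hrets : RetsBefore L s (k + 1) h)
    (hk : k = 0 ∨ ∃ r w h₀ l, L[k]? = some r ∧ (s.heap r).inv = some w ∧
      (s.heap r).hist = some h₀ ∧ (s.heap r).lin = some l ∧ h₀ <+: h) :
    ∃ l, IsLinearization Spec h l ∧
      ∀ j w l', j ≤ k → Linked L s j w l' → Agree l w.oid l' := by
  have hh := hhist.of_prefix hpre
  have hn := callIds_nodup_of_prefix hpre hid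
  rcases k with _ | k
  · refine ⟨[], (isLinearization_nil hnil).of_prefix List.nil_prefix hh hn ?_, ?_⟩
    · intro p o m b hm
      obtain ⟨j, w, l, hj, hl, -⟩ := hrets p o m b hm
      have := hI.linked_pos hl
      omega
    · intro j w l hj hl
      have := hI.linked_pos hl
      omega
  · obtain ⟨r, w, h₀, l, h1, h2, h3, h4, h5⟩ := hk.resolve_left (by omega)
    obtain ⟨h₀', h6, h7⟩ := hI.lin k r l h1 h4
    rw [h3] at h6
    cases h6
    have hagree : ∀ j w' l', j ≤ k + 1 → Linked L s j w' l' → Agree l w'.oid l' := by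
      intro j w' l' hj hl
      rcases hj.lt_or_eq with hj | rfl
      · obtain ⟨w'', l'', h8, h9⟩ := h7.agree j (hI.linked_pos hl) (by omega)
        obtain ⟨rfl, rfl⟩ := hl.unique h8
        exact h9
      · obtain ⟨rfl, rfl⟩ := hl.unique ⟨r, h1, h2, h4⟩
        obtain ⟨w'', hw, x, hx, hxt⟩ := h7.own
        rw [h2] at hw
        cases hw
        exact ⟨x, hx, hxt, x, hx, hxt, rfl⟩
    refine ⟨l, h7.isLin.of_prefix h5 hh hn ?_, hagree⟩
    intro p o m b hm
    obtain ⟨j, w', l', hj, hl, rfl, x, hx, hxt, rfl⟩ := hrets p o m b hm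
    obtain ⟨y, hy, hyt, z, hz, hzt, hres⟩ := hagree j w' l' (by omega) hl
    obtain ⟨j, rfl⟩ := Nat.exists_eq_succ_of_ne_zero (hI.linked_pos hl).ne'
    obtain ⟨_, h', -, -, -, h8, h9⟩ := hI.linked_linOK hl
    obtain rfl := h9.isLin.eq_of_tag_eq (callIds_nodup_of_prefix h8.pre hid) hx hz
      (hxt.trans hzt.symm)
    exact ⟨y, hy, hyt, hres⟩

/-- The recorded history is linearizable: the last `lin`-field that is set is a linearization. -/
theorem ListInv.recorder_linearizable (hI : ListInv Spec L s) (hnil : [] ∈ Spec)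
    (hid : (callIds s.recorder).Nodup) (hhist : IsHistory s.recorder) :
    ∃ l, IsLinearization Spec s.recorder l := by
  obtain ⟨hlen, -⟩ := List.getElem?_eq_some_iff.1 hI.zero
  obtain ⟨k, hk⟩ : ∃ k, L.length = k + 1 := ⟨L.length - 1, by omega⟩
  have complete : ∀ i r l, L[i + 1]? = some r → (s.heap r).lin = some l →
      ∃ r w h₀ l, L[i + 1]? = some r ∧ (s.heap r).inv = some w ∧
        (s.heap r).hist = some h₀ ∧ (s.heap r).lin = some l ∧ h₀ <+: s.recorder := by
    intro i r l hr hl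
    obtain ⟨w, hw⟩ := hI.invoc i r hr
    obtain ⟨h, hh, -⟩ := hI.lin i r l hr hl
    exact ⟨r, w, h, l, hr, hw, hh, hl, (hI.hist i r h hr hh).pre⟩
  have hrets := hI.rets
  rw [hk] at hrets
  rcases k with _ | k
  · obtain ⟨l, hl, -⟩ := hI.exists_isLinearization hnil hid hhist List.prefix_rfl hrets (.inl rfl)
    exact ⟨l, hl⟩
  · have hr : L[k + 1]? = some (L[k + 1]'(by omega)) := List.getElem?_eq_getElem _
    generalize L[k + 1]'(by omega) = r at hr
    rcases hl : (s.heap r).lin with _ | l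
    · -- The last node is incomplete, so the linearization of its predecessor is used.
      have hr₀ : L[k]? = some (L[k]'(by omega)) := List.getElem?_eq_getElem _
      generalize L[k]'(by omega) = r₀ at hr₀
      obtain ⟨l, hl, -⟩ := hI.exists_isLinearization (k := k) hnil hid hhist List.prefix_rfl
        (fun p o m b hm => by
          obtain ⟨j, w, l, hj, ⟨q, hq, hq1, hq2⟩, hres⟩ := hrets p o m b hm
          have : j ≠ k + 1 := by
            rintro rfl
            rw [hr] at hq
            cases hq
            rw [hl] at hq2; cases hq2
          exact ⟨j, w, l, by omega, ⟨q, hq, hq1, hq2⟩, hres⟩) (by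
          rcases k with _ | k
          · exact .inl rfl
          · obtain ⟨w, l, h, -, h1, -⟩ := hI.exists_lin hr₀ (hI.seq_pred _ r₀ r hr₀ hr)
            exact .inr (complete k r₀ l hr₀ h1))
      exact ⟨l, hl⟩
    · obtain ⟨l, hl, -⟩ := hI.exists_isLinearization hnil hid hhist List.prefix_rfl hrets
        (.inr (complete k r l hr hl))
      exact ⟨l, hl⟩

theorem universalObject_linearizable (hnil : [] ∈ Spec) :
    (universalObject n Spec).Linearizable Spec := by
  rintro e ⟨c, hr⟩
  obtain ⟨L, hI⟩ := ConfigInv.run hr .init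
  obtain ⟨l, hl⟩ := hI.list.recorder_linearizable hnil hI.record.nodup hI.record.isHistory
  exact ⟨_, hI.record.isLinearization hl⟩

end configurations

section progress

variable {n : ℕ} {M A B Q : Type*}

/-! ### No process is ever stuck -/

theorem LTS.Run.append {Q L : Type*} {S : LTS Q L} {q q₁ q₂ : Q} {t t' : List L}
    (h : S.Run q t q₁) (h' : S.Run q₁ t' q₂) : S.Run q (t ++ t') q₂ := by
  induction h with
  | nil => exact h'
  | cons hx _ ih => exact .cons hx (ih h')

theorem LTS.NonBlocking.exists_append {S : LTS Q (Operation M A B)} (hnb : S.NonBlocking)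
    {t : List (Operation M A B)} (ht : t ∈ S.traces) (m : M) (a : A) :
    ∃ b, t ++ [⟨m, a, b⟩] ∈ S.traces := by
  obtain ⟨q, hq⟩ := ht
  obtain ⟨b, q', hb⟩ := hnb q m a
  exact ⟨b, q', hq.append (.cons hb (.nil _))⟩

variable {S : LTS Q (Operation M A B)} {L : List ℕ} {s : Mem n M A B}

/-- `genLin` has a possible result: the linearization in the node `before` can be kept, and the
operation of `after` linearized last if it does not occur in it. -/
theorem ListInv.exists_genLinResult (hI : ListInv S.traces L s) (hnb : S.NonBlocking)
    (hid : (callIds s.recorder).Nodup) (hhist : IsHistory s.recorder) {k r r' : ℕ}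
    (hr : L[k]? = some r) (hr' : L[k + 1]? = some r') {h : RecHistory n M A B}
    (hh : (s.heap r').hist = some h) {w : Invoc M A} (hw : (s.heap r').inv = some w)
    {cs : List (ℕ × OpSeq n M A B)} (hcs : ScanOK L s (k + 1) cs) :
    ∃ l, GenLinResult S.traces h w.oid cs l := by
  have hok := hI.hist k r' h hr' hh
  obtain ⟨l, hl, hagree⟩ := hI.exists_isLinearization ⟨S.init, .nil _⟩ hid hhist hok.pre hok.rets
    (by
      rcases k with _ | k
      · exact .inl rfl
      · obtain ⟨w, l, h₀, h1, h2, h3, -⟩ := hI.exists_lin hr (hI.seq_pred _ r r' hr hr')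
        obtain ⟨r₁, h₁, h4, h5, h6⟩ := hok.prev.resolve_left (by omega)
        rw [hr] at h4
        cases h4
        rw [h3] at h5
        cases h5
        exact .inr ⟨r, w, h₀, l, hr, h1, h3, h2, h6⟩)
  have hcs' : ∀ c ∈ cs, Agree l c.1 c.2 := by
    intro c hc
    obtain ⟨j, w', l', -, hj, h1, rfl⟩ := hcs.2 c hc
    exact hagree j w' l' (by omega) h1
  by_cases hmem : ∃ x ∈ l, x.tag = w.oid
  · exact ⟨l, hl, hmem, hcs'⟩
  · obtain ⟨b, hb⟩ := hnb.exists_append (isLinearization_iff.1 hl).1 w.meth w.arg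
    obtain ⟨w', hw', p, hp⟩ := hok.called
    rw [hw] at hw'
    cases hw'
    refine ⟨l ++ [⟨p, w.oid, ⟨w.meth, w.arg, b⟩⟩], hl.append_pending hp
      (fun y hy hyt => hmem ⟨y, hy, hyt⟩) (by simpa using hb),
      ⟨⟨p, w.oid, ⟨w.meth, w.arg, b⟩⟩, by simp, rfl⟩, fun c hc => ?_⟩
    obtain ⟨x, hx, hr⟩ := hcs' c hc
    exact ⟨x, List.mem_append_left _ hx, hr⟩

theorem ListInv.exists_readLin {Spec : Set (List (Operation M A B))} (hI : ListInv Spec L s)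
    {i r : ℕ} (hr : L[i]? = some r) (h : (s.heap r).seq ≠ 0) :
    ∃ cs, ReadLin (s.heap r) cs := by
  rcases i with _ | i
  · rw [hI.zero] at hr
    cases hr
    exact ⟨[], .sentinel _ hI.tail.1⟩
  · obtain ⟨w, l, -, h1, h2, -⟩ := hI.exists_lin hr h
    exact ⟨_, .node _ w l h1 h2⟩

theorem ListInv.exists_next {Spec : Set (List (Operation M A B))} (hI : ListInv Spec L s)
    {i k r r' : ℕ} (hr : L[i]? = some r) (hi : i < k) (hr' : L[k]? = some r')
    (h : (s.heap r').seq ≠ 0) : ∃ x, (s.heap r).next = some x := by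
  obtain ⟨hk, -⟩ := List.getElem?_eq_some_iff.1 hr'
  have hx : L[i + 1]? = some (L[i + 1]'(by omega)) := List.getElem?_eq_getElem _
  exact ⟨_, (hI.linked i r _ hr hx (hI.seq_of_le hr' h hi hx)).1⟩

theorem ConfigInv.exists_step {c : UConfig n M A B} {H : List (Action n Unit M A B)}
    (hI : ConfigInv S.traces L H c) (hnb : S.NonBlocking) {p : Fin n} {m : M} {pc : PC n M A B}
    (hp : c.loc p = some (m, pc)) :
    (∃ b, pc = .done b) ∨ ∃ s' pc', ApplyStep S.traces p c.shared pc s' pc' := by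
  have hpc := hI.pcs p m pc hp
  have hL := hI.list
  cases pc with
  | genID m a =>
    obtain ⟨o, ho⟩ := Infinite.exists_notMem_finset c.shared.usedIds
    exact .inr ⟨_, _, .genID _ m a o ho⟩
  | storeCall v => exact .inr ⟨_, _, .storeCall _ v⟩
  | announce v => exact .inr ⟨_, _, .announce _ v⟩
  | max v i best =>
    rcases hpc.2.1.lt_or_eq with hi | rfl
    · exact .inr ⟨_, _, .maxRead _ v i best hi⟩
    · exact .inr ⟨_, _, .maxDone _ v best⟩
  | loop v =>
    by_cases h : (c.shared.heap (c.shared.announce p)).seq = 0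
    · exact .inr ⟨_, _, .loopEnter _ v h⟩
    · exact .inr ⟨_, _, .loopExit _ v h⟩
  | setBefore v => exact .inr ⟨_, _, .setBefore _ v⟩
  | setHelp v before => exact .inr ⟨_, _, .setHelp _ v before⟩
  | setPrefer v before help => exact .inr ⟨_, _, .setPrefer _ v before help⟩
  | decide v before prefer =>
    rcases hd : (c.shared.heap before).decideNext with _ | after
    · exact .inr ⟨_, _, .decideFirst _ v before prefer hd⟩
    · exact .inr ⟨_, _, .decideLater _ v before prefer after hd⟩
  | readHis v before after => exact .inr ⟨_, _, .readHis _ v before after⟩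
  | casHist v before after h₁ => exact .inr ⟨_, _, .casHist _ v before after h₁⟩
  | genLin v before after =>
    obtain ⟨-, k, -, -, h, hh⟩ := hpc
    exact .inr ⟨_, _, .genLin _ v before after h hh⟩
  | genLinScan v before after h cur cs =>
    obtain ⟨-, k, h1, h2, h3, i, hi, h4, h5⟩ := hpc
    have hb := hL.seq_pred k before after h1 h2
    obtain ⟨cs', hcs⟩ := hL.exists_readLin h4 (hL.seq_of_le h1 hb hi h4)
    by_cases hcb : cur = before
    · subst hcb
      exact .inr ⟨_, _, .genLinLast _ v cur after h cs cs' hcs⟩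
    · have : i < k := by
        refine Nat.lt_of_le_of_ne hi ?_
        rintro rfl
        rw [h1] at h4
        cases h4
        exact hcb rfl
      obtain ⟨nxt, hn⟩ := hL.exists_next h4 this h1 hb
      exact .inr ⟨_, _, .genLinNext _ v before after h cur nxt cs cs' hcb hcs hn⟩
  | genLinChoose v before after h cs =>
    obtain ⟨-, k, h1, h2, h3, h4⟩ := hpc
    obtain ⟨w, hw⟩ := hL.invoc k after h2
    obtain ⟨l, hl⟩ := hL.exists_genLinResult hnb hI.record.nodup hI.record.isHistory h1 h2 h3 hw h4
    exact .inr ⟨_, _, .genLinChoose _ v w before after h cs l hw hl⟩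
  | casLin v before after l => exact .inr ⟨_, _, .casLin _ v before after l⟩
  | setNext v before after => exact .inr ⟨_, _, .setNext _ v before after⟩
  | setSeq v before after => exact .inr ⟨_, _, .setSeq _ v before after⟩
  | setHead v after => exact .inr ⟨_, _, .setHead _ v after⟩
  | finalHead v => exact .inr ⟨_, _, .finalHead _ v⟩
  | getRet v cur =>
    obtain ⟨h0, h1, i, k, hi, h2, h3⟩ := hpc
    by_cases hw : ∃ w, (c.shared.heap cur).inv = some w ∧ w.oid = v.oid
    · obtain ⟨w, hw, ho⟩ := hw
      rcases i with _ | i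
      · rw [hL.zero] at h2
        cases h2
        rw [hL.tail.1] at hw; cases hw
      · obtain ⟨w', l, h, h4, h5, -, h6, -⟩ := hL.exists_lin h2 (hL.seq_of_le h3 h1 hi h2)
        obtain ⟨w'', h7, x, hx, hxt⟩ := h6.own
        rw [hw] at h7
        cases h7
        exact .inr ⟨_, _, .getRetFound _ v w cur l x hw ho h5 hx (hxt.trans ho)⟩
    · have : i < k := by
        refine Nat.lt_of_le_of_ne hi ?_
        rintro rfl
        rw [h2] at h3
        cases h3
        exact hw ⟨v, h0, rfl⟩
      obtain ⟨nxt, hn⟩ := hL.exists_next h2 this h3 h1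
      exact .inr ⟨_, _, .getRetNext _ v cur nxt (fun w h1 h2 => hw ⟨w, h1, h2⟩) hn⟩
  | storeReturn v b => exact .inr ⟨_, _, .storeReturn _ v b⟩
  | done b => exact .inl ⟨b, rfl⟩

theorem ConfigInv.exists_trans {c : UConfig n M A B} {H : List (Action n Unit M A B)}
    (hI : ConfigInv S.traces L H c) (hnb : S.NonBlocking) {p : Fin n} (hp : c.loc p ≠ none) :
    ∃ x c', (universalObject n S.traces).semantics.trans c x c' ∧ x.proc = p := by
  obtain ⟨⟨m, pc⟩, hp⟩ := Option.ne_none_iff_exists'.1 hp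
  rcases hI.exists_step hnb hp with ⟨b, rfl⟩ | ⟨s', pc', hs⟩
  · exact ⟨_, _, ConcObject.Trans.ret c p m (.done b) b hp rfl, rfl⟩
  · exact ⟨_, _, ConcObject.Trans.step c p m pc pc' s' hp hs, rfl⟩

end progress

section termination

variable {n : ℕ} {M A B : Type*}

/-! ### Announced operations are helped -/

/-- What the processes at `pc` know of the node `r` of `p`, which was announced when the list had
at most `K` nodes: when a node at a position `j ≥ K` is `before`, and it is the turn of `p`, then
`r` is preferred unless it is in the list. The turn is that of `p` if `j + 2`, the sequence number
of the successor, is `p` modulo `n`. -/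
def HelpInv (p : Fin n) (r K : ℕ) (L : List ℕ) : PC n M A B → Prop
  | .setPrefer _ before help =>
      ∃ j : ℕ, L[j]? = some before ∧ (K ≤ j → (j + 2) % n = p → help = r)
  | .decide _ before prefer =>
      ∃ j : ℕ, L[j]? = some before ∧ (K ≤ j → (j + 2) % n = p → prefer = r ∨ r ∈ L)
  | _ => True

theorem HelpInv.mono {p : Fin n} {r K : ℕ} {L L' : List ℕ} (hL : L <+: L') {pc : PC n M A B}
    (h : HelpInv p r K L pc) : HelpInv p r K L' pc := by
  cases pc with
  | setPrefer v before help =>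
    obtain ⟨j, h1, h2⟩ := h
    exact ⟨j, getElem?_of_prefix hL h1, h2⟩
  | decide v before prefer =>
    obtain ⟨j, h1, h2⟩ := h
    exact ⟨j, getElem?_of_prefix hL h1, fun h3 h4 => (h2 h3 h4).imp_right fun h => hL.subset h⟩
  | _ => trivial

/-- Since the node `r` of `p` was announced, when the list had at most `K` nodes, it has been
helped whenever it was the turn of `p`. -/
structure Helped (p : Fin n) (r K : ℕ) (L : List ℕ) (c : UConfig n M A B) : Prop where
  owner : c.shared.announce p = r
  visited : ∀ j, K ≤ j → j + 1 < L.length → (j + 2) % n = p → r ∈ L.take (j + 2)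
  help : ∀ q m pc, c.loc q = some (m, pc) → HelpInv p r K L pc

theorem exists_turn (p : Fin n) (K : ℕ) : ∃ t < n, (K + t + 2) % n = p := by
  have hn : 0 < n := p.pos
  refine ⟨(p + n - (K + 2) % n) % n, Nat.mod_lt _ hn, ?_⟩
  have h1 : (K + 2) % n < n := Nat.mod_lt _ hn
  have h2 : (K + (p + n - (K + 2) % n) % n + 2) % n =
      ((K + 2) % n + (p + n - (K + 2) % n)) % n := by
    rw [show K + (p + n - (K + 2) % n) % n + 2 = (K + 2) + (p + n - (K + 2) % n) % n by ring]
    simp [Nat.add_mod]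
  rw [h2, show (K + 2) % n + (p + n - (K + 2) % n) = p + n by omega]
  simp [Nat.mod_eq_of_lt p.isLt]

/-- A position up to which `r` does not occur is at most `K + n`: among any `n` consecutive
positions from `K` on there is one at which it is the turn of `p`. -/
theorem Helped.pos_le {p : Fin n} {r K : ℕ} {L : List ℕ} {c : UConfig n M A B}
    (h : Helped p r K L c) {k x : ℕ} (hk : L[k]? = some x) (hr : r ∉ L.take (k + 1)) :
    k ≤ K + n := by
  by_contra hlt
  obtain ⟨t, ht, hm⟩ := exists_turn p K
  obtain ⟨hk', -⟩ := List.getElem?_eq_some_iff.1 hk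
  have := h.visited (K + t) (by omega) (by omega) hm
  rw [mem_take_iff] at this hr
  obtain ⟨j, hj, hjr⟩ := this
  exact hr ⟨j, by omega, hjr⟩

/-- The control points of a process whose node has been announced. -/
def PC.Announced : PC n M A B → Prop
  | .genID _ _ => False
  | .storeCall _ => False
  | .announce _ => False
  | _ => True

theorem ApplyStep.announced {Spec : Set (List (Operation M A B))} {p : Fin n}
    {s s' : Mem n M A B} {pc pc' : PC n M A B} (hs : ApplyStep Spec p s pc s' pc')
    (h : pc.Announced) : pc'.Announced ∧ s'.announce = s.announce := by
  cases hs <;> first | exact ⟨trivial, rfl⟩ | exact h.elim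

theorem ApplyStep.head_of_ne {Spec : Set (List (Operation M A B))} {p q : Fin n}
    {s s' : Mem n M A B} {pc pc' : PC n M A B} (hs : ApplyStep Spec q s pc s' pc')
    (h : p ≠ q) : s'.head p = s.head p := by
  cases hs <;> first | rfl | exact Function.update_of_ne h ..

variable {Spec : Set (List (Operation M A B))} {L : List ℕ} {H : List (Action n Unit M A B)}
  {c c' : UConfig n M A B} {x : Label n M A B} {s s' : Mem n M A B} {p : Fin n} {r K : ℕ}

/-- A step of a process `q` preserves what it knows of the node `r` that `p` has announced. -/
theorem ListInv.helpInv_step (hI : ListInv Spec L s) (hr : s.announce p = r) {q : Fin n}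
    {pc pc' : PC n M A B} (hp : PCInv Spec q L s pc) (hh : HelpInv p r K L pc)
    (hs : ApplyStep Spec q s pc s' pc') : HelpInv p r K (grow s pc L) pc' := by
  cases hs with
  | setHelp v before =>
    obtain ⟨-, k, h1, h2, -⟩ := hp
    refine ⟨k, h1, fun _ hm => ?_⟩
    have : slot q ((s.heap before).seq + 1) = p := by
      rw [hI.seq_eq k before h1 h2]
      exact Fin.ext hm
    rw [this, hr]
  | setPrefer v before help =>
    obtain ⟨j, h1, h2⟩ := hh
    refine ⟨j, h1, fun hj hm => ?_⟩
    rw [h2 hj hm]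
    split_ifs with h0
    · exact .inl rfl
    · obtain ⟨k, hk⟩ := hI.exists_pos h0
      exact .inr (List.mem_of_getElem? hk)
  | _ => trivial

/-- A step of a process `q` at `pc` preserves that `r` has been helped. -/
theorem ListInv.visited_step (hI : ListInv Spec L s) {q : Fin n}
    {pc : PC n M A B} (hp : PCInv Spec q L s pc) (hh : HelpInv p r K L pc)
    (hv : ∀ j, K ≤ j → j + 1 < L.length → (j + 2) % n = p → r ∈ L.take (j + 2))
    (j : ℕ) (hj : K ≤ j) (hlen : j + 1 < (grow s pc L).length) (hm : (j + 2) % n = p) :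
    r ∈ (grow s pc L).take (j + 2) := by
  by_cases hg : ∃ v before prefer, pc = .decide v before prefer ∧
      (s.heap before).decideNext = none
  · obtain ⟨v, before, prefer, rfl, hd⟩ := hg
    have hg : grow s (.decide v before prefer) L = L ++ [prefer] := by simp [grow, hd]
    rw [hg] at hlen ⊢
    rw [List.length_append, List.length_singleton] at hlen
    by_cases hjl : j + 1 < L.length
    · rw [List.take_append_of_le_length (by omega)]
      exact hv j hj hjl hm
    · obtain ⟨i, h1, h2⟩ := hh
      have hi := hI.length_of_undecided h1 hd
      obtain rfl : i = j := by omega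
      rw [List.take_of_length_le (by simp; omega)]
      rcases h2 hj hm with rfl | h2
      · simp
      · exact List.mem_append_left _ h2
  · have hg' : grow s pc L = L := by
      unfold grow
      split
      · rw [if_neg fun hd => hg ⟨_, _, _, rfl, hd⟩]
      · rfl
    rw [hg'] at hlen ⊢
    exact hv j hj hlen hm

/-- The cases of a transition, from the point of view of a process `p` with a pending
operation. -/
theorem trans_cases {m : M} {pc : PC n M A B} (hp : c.loc p = some (m, pc))
    (hx : (universalObject n Spec).semantics.trans c x c') :
    (x.proc ≠ p ∧ c'.loc p = some (m, pc) ∧ c'.shared.head p = c.shared.head p) ∨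
    (x = .internal p ∧ ∃ pc', ApplyStep Spec p c.shared pc c'.shared pc' ∧
      c'.loc p = some (m, pc')) ∨
    ∃ b, x = .act (.ret p () m b) := by
  cases hx with
  | call q m' a hq =>
    have : q ≠ p := by rintro rfl; rw [hq] at hp; cases hp
    exact .inl ⟨this, by simpa [Function.update_of_ne this.symm] using hp, rfl⟩
  | step q m' l l' s' hq hs =>
    by_cases hqp : q = p
    · subst hqp
      rw [hq] at hp
      cases hp
      exact .inr (.inl ⟨rfl, l', hs, by simp⟩)
    · exact .inl ⟨hqp, by simpa [Function.update_of_ne (Ne.symm hqp)] using hp,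
        hs.head_of_ne (Ne.symm hqp)⟩
  | ret q m' l b hq hr =>
    by_cases hqp : q = p
    · subst hqp
      rw [hq] at hp
      cases hp
      exact .inr (.inr ⟨b, rfl⟩)
    · exact .inl ⟨hqp, by simpa [Function.update_of_ne (Ne.symm hqp)] using hp, rfl⟩

theorem Helped.trans (hI : ConfigInv Spec L H c) (h : Helped p r K L c) {m : M}
    {pc : PC n M A B} (hp : c.loc p = some (m, pc)) (ha : pc.Announced)
    (hx : (universalObject n Spec).semantics.trans c x c') :
    Helped p r K (growConfig c L x) c' := by
  cases hx with
  | call q m' a hq =>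
    refine ⟨h.owner, h.visited, fun q' m₁ pc₁ hq' => ?_⟩
    by_cases hqq : q' = q
    · subst hqq
      simp only [Function.update_self, Option.some.injEq, Prod.mk.injEq] at hq'
      obtain ⟨-, rfl⟩ := hq'
      trivial
    · simp only [Function.update_of_ne hqq] at hq'
      exact h.help q' m₁ pc₁ hq'
  | ret q m' l b hq hr =>
    refine ⟨h.owner, h.visited, fun q' m₁ pc₁ hq' => ?_⟩
    by_cases hqq : q' = q
    · subst hqq
      simp at hq'
    · simp only [Function.update_of_ne hqq] at hq'
      exact h.help q' m₁ pc₁ hq'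
  | step q m' l l' s' hq hs =>
    have hpc := hI.pcs q m' l hq
    have hhelp := h.help q m' l hq
    obtain ⟨-, hE, -, hsame⟩ := hI.list.step hpc hs
    have hg : growConfig c L (.internal q) = grow c.shared l L := by simp [growConfig, hq]
    rw [hg]
    refine ⟨?_, hI.list.visited_step hpc hhelp h.visited, fun q' m₁ pc₁ hq' => ?_⟩
    · by_cases hqp : p = q
      · subst hqp
        rw [hp] at hq
        cases hq
        rw [← h.owner]
        exact congrFun (hs.announced ha).2 p
      · rw [← h.owner]
        exact (hsame p hqp).1
    · by_cases hqq : q' = q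
      · subst hqq
        simp only [Function.update_self, Option.some.injEq, Prod.mk.injEq] at hq'
        obtain ⟨-, rfl⟩ := hq'
        exact hI.list.helpInv_step h.owner hpc hhelp hs
      · simp only [Function.update_of_ne hqq] at hq'
        exact (h.help q' m₁ pc₁ hq').mono hE.list

/-! ### The number of steps of an operation is bounded -/

/-- The sequence number of the node `before` is at most `D - 2`, that of its successor `after` at
most `D - 1`. -/
def Bounded (D : ℕ) (s : Mem n M A B) : PC n M A B → Prop
  | .setHelp _ before => (s.heap before).seq + 2 ≤ D
  | .setPrefer _ before _ => (s.heap before).seq + 2 ≤ D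
  | .decide _ before _ => (s.heap before).seq + 2 ≤ D
  | .readHis _ before _ => (s.heap before).seq + 2 ≤ D
  | .casHist _ before _ _ => (s.heap before).seq + 2 ≤ D
  | .genLin _ before _ => (s.heap before).seq + 2 ≤ D
  | .genLinScan _ before _ _ _ _ => (s.heap before).seq + 2 ≤ D
  | .genLinChoose _ before _ _ _ => (s.heap before).seq + 2 ≤ D
  | .casLin _ before _ _ => (s.heap before).seq + 2 ≤ D
  | .setNext _ before _ => (s.heap before).seq + 2 ≤ D
  | .setSeq _ before _ => (s.heap before).seq + 2 ≤ D
  | .setHead _ after => (s.heap after).seq + 1 ≤ D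
  | _ => True

/-- A bound for the number of remaining steps of `p`, if the sequence numbers are less than `D`:
each iteration of the loop takes less than `D + 20` steps and moves `p` on by one node. -/
def rank (D : ℕ) (p : Fin n) (s : Mem n M A B) : PC n M A B → ℕ
  | .genID _ _ => 0
  | .storeCall _ => 0
  | .announce _ => 0
  | .max _ i _ => D + 4 + D * (D + 20) + (D + 16 + (n - i))
  | .loop _ => D + 4 + (D - (s.heap (s.head p)).seq) * (D + 20) + (D + 15)
  | .setBefore _ => D + 4 + (D - (s.heap (s.head p)).seq) * (D + 20) + (D + 14)
  | .setHelp _ before => D + 4 + (D - (s.heap before).seq) * (D + 20) + (D + 13)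
  | .setPrefer _ before _ => D + 4 + (D - (s.heap before).seq) * (D + 20) + (D + 12)
  | .decide _ before _ => D + 4 + (D - (s.heap before).seq) * (D + 20) + (D + 11)
  | .readHis _ before _ => D + 4 + (D - (s.heap before).seq) * (D + 20) + (D + 10)
  | .casHist _ before _ _ => D + 4 + (D - (s.heap before).seq) * (D + 20) + (D + 9)
  | .genLin _ before _ => D + 4 + (D - (s.heap before).seq) * (D + 20) + (D + 8)
  | .genLinScan _ before _ _ cur _ =>
      D + 4 + (D - (s.heap before).seq) * (D + 20) + (7 + (D - (s.heap cur).seq))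
  | .genLinChoose _ before _ _ _ => D + 4 + (D - (s.heap before).seq) * (D + 20) + 6
  | .casLin _ before _ _ => D + 4 + (D - (s.heap before).seq) * (D + 20) + 5
  | .setNext _ before _ => D + 4 + (D - (s.heap before).seq) * (D + 20) + 4
  | .setSeq _ before _ => D + 4 + (D - (s.heap before).seq) * (D + 20) + 3
  | .setHead _ after => D + 4 + (D + 1 - (s.heap after).seq) * (D + 20) + 2
  | .finalHead _ => D + 3
  | .getRet _ cur => 2 + (D - (s.heap cur).seq)
  | .storeReturn _ _ => 1
  | .done _ => 0

theorem Ext.seq_le {L' : List ℕ} (hE : Ext L s L' s') (r : ℕ) :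
    (s.heap r).seq ≤ (s'.heap r).seq := by
  by_cases h : (s.heap r).seq = 0
  · omega
  · rw [hE.seq r h]

/-- Steps of other processes do not increase the rank. -/
theorem rank_anti {L' : List ℕ} (hE : Ext L s L' s') (hh : s'.head p = s.head p) (D : ℕ)
    (pc : PC n M A B) : rank D p s' pc ≤ rank D p s pc := by
  have h1 : ∀ E r, (E - (s'.heap r).seq) ≤ E - (s.heap r).seq := fun E r =>
    Nat.sub_le_sub_left (hE.seq_le r) E
  have h2 : ∀ E r, (E - (s'.heap r).seq) * (D + 20) ≤ (E - (s.heap r).seq) * (D + 20) :=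
    fun E r => Nat.mul_le_mul_right _ (h1 E r)
  cases pc <;> simp only [rank, hh] <;> first
    | exact le_rfl
    | exact Nat.add_le_add_left (h1 _ _) _
    | exact Nat.add_le_add_right (Nat.add_le_add_left (h2 _ _) _) _
    | exact Nat.add_le_add (Nat.add_le_add_left (h2 _ _) _) (Nat.add_le_add_left (h1 _ _) _)

/-- Steps of other processes do not change the sequence numbers of the nodes at which `p`
works. -/
theorem Bounded.mono {L' : List ℕ} (hI : ListInv Spec L s) (hE : Ext L s L' s') {D : ℕ}
    {pc : PC n M A B} (hp : PCInv Spec p L s pc) (h : Bounded D s pc) : Bounded D s' pc := by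
  cases pc with
  | setHelp v before | setPrefer v before help | decide v before prefer =>
    have hz : (s.heap before).seq ≠ 0 := by
      first
      | (obtain ⟨-, k, -, hz, -⟩ := hp; exact hz)
      | (obtain ⟨-, -, k, -, hz, -⟩ := hp; exact hz)
    simp only [Bounded] at h ⊢
    rwa [hE.seq _ hz]
  | readHis v before after =>
    obtain ⟨-, k, h1, h2⟩ := hp
    simp only [Bounded] at h ⊢
    rwa [hE.seq _ (hI.seq_pred k _ _ h1 h2)]
  | genLin v before after | setNext v before after | casHist v before after h₁
  | genLinScan v before after h cur cs | genLinChoose v before after h cs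
  | casLin v before after l | setSeq v before after =>
    obtain ⟨-, k, h1, h2, -⟩ := hp
    simp only [Bounded] at h ⊢
    rwa [hE.seq _ (hI.seq_pred k _ _ h1 h2)]
  | setHead v after =>
    simp only [Bounded] at h ⊢
    rwa [hE.seq _ hp.2]
  | _ => trivial

/-- Each step of `p` decreases the rank. The hypothesis on `D` bounds the positions that precede
the node announced by `p`; it bounds the whole list as long as this node is not in it. -/
theorem ListInv.rank_step (hI : ListInv Spec L s) {D : ℕ} {pc pc' : PC n M A B}
    (hD : ∀ k x : ℕ, L[k]? = some x → s.announce p ∉ L.take (k + 1) → k + 3 ≤ D)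
    (hp : PCInv Spec p L s pc) (hb : Bounded D s pc) (ha : pc.Announced)
    (hs : ApplyStep Spec p s pc s' pc') :
    rank D p s' pc' < rank D p s pc ∧ Bounded D s' pc' := by
  obtain ⟨-, hE, -, -⟩ := hI.step hp hs
  cases hs with
  | genID | storeCall | announce => exact ha.elim
  | maxRead v i best hi => exact ⟨by simp only [rank]; omega, trivial⟩
  | maxDone v best =>
    refine ⟨?_, trivial⟩
    have := Nat.mul_le_mul_right (D + 20) (Nat.sub_le D (s.heap best).seq)
    simp only [rank, Function.update_self]
    omega
  | loopEnter v h0 => exact ⟨by simp only [rank]; omega, trivial⟩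
  | loopExit v h0 => exact ⟨by simp only [rank]; omega, trivial⟩
  | setBefore v =>
    refine ⟨by simp only [rank]; omega, ?_⟩
    obtain ⟨-, k, h1, h2⟩ := hp
    have := hD k _ h1 h2
    simp only [Bounded]
    rw [hI.seq_eq k _ h1 (hI.head p)]
    omega
  | setHelp v before => exact ⟨by simp only [rank]; omega, hb⟩
  | setPrefer v before help => exact ⟨by simp only [rank]; omega, hb⟩
  | decideFirst v before prefer hd =>
    obtain ⟨-, -, k, -, h2, -⟩ := hp
    have := hE.seq before h2
    simp only [rank, Bounded, this] at hb ⊢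
    exact ⟨by omega, hb⟩
  | decideLater v before prefer after hd => exact ⟨by simp only [rank]; omega, hb⟩
  | readHis v before after => exact ⟨by simp only [rank]; omega, hb⟩
  | casHist v before after h₁ =>
    obtain ⟨-, k, h1, h2, -⟩ := hp
    have := hE.seq before (hI.seq_pred k _ _ h1 h2)
    simp only [rank, Bounded, this] at hb ⊢
    exact ⟨by omega, hb⟩
  | genLin v before after h hh =>
    refine ⟨?_, hb⟩
    simp only [rank, hI.tail.2]
    simp only [Bounded] at hb
    omega
  | genLinNext v before after h cur nxt cs cs' hne hread hnext =>
    refine ⟨?_, hb⟩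
    obtain ⟨-, k, h1, h2, -, i, hi, h4, -⟩ := hp
    have hz := hI.seq_pred k _ _ h1 h2
    have hik : i < k := by
      refine Nat.lt_of_le_of_ne hi ?_
      rintro rfl
      rw [h1] at h4
      cases h4
      exact hne rfl
    have h5 := hI.next_eq i cur nxt h4 hnext
    have e1 := hI.seq_eq k _ h1 hz
    have e2 := hI.seq_eq i _ h4 (hI.seq_of_le h1 hz hi h4)
    have e3 := hI.seq_eq (i + 1) _ h5 (hI.seq_of_le h1 hz hik h5)
    simp only [Bounded] at hb
    simp only [rank, e2, e3]
    omega
  | genLinLast v before after h cs cs' hread => exact ⟨by simp only [rank]; omega, hb⟩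
  | genLinChoose v w before after h cs l hw hres => exact ⟨by simp only [rank]; omega, hb⟩
  | casLin v before after l =>
    obtain ⟨-, k, h1, h2, -⟩ := hp
    have := hE.seq before (hI.seq_pred k _ _ h1 h2)
    simp only [rank, Bounded, this] at hb ⊢
    exact ⟨by omega, hb⟩
  | setNext v before after =>
    obtain ⟨-, k, h1, h2, -⟩ := hp
    have := hE.seq before (hI.seq_pred k _ _ h1 h2)
    simp only [rank, Bounded, this] at hb ⊢
    exact ⟨by omega, hb⟩
  | setSeq v before after =>
    have : ((s.modify after (fun x => { x with seq := (s.heap before).seq + 1 })).heap after).seq =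
        (s.heap before).seq + 1 := by rw [heap_modify, if_pos rfl]
    simp only [rank, Bounded, this] at hb ⊢
    refine ⟨?_, by omega⟩
    rw [Nat.add_sub_add_right]
    omega
  | setHead v after =>
    refine ⟨?_, trivial⟩
    simp only [Bounded] at hb
    simp only [rank, Function.update_self]
    rw [show D + 1 - (s.heap after).seq = D - (s.heap after).seq + 1 by omega, Nat.succ_mul]
    omega
  | finalHead v =>
    refine ⟨?_, trivial⟩
    simp only [rank, hI.tail.2]
    omega
  | getRetNext v cur nxt hne hnext =>
    refine ⟨?_, trivial⟩
    obtain ⟨h0, h1, i, k, hi, h2, h3⟩ := hp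
    have hik : i < k := by
      refine Nat.lt_of_le_of_ne hi ?_
      rintro rfl
      rw [h2] at h3
      cases h3
      exact hne v h0 rfl
    have h5 := hI.next_eq i cur nxt h2 hnext
    have e2 := hI.seq_eq i _ h2 (hI.seq_of_le h3 h1 hi h2)
    have e3 := hI.seq_eq (i + 1) _ h5 (hI.seq_of_le h3 h1 hik h5)
    have := hD i cur h2 (by
      rw [mem_take_iff]
      rintro ⟨j, hj, hj'⟩
      have := nodup_getElem?_unique hI.nodup h3 hj'
      omega)
    simp only [rank, e2, e3]
    omega
  | getRetFound v w cur l x hw hv hl hx hxv => exact ⟨by simp only [rank]; omega, trivial⟩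
  | storeReturn v b => exact ⟨by simp [rank], trivial⟩

/-- An operation that has announced its node returns if its process takes enough steps. -/
theorem exists_return_of_announced {c : ℕ → UConfig n M A B} {x : ℕ → Label n M A B}
    (hx : ∀ i, (universalObject n Spec).semantics.trans (c i) (x i) (c (i + 1)))
    {i : ℕ} (hI : ConfigInv Spec L H (c i)) {p : Fin n} {m : M} {v : Invoc M A} {k best : ℕ}
    (hp : (c i).loc p = some (m, .max v k best)) (hinf : ∀ N, ∃ k, N ≤ k ∧ (x k).proc = p) :
    ∃ (j : ℕ) (b : B), i ≤ j ∧ x j = .act (.ret p () m b) := by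
  by_contra hno
  push Not at hno
  set K := L.length with hK
  set r := (c i).shared.announce p with hr
  set D := K + n + 3 with hD
  have key : ∀ j, ∃ (L : List ℕ) (H : List (Action n Unit M A B)) (pc : PC n M A B),
      ConfigInv Spec L H (c (i + j)) ∧ Helped p r K L (c (i + j)) ∧
      (c (i + j)).loc p = some (m, pc) ∧ pc.Announced ∧ Bounded D (c (i + j)).shared pc := by
    intro j
    induction j with
    | zero =>
      refine ⟨L, H, _, hI, ⟨rfl, fun j hj hj' => by omega, fun q m' pc hq => ?_⟩, hp, trivial,
        trivial⟩
      have hpc := hI.pcs q m' pc hq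
      cases pc with
      | setPrefer v before help =>
        obtain ⟨-, -, j, h1, -⟩ := hpc
        obtain ⟨hj, -⟩ := List.getElem?_eq_some_iff.1 h1
        exact ⟨j, h1, fun h => by omega⟩
      | decide v before prefer =>
        obtain ⟨-, -, j, h1, -⟩ := hpc
        obtain ⟨hj, -⟩ := List.getElem?_eq_some_iff.1 h1
        exact ⟨j, h1, fun h => by omega⟩
      | _ => trivial
    | succ j ih =>
      obtain ⟨L, H, pc, hI, hh, hp, ha, hb⟩ := ih
      have ht := hx (i + j)
      obtain ⟨hI', hE⟩ := hI.trans ht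
      have hh' := hh.trans hI hp ha ht
      rcases trans_cases hp ht with ⟨-, hp', -⟩ | ⟨-, pc', hs, hp'⟩ | ⟨b, hxb⟩
      · exact ⟨_, _, pc, hI', hh', hp', ha, hb.mono hI.list hE (hI.pcs p m pc hp)⟩
      · refine ⟨_, _, pc', hI', hh', hp', (hs.announced ha).1, ?_⟩
        refine (hI.list.rank_step (fun k y hk hy => ?_) (hI.pcs p m pc hp) hb ha hs).2
        rw [hh.owner] at hy
        have := hh.pos_le hk hy
        omega
      · exact absurd hxb (hno _ b (by omega))
  choose L H pc hI hh hp ha hb using key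
  have hdec : ∀ j, rank D p (c (i + (j + 1))).shared (pc (j + 1)) ≤
      rank D p (c (i + j)).shared (pc j) ∧ ((x (i + j)).proc = p →
        rank D p (c (i + (j + 1))).shared (pc (j + 1)) <
          rank D p (c (i + j)).shared (pc j)) := by
    intro j
    have ht := hx (i + j)
    have hloc := hp (j + 1)
    rcases trans_cases (hp j) ht with ⟨hne, hp', hhd⟩ | ⟨-, pc', hs, hp'⟩ | ⟨b, hxb⟩
    · rw [show i + (j + 1) = i + j + 1 by ring] at hloc ⊢
      simp only [hp', Option.some.injEq, Prod.mk.injEq, true_and] at hloc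
      rw [← hloc]
      exact ⟨rank_anti ((hI j).trans ht).2 hhd D _, fun h => absurd h hne⟩
    · rw [show i + (j + 1) = i + j + 1 by ring] at hloc ⊢
      simp only [hp', Option.some.injEq, Prod.mk.injEq, true_and] at hloc
      rw [← hloc]
      have := ((hI j).list.rank_step (fun k y hk hy => by
        rw [(hh j).owner] at hy
        have := (hh j).pos_le hk hy
        omega) ((hI j).pcs p m _ (hp j)) (hb j) (ha j) hs).1
      exact ⟨this.le, fun _ => this⟩
    · exact absurd hxb (hno _ b (by omega))
  have hanti : Antitone fun j => rank D p (c (i + j)).shared (pc j) :=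
    antitone_nat_of_succ_le fun j => (hdec j).1
  have hlt : ∀ N, ∃ j, rank D p (c (i + j)).shared (pc j) + N ≤
      rank D p (c (i + 0)).shared (pc 0) := by
    intro N
    induction N with
    | zero => exact ⟨0, le_rfl⟩
    | succ N ih =>
      obtain ⟨j, hj⟩ := ih
      obtain ⟨k, hk, hkp⟩ := hinf (i + j)
      obtain ⟨k, rfl⟩ := Nat.exists_eq_add_of_le (show i ≤ k by omega)
      have h1 := (hdec k).2 hkp
      have h2 := hanti (show j ≤ k by omega)
      simp only at h2
      exact ⟨k + 1, by omega⟩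
  obtain ⟨j, hj⟩ := hlt (rank D p (c (i + 0)).shared (pc 0) + 1)
  omega

/-- A process that takes another step and does not return takes an internal step. -/
theorem exists_next_step {c : ℕ → UConfig n M A B} {x : ℕ → Label n M A B}
    (hx : ∀ i, (universalObject n Spec).semantics.trans (c i) (x i) (c (i + 1)))
    {i : ℕ} {p : Fin n} {m : M} {pc : PC n M A B}
    (hp : (c i).loc p = some (m, pc)) (hinf : ∀ N, ∃ k, N ≤ k ∧ (x k).proc = p)
    (hno : ∀ (j : ℕ) (b : B), i ≤ j → x j ≠ .act (.ret p () m b)) :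
    ∃ j pc', i ≤ j ∧ ApplyStep Spec p (c j).shared pc (c (j + 1)).shared pc' ∧
      (c (j + 1)).loc p = some (m, pc') := by
  classical
  have hex : ∃ k, (x (i + k)).proc = p := by
    obtain ⟨k, hk, hkp⟩ := hinf i
    obtain ⟨k, rfl⟩ := Nat.exists_eq_add_of_le hk
    exact ⟨k, hkp⟩
  have hloc : ∀ j, j ≤ Nat.find hex → (c (i + j)).loc p = some (m, pc) := by
    intro j hj
    induction j with
    | zero => exact hp
    | succ j ih =>
      rcases trans_cases (ih (by omega)) (hx (i + j)) with ⟨-, h, -⟩ | ⟨h, -⟩ | ⟨b, h⟩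
      · exact h
      · exact absurd (by rw [h]; rfl) (Nat.find_min hex (m := j) (by omega))
      · exact absurd h (hno _ b (by omega))
  rcases trans_cases (hloc _ le_rfl) (hx (i + Nat.find hex)) with ⟨h, -⟩ | ⟨-, pc', hs, h⟩ | ⟨b, h⟩
  · exact absurd (Nat.find_spec hex) h
  · exact ⟨_, pc', by omega, hs, h⟩
  · exact absurd h (hno _ b (by omega))

theorem universalObject_waitFree {Q : Type*} {S : LTS Q (Operation M A B)}
    (hnb : S.NonBlocking) : (universalObject n S.traces).WaitFree := by
  refine ⟨fun c x hpath i p m a hi hinf => ?_, fun c hc p hp => ?_⟩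
  · have hx := hpath.2
    have hinv : ∀ j, ∃ L H, ConfigInv S.traces L H (c j) := by
      intro j
      induction j with
      | zero => rw [hpath.1]; exact ⟨_, _, .init⟩
      | succ j ih =>
        obtain ⟨L, H, h⟩ := ih
        exact ⟨_, _, (h.trans (hx j)).1⟩
    by_contra hno
    push Not at hno
    have h0 : (c (i + 1)).loc p = some (m, .genID m a) := by
      have := hx i
      rw [hi] at this
      generalize c (i + 1) = c' at this
      cases this
      simp [universalObject]
    obtain ⟨j₁, pc₁, hj₁, hs₁, h1⟩ := exists_next_step hx h0 hinf fun j b hj => hno j b hj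
    generalize (c (j₁ + 1)).shared = s at hs₁
    cases hs₁
    obtain ⟨j₂, pc₂, hj₂, hs₂, h2⟩ := exists_next_step hx h1 hinf
      fun j b hj => hno j b (by omega)
    generalize (c (j₂ + 1)).shared = s at hs₂
    cases hs₂
    obtain ⟨j₃, pc₃, hj₃, hs₃, h3⟩ := exists_next_step hx h2 hinf
      fun j b hj => hno j b (by omega)
    generalize (c (j₃ + 1)).shared = s at hs₃
    cases hs₃
    obtain ⟨L, H, hI⟩ := hinv (j₃ + 1)
    obtain ⟨j, b, hj, hb⟩ := exists_return_of_announced hx hI h3 hinf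
    exact hno j b (by omega) hb
  · obtain ⟨e, he⟩ := hc
    obtain ⟨L, hI⟩ := ConfigInv.run he .init
    exact hI.exists_trans hnb hp

end termination

end UnivConstr

theorem lemma1 {M A B Q : Type*} (n : ℕ) (S : UnivConstr.LTS Q (UnivConstr.Operation M A B))
    (hdet : S.Deterministic) (hnb : S.NonBlocking) :
    (UnivConstr.universalObject n S.traces).WaitFree ∧
      (UnivConstr.universalObject n S.traces).Linearizable S.traces :=
  ⟨UnivConstr.universalObject_waitFree hnb,
    UnivConstr.universalObject_linearizable ⟨S.init, .nil _⟩⟩
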